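/- Let $K$ be a field of characteristic $0$, let $d\ge 2$, let $L_d$ be the free Lie algebra over $K$ on $x_1,\dots,x_d$, and let $M_d=L_d/L_d''$ be the free metabelian Lie algebra, where $L_d''=[[L_d,L_d],[L_d,L_d]]$. A Weitzenböck derivation of $M_d$ is a derivation $\delta$ which maps $KX_d=\operatorname{span}(x_1,\dots,x_d)$ into itself and acts on it as a nonzero nilpotent operator. Write $\delta=\delta(p_1,\dots,p_s)$, $p_1\ge\cdots\ge p_s\ge 0$, if the Jordan normal form of $\delta$ on $KX_d$ consists of nilpotent cells of sizes $p_1+1,\dots,p_s+1$, i.e. if $KX_d$ has a Jordan basis $e_{i,k}$ ($1\le i\le s$, $0\le k\le p_i$) with $\delta(e_{i,0})=0$ and $\delta(e_{i,k+1})=e_{i,k}$. Let $M_d^\delta=\ker\delta$. Put $$H(M_d^\delta,z)=\sum_{n\ge0}\dim\bigl(M_d^\delta\cap M_d^{(n)}\bigr)z^n ,$$ where $M_d^{(n)}$ is spanned by the Lie monomials of length $n$ in $x_1,\dots,x_d$. For a given Jordan basis $(e_{i,k})$ put $$H_{GL_2}(M_d^\delta,t_1,t_2,z)=\sum_{n,n_1,n_2\ge0}\dim\bigl(M_d^\delta\cap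 M_d^{(n_1,n_2,n)}\bigr)t_1^{n_1}t_2^{n_2}z^n ,$$ where $M_d^{(n_1,n_2,n)}$ is spanned by the Lie monomials of length $n$ in the $e_{i,k}$ whose total bidegree is $(n_1,n_2)$, $e_{i,k}$ having bidegree $(p_i-k,k)$. If $2\le d\le 6$ and $\delta=\delta(p_1,\dots,p_s)$ is a Weitzenböck derivation without $1\times1$ Jordan cells (all $p_i\ge1$), then $\delta$ is one of $\delta(1)$ ($d=2$); $\delta(2)$ ($d=3$); $\delta(3)$, $\delta(1,1)$ ($d=4$); $\delta(4)$, $\delta(2,1)$ ($d=5$); $\delta(5)$, $\delta(3,1)$, $\delta(2,2)$, $\delta(1,1,1)$ ($d=6$). The Hilbert series, as formal power series, are the following. Bigraded, for every Jordan basis: $$\delta(1):\quad H_{GL_2}=t_1z+\frac{t_1t_2z^2}{1-t_1z},$$ $$\delta(2):\quad H_{GL_2}=t_1^2z+\frac{t_1^3t_2z^2}{(1-t_1^2z)(1-t_1t_2z)},$$ $$\delta(3):\quad H_{GL_2}=t_1^3z+\frac{t_1^3t_2z^2(t_1^2+t_2^2+t_1^4t_2^4z^2+t_1^5t_2^6z^3-t_1^8t_2^6z^4)}{(1-t_1^3z)(1-t_1^2t_2z)(1-t_1^6t_2^6z^4)},$$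 $$\delta(1,1):\quad H_{GL_2}=2t_1z+\frac{t_1z^2(t_1+3t_2-t_1^2t_2z^2)}{(1-t_1z)^2(1-t_1t_2z^2)},$$ $$\delta(1,1,1):\quad H_{GL_2}=3t_1z+\frac{t_1z^2\,q(t_1,t_2,z)}{(1-t_1z)^3(1-t_1t_2z^2)^3},$$ where $$q=3(t_1+2t_2)+t_1(-t_1+t_2)z-9t_1^2t_2z^2+3t_1^2t_2(-3t_2+t_1)z^3+t_1^2t_2^2(9t_1-t_2)z^4+3t_1^3t_2^2(t_2-t_1)z^5-3t_1^4t_2^3z^6+t_1^5t_2^3z^7.$$ Graded: $$\delta(1):\quad H=z+\frac{z^2}{1-z},\qquad \delta(2):\quad H=z+\frac{z^2}{(1-z)^2},$$ $$\delta(3):\quad H=z+\frac{z^2(2+z^2+z^3-z^4)}{(1-z)^2(1-z^4)},\qquad \delta(1,1):\quad H=2z+\frac{z^2(4-z^2)}{(1-z)^2(1-z^2)},$$ $$\delta(4):\quad H=z+\frac{z^2(2+2z+z^2-2z^4+z^5)}{(1-z)^2(1-z^2)(1-z^3)},$$ $$\delta(2,1):\quad H=2z+\frac{z^2(4+2z^2-3z^3+z^4)}{(1-z)^3(1-z^3)},$$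 $$\delta(5):\quad H=z+\frac{p(z)}{(1-z)^2(1-z^4)(1-z^6)(1-z^8)},$$ where $$p(z)=z^2(3+3z+7z^2+10z^3+11z^4+14z^5+13z^6+16z^7+12z^8+8z^9+10z^{10}+3z^{11}+5z^{12}-z^{13}+z^{14}-z^{16}+2z^{17}-z^{18}),$$ $$\delta(3,1):\quad H=2z+\frac{z^2(5+6z+8z^2+11z^3+5z^4-2z^5+3z^6-2z^7+2z^9-z^{10})}{(1-z)^2(1-z^2)(1-z^4)^2},$$ $$\delta(2,2):\quad H=2z+\frac{z^2(5+8z-6z^3+2z^4+2z^5-z^6)}{(1-z)^2(1-z^2)^3},$$ $$\delta(1,1,1):\quad H=3z+\frac{z^2(9+9z-6z^3+2z^4+2z^5-z^6)}{(1-z)^2(1-z^2)^3}.$$ -/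

import Mathlib

namespace FreeMetabelian

/-- The free metabelian Lie algebra `L_d / L_d''`, where `L_d` is the free Lie algebra on
`d` generators and `L_d'' = [[L_d, L_d], [L_d, L_d]]`. -/
noncomputable abbrev Alg (K : Type*) [Field K] (d : ℕ) : Type _ :=
  FreeLieAlgebra K (Fin d) ⧸ LieAlgebra.derivedSeries K (FreeLieAlgebra K (Fin d)) 2

/-- The free generators `x_1, …, x_d` of `L_d / L_d''`. -/
noncomputable def gen (K : Type*) [Field K] (d : ℕ) (j : Fin d) : Alg K d :=
  LieSubmodule.Quotient.mk (FreeLieAlgebra.of K j)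

/-- The vector space `K X_d` spanned by the free generators. -/
noncomputable def linearPart (K : Type*) [Field K] (d : ℕ) : Submodule K (Alg K d) :=
  Submodule.span K (Set.range (gen K d))

/-- A Weitzenböck derivation: a derivation that acts on `K X_d` as a nonzero nilpotent
linear operator. -/
structure IsWeitzenbock {K : Type*} [Field K] {d : ℕ}
    (δ : LieDerivation K (Alg K d) (Alg K d)) : Prop where
  mapsTo : ∀ v ∈ linearPart K d, δ v ∈ linearPart K d
  nilpotent : ∃ n : ℕ, ∀ v ∈ linearPart K d, (δ : Alg K d → Alg K d)^[n] v = 0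
  nonzero : ∃ v ∈ linearPart K d, δ v ≠ 0

/-- Positions in a Jordan basis with cells of sizes `p_1 + 1, …, p_s + 1`: the `k`-th vector
(`0 ≤ k ≤ p_i`) of the `i`-th cell. -/
abbrev CellIndex (p : List ℕ) : Type :=
  (i : Fin p.length) × Fin (p.get i + 1)

/-- `e` is a Jordan basis of `K X_d` for `δ`, with nilpotent Jordan cells of sizes
`p_1 + 1, …, p_s + 1`: in each cell `δ` kills the first vector and maps each further vector
to the preceding one. -/
structure IsJordanBasis {K : Type*} [Field K] {d : ℕ}
    (δ : LieDerivation K (Alg K d) (Alg K d)) (p : List ℕ) (e : CellIndex p → Alg K d) :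
    Prop where
  linearIndependent : LinearIndependent K e
  span_eq : Submodule.span K (Set.range e) = linearPart K d
  map_zero : ∀ i : Fin p.length, δ (e ⟨i, 0⟩) = 0
  map_succ : ∀ (i : Fin p.length) (k : Fin (p.get i)), δ (e ⟨i, k.succ⟩) = e ⟨i, k.castSucc⟩

/-- `δ = δ(p_1, …, p_s)`: `p_1 ≥ … ≥ p_s` and the action of `δ` on `K X_d` has Jordan normal
form with nilpotent cells of sizes `p_1 + 1, …, p_s + 1`. -/
def HasJordanCells {K : Type*} [Field K] {d : ℕ}
    (δ : LieDerivation K (Alg K d) (Alg K d)) (p : List ℕ) : Prop :=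
  p.Pairwise (fun a b => b ≤ a) ∧ ∃ e : CellIndex p → Alg K d, IsJordanBasis δ p e

/-- The value of a nonassociative monomial, with arbitrary bracketing, in the elements `e`. -/
def lieMonomial {ι L : Type*} [Bracket L L] (e : ι → L) : FreeMagma ι → L
  | .of i => e i
  | .mul a b => ⁅lieMonomial e a, lieMonomial e b⁆

/-- The weight of a nonassociative monomial whose variables have weights `w`. -/
def weight {ι A : Type*} [Add A] (w : ι → A) : FreeMagma ι → A
  | .of i => w i
  | .mul a b => weight w a + weight w b

/-- The component of degree `n` of `L_d / L_d''`: linear combinations of Lie monomials of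
length `n` in the generators. -/
noncomputable def component (K : Type*) [Field K] (d n : ℕ) : Submodule K (Alg K d) :=
  Submodule.span K (lieMonomial (gen K d) '' {m | m.length = n})

/-- The `k`-th vector (`0 ≤ k ≤ p_i`) of the `i`-th Jordan cell has bidegree `(p_i - k, k)`. -/
def bidegree (p : List ℕ) (c : CellIndex p) : ℕ × ℕ :=
  (p.get c.1 - c.2, c.2)

/-- The component of bidegree `(n₁, n₂)` and total degree `n` with respect to `e`: linear
combinations of Lie monomials of length `n` and of bidegree `(n₁, n₂)` in the elements `e`. -/
noncomputable def bicomponent {K : Type*} [Field K] {d : ℕ} (p : List ℕ) (e : CellIndex p → Alg K d)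
    (n₁ n₂ n : ℕ) : Submodule K (Alg K d) :=
  Submodule.span K
    (lieMonomial e '' {m | m.length = n ∧ weight (bidegree p) m = (n₁, n₂)})

/-- The homogeneous component of degree `n` of the algebra of constants of `δ`. -/
noncomputable def constants {K : Type*} [Field K] {d : ℕ} (δ : LieDerivation K (Alg K d) (Alg K d))
    (n : ℕ) : Submodule K (Alg K d) :=
  LinearMap.ker (δ : Alg K d →ₗ[K] Alg K d) ⊓ component K d n

/-- The component of bidegree `(n₁, n₂)` and total degree `n` of the algebra of constants
of `δ`, with respect to `e`. -/
noncomputable def biconstants {K : Type*} [Field K] {d : ℕ} (δ : LieDerivation K (Alg K d) (Alg K d))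
    (p : List ℕ) (e : CellIndex p → Alg K d) (n₁ n₂ n : ℕ) : Submodule K (Alg K d) :=
  LinearMap.ker (δ : Alg K d →ₗ[K] Alg K d) ⊓ bicomponent p e n₁ n₂ n

/-- There are finitely many nonassociative monomials of a given length. -/
theorem finite_length_eq {ι : Type*} [Finite ι] (n : ℕ) :
    {m : FreeMagma ι | m.length = n}.Finite := by
  induction n using Nat.strong_induction_on with
  | _ n ih =>
    have hfin : ((Set.range (FreeMagma.of : ι → FreeMagma ι)) ∪
        ⋃ q ∈ (Set.Iio n ×ˢ Set.Iio n : Set (ℕ × ℕ)),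
          Set.image2 (fun a b : FreeMagma ι => a * b)
            {m | m.length = q.1} {m | m.length = q.2}).Finite := by
      refine (Set.finite_range _).union (Set.Finite.biUnion
        ((Set.finite_Iio n).prod (Set.finite_Iio n)) ?_)
      rintro ⟨a, b⟩ ⟨ha, hb⟩
      exact Set.Finite.image2 _ (ih a ha) (ih b hb)
    refine hfin.subset ?_
    rintro m hm
    cases m with
    | of i => exact Or.inl ⟨i, rfl⟩
    | mul a b =>
      have ha := a.length_pos
      have hb := b.length_pos
      have hab : a.length + b.length = n := hm
      refine Or.inr (Set.mem_biUnion (x := (a.length, b.length)) ⟨?_, ?_⟩ ?_)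
      · change a.length < n
        omega
      · change b.length < n
        omega
      · exact ⟨a, rfl, b, rfl, rfl⟩

/-- The graded components of the algebra of constants are finite dimensional. -/
theorem finite_constants {K : Type*} [Field K] {d : ℕ}
    (δ : LieDerivation K (Alg K d) (Alg K d)) (n : ℕ) : Module.Finite K (constants δ n) := by
  have : Module.Finite K (component K d n) :=
    Module.Finite.span_of_finite K ((finite_length_eq n).image _)
  exact Submodule.finiteDimensional_of_le (S₂ := component K d n) inf_le_right

/-- The bigraded components of the algebra of constants are finite dimensional. -/
theorem finite_biconstants {K : Type*} [Field K] {d : ℕ}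
    (δ : LieDerivation K (Alg K d) (Alg K d)) (p : List ℕ) (e : CellIndex p → Alg K d)
    (n₁ n₂ n : ℕ) : Module.Finite K (biconstants δ p e n₁ n₂ n) := by
  have : Module.Finite K (bicomponent p e n₁ n₂ n) :=
    Module.Finite.span_of_finite K
      (((finite_length_eq n).subset (fun _ h => h.1)).image _)
  exact Submodule.finiteDimensional_of_le (S₂ := bicomponent p e n₁ n₂ n) inf_le_right

/-- The Hilbert series `H((L_d / L_d'')^δ, z)`. -/
noncomputable def hilbertSeries {K : Type*} [Field K] {d : ℕ}
    (δ : LieDerivation K (Alg K d) (Alg K d)) : PowerSeries ℚ :=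
  PowerSeries.mk fun n => (Module.finrank K (constants δ n) : ℚ)

/-- The bigraded Hilbert series `H_{GL_2}((L_d / L_d'')^δ, t₁, t₂, z)`, a power series in the
variables `t₁ = X 0`, `t₂ = X 1`, `z = X 2`. -/
noncomputable def bigradedHilbertSeries {K : Type*} [Field K] {d : ℕ}
    (δ : LieDerivation K (Alg K d) (Alg K d)) (p : List ℕ) (e : CellIndex p → Alg K d) :
    MvPowerSeries (Fin 3) ℚ :=
  fun m => (Module.finrank K (biconstants δ p e (m 0) (m 1) (m 2)) : ℚ)

end FreeMetabelian

open FreeMetabelian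

/-!
The proof reduces the constants of `δ` to vectors of highest weight in spaces of differential forms
and then to a count of monomials.

Let `e_c` be a Jordan basis. It is a system of free generators, so there is a homomorphism `φ`, the
Magnus embedding (`exists_magnus_embedding`), to the semidirect sum of the polynomial ring
`S = K[x_c]` and its module of differential forms `∑ ω_c dx_c`, with `φ e_c = x_c + dx_c`. The
derived algebra is mapped into the kernel of the contraction `∑ ω_c dx_c ↦ ∑ ω_c x_c`
(`fst_lieMonomial`). Conversely the derived algebra is an `S`-module through `ad e_c`, and
`f dx_c ↦ ∑_b (∂f/∂x_b) ⁅e_b, e_c⁆` (`exteriorMap`) is, in degree `n ≥ 2`, `n` times the inverse of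
the embedding: in one direction this is an induction on left-normed monomials
(`exteriorMap_snd_lieMonomial`), in the other it is Cartan's formula for the Euler vector field
(`snd_exteriorMap`). Hence `map_weightSpan`: the elements of given weight correspond to the forms of
that weight which the contraction kills, and the contraction is onto by Euler's identity, so their
dimension is a difference of numbers of monomials (`finrank_magnusForms_add`).

Under the embedding `δ` becomes the Lie derivative along a linear vector field
(`map_derivation_lieMonomial`). Its matrix, a sum of Jordan cells, is the raising operator of an
`sl₂`-triple (`raiseMatrix_lowerMatrix`), so it is injective on negative and surjective onto
positive weights (`raise_injective`, `raise_surjective`). The dimension of the space of constants of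
bidegree `(n₁, n₂)` with `n₁ ≥ n₂` is therefore the difference of the dimensions of the weight
spaces of bidegrees `(n₁, n₂)` and `(n₁ + 1, n₂ - 1)`, and in total degree `n` there are as many
constants as there are forms of `sl₂`-weight `0` or `1` (`IsJordanBasis.finrank_biconstants`,
`IsJordanBasis.finrank_constants`).

What is left are identities of generating functions. The graded series is the constant term in `u`
of `(1 + u⁻¹) (V z - 1) F`, up to the terms of degrees zero and one, where `V` is the sum and `F`
the product of the geometric series of the variables (`IsJordanBasis.hilbertSeries_eq`). It is read
off from a partial fraction decomposition into a part without `u`, a part with positive and a part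
with negative powers of `u`. The bigraded series `R` is characterized by
`(t₁ - t₂) 𝒩 = t₁ R - t₂ R'`, where `𝒩` is the generating function of the dimensions of the weight
spaces, `R'` is `R` with `t₁` and `t₂` exchanged, and `R` is supported at `n₁ ≥ n₂`
(`IsJordanBasis.bigradedHilbertSeries_eq_of_antisymm`). In each case these are polynomial identities
once the denominators are cleared.
-/

namespace FreeMetabelian

/-! ### The target of the Magnus embedding -/

section Semidirect

open MvPolynomial

/-- The semidirect sum of an abelian Lie algebra `S` and an abelian ideal `N`, where `S` is a
commutative ring acting on the `S`-module `N` by multiplication: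
`⁅(a, x), (b, y)⁆ = (0, a y - b x)`. For `S` a polynomial ring and `N` its module of differentials
it contains the free metabelian Lie algebra (the Magnus embedding). -/
def MagnusAlgebra (S N : Type*) : Type _ := S × N

namespace MagnusAlgebra

variable {S N : Type*}

theorem ext {u v : MagnusAlgebra S N} (h₁ : u.1 = v.1) (h₂ : u.2 = v.2) : u = v :=
  Prod.ext h₁ h₂

variable [CommRing S] [AddCommGroup N]

instance : AddCommGroup (MagnusAlgebra S N) := inferInstanceAs (AddCommGroup (S × N))

theorem fst_add (u v : MagnusAlgebra S N) : (u + v).1 = u.1 + v.1 := rfl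

theorem snd_add (u v : MagnusAlgebra S N) : (u + v).2 = u.2 + v.2 := rfl

section

variable {K : Type*} [CommRing K] [Algebra K S] [Module K N]

instance : Module K (MagnusAlgebra S N) :=
  inferInstanceAs (Module K (S × N))

theorem fst_smul (r : K) (u : MagnusAlgebra S N) : (r • u).1 = r • u.1 := rfl

theorem snd_smul (r : K) (u : MagnusAlgebra S N) : (r • u).2 = r • u.2 := rfl

variable (K S N)

/-- The projection of `MagnusAlgebra S N` to the ideal `N`. -/
def sndₗ : MagnusAlgebra S N →ₗ[K] N := LinearMap.snd K S N

variable {K S N}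

theorem sndₗ_apply (u : MagnusAlgebra S N) : sndₗ S N K u = u.2 := rfl

end

variable [Module S N]

instance : Bracket (MagnusAlgebra S N) (MagnusAlgebra S N) :=
  ⟨fun u v => (0, u.1 • v.2 - v.1 • u.2)⟩

theorem fst_lie (u v : MagnusAlgebra S N) : ⁅u, v⁆.1 = 0 := rfl

theorem snd_lie (u v : MagnusAlgebra S N) : ⁅u, v⁆.2 = u.1 • v.2 - v.1 • u.2 := rfl

instance : LieRing (MagnusAlgebra S N) where
  add_lie u v t := by
    apply ext
    · simp [fst_add, fst_lie]
    · simp only [snd_add, snd_lie, fst_add]; module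
  lie_add u v t := by
    apply ext
    · simp [fst_add, fst_lie]
    · simp only [snd_add, snd_lie, fst_add]; module
  lie_self u := by
    apply ext
    · rfl
    · rw [snd_lie, sub_self]; rfl
  leibniz_lie u v t := by
    apply ext
    · simp [fst_add, fst_lie]
    · simp only [snd_add, snd_lie, fst_lie]; module

variable {K : Type*} [CommRing K] [Algebra K S] [Module K N]

instance [IsScalarTower K S N] : LieAlgebra K (MagnusAlgebra S N) where
  lie_smul r u v := by
    apply ext
    · simp [fst_smul, fst_lie]
    · simp only [snd_smul, snd_lie, fst_smul]
      rw [smul_sub, smul_assoc, ← algebraMap_smul S r v.2, ← algebraMap_smul S r (u.1 • v.2),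
        smul_smul, smul_smul, mul_comm]

theorem fst_eq_zero_of_mem_derivedSeries_one [IsScalarTower K S N] {u : MagnusAlgebra S N}
    (hu : u ∈ LieAlgebra.derivedSeries K (MagnusAlgebra S N) 1) : u.1 = 0 := by
  let I : LieIdeal K (MagnusAlgebra S N) :=
    { LinearMap.ker (LinearMap.fst K S N) with
      lie_mem := fun {_ _} _ => rfl }
  have h1 : LieAlgebra.derivedSeries K (MagnusAlgebra S N) 1 ≤ I := by
    rw [LieAlgebra.derivedSeries_def, LieAlgebra.derivedSeriesOfIdeal_succ, LieSubmodule.lie_le_iff]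
    intro u _ v _
    exact rfl
  exact h1 hu

/-- `MagnusAlgebra S N` is metabelian. -/
theorem derivedSeries_two_eq_bot [IsScalarTower K S N] :
    LieAlgebra.derivedSeries K (MagnusAlgebra S N) 2 = ⊥ := by
  rw [LieAlgebra.derivedSeries_def, LieAlgebra.derivedSeriesOfIdeal_succ,
    LieSubmodule.lie_eq_bot_iff]
  intro u hu v hv
  apply ext
  · rfl
  · rw [snd_lie, fst_eq_zero_of_mem_derivedSeries_one (K := K) hu,
      fst_eq_zero_of_mem_derivedSeries_one (K := K) hv, zero_smul, zero_smul, sub_zero]; rfl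

end MagnusAlgebra

end Semidirect

/-! ### The free metabelian Lie algebra -/

section Free

open MvPolynomial

variable {K : Type*} [Field K] {d : ℕ}

theorem lie_mem_derivedSeries_one {L : Type*} [LieRing L] [LieAlgebra K L] (a b : L) :
    ⁅a, b⁆ ∈ LieAlgebra.derivedSeries K L 1 := by
  rw [LieAlgebra.derivedSeries_def, LieAlgebra.derivedSeriesOfIdeal_succ,
    LieAlgebra.derivedSeriesOfIdeal_zero]
  exact LieSubmodule.lie_mem_lie (LieSubmodule.mem_top a) (LieSubmodule.mem_top b)

/-- The free metabelian Lie algebra is metabelian. -/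
theorem derivedSeries_two_eq_bot : LieAlgebra.derivedSeries K (Alg K d) 2 = ⊥ := by
  let f : FreeLieAlgebra K (Fin d) →ₗ⁅K⁆ Alg K d :=
    { (LieSubmodule.Quotient.mk' (LieAlgebra.derivedSeries K (FreeLieAlgebra K (Fin d)) 2) :
        FreeLieAlgebra K (Fin d) →ₗ[K] Alg K d) with
      map_lie' := fun {_ _} => rfl }
  have hf : Function.Surjective f := LieSubmodule.Quotient.surjective_mk' _
  rw [← LieIdeal.derivedSeries_map_eq (f := f) 2 hf, LieIdeal.map_eq_bot_iff]
  intro x hx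
  rw [LieHom.mem_ker]
  exact (LieSubmodule.Quotient.mk_eq_zero').2 hx

theorem lie_eq_zero_of_mem_derivedSeries_one {u v : Alg K d}
    (hu : u ∈ LieAlgebra.derivedSeries K (Alg K d) 1)
    (hv : v ∈ LieAlgebra.derivedSeries K (Alg K d) 1) : ⁅u, v⁆ = 0 := by
  have h : ⁅u, v⁆ ∈ LieAlgebra.derivedSeries K (Alg K d) 2 := by
    exact LieSubmodule.lie_mem_lie hu hv
  rwa [derivedSeries_two_eq_bot, LieSubmodule.mem_bot] at h

/-- The universal property of the free metabelian Lie algebra. -/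
theorem exists_lieHom_gen {L : Type*} [LieRing L] [LieAlgebra K L]
    (hL : LieAlgebra.derivedSeries K L 2 = ⊥) (v : Fin d → L) :
    ∃ φ : Alg K d →ₗ⁅K⁆ L, ∀ j, φ (gen K d j) = v j := by
  let f := FreeLieAlgebra.lift K v
  have hker : (LieAlgebra.derivedSeries K (FreeLieAlgebra K (Fin d)) 2).toSubmodule ≤
      LinearMap.ker (f : FreeLieAlgebra K (Fin d) →ₗ[K] L) := by
    intro x hx
    have := LieIdeal.derivedSeries_map_le (f := f) 2 (LieIdeal.mem_map (f := f) hx)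
    rwa [hL, LieSubmodule.mem_bot] at this
  refine ⟨{ Submodule.liftQ _ (f : FreeLieAlgebra K (Fin d) →ₗ[K] L) hker with
    map_lie' := ?_ }, fun j => FreeLieAlgebra.lift_of_apply v j⟩
  intro x y
  induction x using Submodule.Quotient.induction_on
  induction y using Submodule.Quotient.induction_on
  exact LieHom.map_lie f _ _

end Free

/-! ### Weights of Lie monomials -/

section Monomials

open MvPolynomial

variable {ι L G : Type*}

theorem weight_map {A B : Type*} [AddMonoid A] [AddMonoid B] (f : A →+ B) (w : ι → A)
    (m : FreeMagma ι) : weight (fun i => f (w i)) m = f (weight w m) := by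
  induction m using FreeMagma.rec with
  | of i => rfl
  | mul a b ha hb => exact (congrArg₂ (· + ·) ha hb).trans (map_add f _ _).symm

theorem weight_one (m : FreeMagma ι) : weight (fun _ => (1 : ℕ)) m = m.length := by
  induction m using FreeMagma.rec with
  | of i => rfl
  | mul a b ha hb => exact congrArg₂ (· + ·) ha hb

variable {K : Type*} [Field K] [LieRing L] [LieAlgebra K L] [AddCommMonoid G]

variable (K) in
/-- The space of linear combinations of Lie monomials of weight `g` in the elements `e`, where
`e i` has weight `w i`. -/
def weightSpan (w : ι → G) (e : ι → L) (g : G) : Submodule K L :=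
  Submodule.span K (lieMonomial e '' {m | weight w m = g})

theorem lie_mem_weightSpan {w : ι → G} {e : ι → L} {g h : G} {u v : L}
    (hu : u ∈ weightSpan K w e g) (hv : v ∈ weightSpan K w e h) :
    ⁅u, v⁆ ∈ weightSpan K w e (g + h) := by
  induction hu using Submodule.span_induction with
  | zero => rw [zero_lie]; exact zero_mem _
  | add a b _ _ ha hb => rw [add_lie]; exact add_mem ha hb
  | smul r a _ ha => rw [smul_lie]; exact Submodule.smul_mem _ r ha
  | mem a ha =>
    obtain ⟨m, hm, rfl⟩ := ha
    induction hv using Submodule.span_induction with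
    | zero => rw [lie_zero]; exact zero_mem _
    | add a b _ _ ha hb => rw [lie_add]; exact add_mem ha hb
    | smul r a _ ha => rw [lie_smul]; exact Submodule.smul_mem _ r ha
    | mem b hb =>
      obtain ⟨m', hm', rfl⟩ := hb
      exact Submodule.subset_span ⟨.mul m m', congrArg₂ (· + ·) hm hm', rfl⟩

theorem mem_weightSpan (w : ι → G) (e : ι → L) (i : ι) : e i ∈ weightSpan K w e (w i) :=
  Submodule.subset_span ⟨.of i, rfl, rfl⟩

/-- A derivation that shifts the weights of the elements `e` by `ε` shifts all weights by `ε`. -/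
theorem derivation_mem_weightSpan {w : ι → G} {e : ι → L} {ε : G} (δ : LieDerivation K L L)
    (hδ : ∀ i, δ (e i) ∈ weightSpan K w e (w i + ε)) {g : G} {u : L}
    (hu : u ∈ weightSpan K w e g) : δ u ∈ weightSpan K w e (g + ε) := by
  have key : ∀ m : FreeMagma ι, δ (lieMonomial e m) ∈ weightSpan K w e (weight w m + ε) := by
    intro m
    induction m using FreeMagma.rec with
    | of i => exact hδ i
    | mul a b ha hb =>
      have ha' : lieMonomial e a ∈ weightSpan K w e (weight w a) :=
        Submodule.subset_span ⟨a, rfl, rfl⟩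
      have hb' : lieMonomial e b ∈ weightSpan K w e (weight w b) :=
        Submodule.subset_span ⟨b, rfl, rfl⟩
      change δ ⁅lieMonomial e a, lieMonomial e b⁆ ∈
        weightSpan K w e (weight w a + weight w b + ε)
      rw [LieDerivation.apply_lie_eq_sub]
      refine sub_mem ?_ ?_
      · rw [add_assoc]
        exact lie_mem_weightSpan ha' hb
      · rw [add_comm (weight w a), add_assoc]
        exact lie_mem_weightSpan hb' ha
  induction hu using Submodule.span_induction with
  | zero => rw [map_zero]; exact zero_mem _
  | add a b _ _ ha hb => rw [map_add]; exact add_mem ha hb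
  | smul r a _ ha => rw [map_smul]; exact Submodule.smul_mem _ r ha
  | mem a ha =>
    obtain ⟨m, rfl, rfl⟩ := ha
    exact key m

/-- Lie monomials in linear combinations of the elements `f` are linear combinations of Lie
monomials of the same length in the elements `f`. -/
theorem weightSpan_one_le {κ : Type*} {e : ι → L} {f : κ → L}
    (h : ∀ i, e i ∈ Submodule.span K (Set.range f)) (n : ℕ) :
    weightSpan K (fun _ => 1) e n ≤ weightSpan K (fun _ => 1) f n := by
  rw [weightSpan, Submodule.span_le]
  rintro _ ⟨m, hm, rfl⟩
  induction m using FreeMagma.rec generalizing n with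
  | of i =>
    obtain rfl : 1 = n := hm
    refine Submodule.span_mono ?_ (h i)
    rintro _ ⟨k, rfl⟩
    exact ⟨.of k, rfl, rfl⟩
  | mul a b ha hb =>
    obtain rfl : weight _ a + weight _ b = n := hm
    exact lie_mem_weightSpan (ha _ rfl) (hb _ rfl)

end Monomials

/-! ### The Magnus embedding and the contraction of differential forms -/

section Magnus

open MvPolynomial

variable {σ K : Type*} [Field K]

variable (K) in
/-- The forms `∑ ω_c dx_c` of weight `g`, where both `x_c` and `dx_c` have weight `w c`. -/
noncomputable def homogeneousForms {G : Type*} [AddCommGroup G] (w : σ → G) (g : G) :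
    Submodule K (σ → MvPolynomial σ K) :=
  Submodule.pi Set.univ fun c => weightedHomogeneousSubmodule K w (g - w c)

theorem mem_homogeneousForms {G : Type*} [AddCommGroup G] {w : σ → G} {g : G}
    {ω : σ → MvPolynomial σ K} :
    ω ∈ homogeneousForms K w g ↔ ∀ c, IsWeightedHomogeneous w (ω c) (g - w c) := by
  simp [homogeneousForms, Submodule.mem_pi]

variable {d : ℕ} {e : σ → Alg K d}
  {φ : Alg K d →ₗ⁅K⁆ MagnusAlgebra (MvPolynomial σ K) (σ → MvPolynomial σ K)}

theorem fst_apply_of_mem_derivedSeries_one {u : Alg K d}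
    (hu : u ∈ LieAlgebra.derivedSeries K (Alg K d) 1) : (φ u).1 = 0 :=
  MagnusAlgebra.fst_eq_zero_of_mem_derivedSeries_one (K := K)
    (LieIdeal.derivedSeries_map_le (f := φ) 1 (LieIdeal.mem_map (f := φ) hu))

theorem lieMonomial_mul_mem (a b : FreeMagma σ) :
    lieMonomial e (.mul a b) ∈ LieAlgebra.derivedSeries K (Alg K d) 1 :=
  lie_mem_derivedSeries_one _ _

variable (e) in
/-- Modulo the second derived algebra, the operators `ad e_c` commute on the derived algebra,
which so becomes a module over the polynomial ring. -/
theorem exists_polynomial_action :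
    ∃ act : MvPolynomial σ K →ₐ[K] Module.End K (LieAlgebra.derivedSeries K (Alg K d) 1),
      ∀ c (u : LieAlgebra.derivedSeries K (Alg K d) 1), act (X c) u = ⁅e c, u⁆ := by
  let T : σ → Module.End K (LieAlgebra.derivedSeries K (Alg K d) 1) := fun c =>
    LieModule.toEnd K (Alg K d) (LieAlgebra.derivedSeries K (Alg K d) 1) (e c)
  have hT : ∀ a ∈ Set.range T, ∀ b ∈ Set.range T, a * b = b * a := by
    rintro _ ⟨a, rfl⟩ _ ⟨b, rfl⟩
    ext u
    change ⁅e a, ⁅e b, (u : Alg K d)⁆⁆ = ⁅e b, ⁅e a, (u : Alg K d)⁆⁆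
    rw [leibniz_lie, lie_eq_zero_of_mem_derivedSeries_one (lie_mem_derivedSeries_one _ _) u.2,
      zero_add]
  have := Algebra.isMulCommutative_adjoin K hT
  let _ : CommRing (Algebra.adjoin K (Set.range T)) :=
    open scoped IsMulCommutative in inferInstance
  refine ⟨(Algebra.adjoin K (Set.range T)).val.comp
    (aeval fun c => ⟨T c, Algebra.subset_adjoin ⟨c, rfl⟩⟩), fun c u => ?_⟩
  rw [AlgHom.comp_apply, aeval_X]
  rfl

variable (σ K) in
/-- The contraction `∑ ω_c dx_c ↦ ∑ ω_c x_c` of differential forms with the Euler vector field. -/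
noncomputable def contraction [Fintype σ] :
    (σ → MvPolynomial σ K) →ₗ[MvPolynomial σ K] MvPolynomial σ K :=
  ∑ c, (X c : MvPolynomial σ K) • LinearMap.proj c

theorem contraction_apply [Fintype σ] (ω : σ → MvPolynomial σ K) :
    contraction σ K ω = ∑ c, X c * ω c := by
  simp [contraction]

variable [DecidableEq σ]

variable (K) in
/-- The image `x_c + dx_c` of the `c`-th generator under the Magnus embedding. -/
noncomputable def magnusGen (c : σ) :
    MagnusAlgebra (MvPolynomial σ K) (σ → MvPolynomial σ K) :=
  (X c, Pi.single c 1)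

theorem fst_magnusGen (c : σ) : (magnusGen K c).1 = X c := rfl

theorem snd_magnusGen (c : σ) : (magnusGen K c).2 = Pi.single c 1 := rfl

theorem contraction_single [Fintype σ] (c : σ) (f : MvPolynomial σ K) :
    contraction σ K (Pi.single c f) = X c * f := by
  rw [contraction_apply, Finset.sum_eq_single c]
  · rw [Pi.single_eq_same]
  · intro b _ hb
    rw [Pi.single_eq_of_ne hb, mul_zero]
  · simp

variable (hφ : ∀ c, φ (e c) = magnusGen K c)

include hφ

/-- The polynomial component of the Magnus embedding is the contraction of the linear component. As
it vanishes on the derived algebra, the contraction kills the forms that come from there. -/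
theorem fst_lieMonomial [Fintype σ] (m : FreeMagma σ) :
    (φ (lieMonomial e m)).1 = contraction σ K (φ (lieMonomial e m)).2 := by
  induction m using FreeMagma.rec with
  | of c =>
    change (φ (e c)).1 = contraction σ K (φ (e c)).2
    rw [hφ, fst_magnusGen, snd_magnusGen, contraction_single, mul_one]
  | mul a b ha hb =>
    change (φ ⁅lieMonomial e a, lieMonomial e b⁆).1 =
      contraction σ K (φ ⁅lieMonomial e a, lieMonomial e b⁆).2
    rw [LieHom.map_lie, MagnusAlgebra.fst_lie, MagnusAlgebra.snd_lie, map_sub, map_smul, map_smul,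
      ← ha, ← hb, smul_eq_mul, smul_eq_mul, mul_comm, sub_self]

theorem lieMonomial_homogeneous {G : Type*} [AddCommGroup G] (w : σ → G) (m : FreeMagma σ) :
    IsWeightedHomogeneous w (φ (lieMonomial e m)).1 (weight w m) ∧
      (φ (lieMonomial e m)).2 ∈ homogeneousForms K w (weight w m) := by
  induction m using FreeMagma.rec with
  | of c =>
    change IsWeightedHomogeneous w (φ (e c)).1 (w c) ∧ (φ (e c)).2 ∈ homogeneousForms K w (w c)
    rw [hφ, fst_magnusGen, snd_magnusGen, mem_homogeneousForms]
    refine ⟨isWeightedHomogeneous_X K w c, fun b => ?_⟩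
    by_cases hb : b = c
    · subst hb
      rw [Pi.single_eq_same, sub_self]
      exact isWeightedHomogeneous_one K w
    · rw [Pi.single_eq_of_ne hb]
      exact isWeightedHomogeneous_zero K w _
  | mul a b ha hb =>
    change IsWeightedHomogeneous w (φ ⁅lieMonomial e a, lieMonomial e b⁆).1
      (weight w a + weight w b) ∧ (φ ⁅lieMonomial e a, lieMonomial e b⁆).2 ∈
        homogeneousForms K w (weight w a + weight w b)
    rw [LieHom.map_lie, MagnusAlgebra.fst_lie, MagnusAlgebra.snd_lie]
    refine ⟨isWeightedHomogeneous_zero K w _, ?_⟩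
    rw [mem_homogeneousForms] at *
    intro c
    refine IsWeightedHomogeneous.sub ?_ ?_
    · rw [add_sub_assoc]
      exact ha.1.mul (hb.2 c)
    · rw [add_comm, add_sub_assoc]
      exact hb.1.mul (ha.2 c)

end Magnus

/-! ### The inverse of the Magnus embedding -/

section Inverse

open MvPolynomial

variable {σ K : Type*} [Field K] {d : ℕ} {e : σ → Alg K d}
  {act : MvPolynomial σ K →ₐ[K] Module.End K (LieAlgebra.derivedSeries K (Alg K d) 1)}

/-- An induction principle for Lie monomials of length at least two: since the derived algebra is
abelian, up to sign the nonzero ones are left-normed. -/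
theorem lieMonomial_induction {P : ℕ → Alg K d → Prop} (zero : ∀ n, P n 0)
    (neg : ∀ n u, P n u → P n (-u)) (base : ∀ b c, P 2 ⁅e b, e c⁆)
    (step : ∀ n b, ∀ u ∈ LieAlgebra.derivedSeries K (Alg K d) 1, P n u → P (n + 1) ⁅e b, u⁆)
    (m : FreeMagma σ) (hm : 2 ≤ m.length) : P m.length (lieMonomial e m) := by
  induction m using FreeMagma.rec with
  | of c => exact absurd (show 2 ≤ 1 from hm) (by decide)
  | mul x y hx hy =>
    cases x with
    | of b =>
      cases y with
      | of c => exact base b c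
      | mul y₁ y₂ =>
        have hy' : 2 ≤ (FreeMagma.mul y₁ y₂).length :=
          Nat.add_le_add y₁.length_pos y₂.length_pos
        have := step _ b _ (lieMonomial_mul_mem y₁ y₂) (hy hy')
        rwa [add_comm] at this
    | mul x₁ x₂ =>
      cases y with
      | of c =>
        have hx' : 2 ≤ (FreeMagma.mul x₁ x₂).length :=
          Nat.add_le_add x₁.length_pos x₂.length_pos
        have := neg _ _ (step _ c _ (lieMonomial_mul_mem x₁ x₂) (hx hx'))
        rwa [lie_skew] at this
      | mul y₁ y₂ =>
        have h : lieMonomial e (.mul (.mul x₁ x₂) (.mul y₁ y₂)) = 0 :=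
          lie_eq_zero_of_mem_derivedSeries_one (lieMonomial_mul_mem x₁ x₂)
            (lieMonomial_mul_mem y₁ y₂)
        rw [h]
        exact zero _

theorem act_mem_weightSpan
    (hact : ∀ c (u : LieAlgebra.derivedSeries K (Alg K d) 1), act (X c) u = ⁅e c, u⁆)
    {G : Type*} [AddCommMonoid G] {w : σ → G} {f : MvPolynomial σ K} {g h : G}
    (hf : IsWeightedHomogeneous w f g) (u : LieAlgebra.derivedSeries K (Alg K d) 1)
    (hu : (u : Alg K d) ∈ weightSpan K w e h) :
    (act f u : Alg K d) ∈ weightSpan K w e (g + h) := by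
  have key : ∀ (s : σ →₀ ℕ) (h : G) (u : LieAlgebra.derivedSeries K (Alg K d) 1),
      (u : Alg K d) ∈ weightSpan K w e h →
        (act (monomial s 1) u : Alg K d) ∈ weightSpan K w e (Finsupp.weight w s + h) := by
    intro s
    induction s using Finsupp.induction_linear with
    | zero =>
      intro h u hu
      rw [map_zero, zero_add, monomial_zero', C_1, map_one]
      exact hu
    | add s t hs ht =>
      intro h u hu
      rw [map_add, ← one_mul (1 : K), ← monomial_mul, map_mul, add_assoc]
      exact hs _ _ (ht _ _ hu)
    | single c n =>
      induction n with
      | zero =>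
        intro h u hu
        rw [Finsupp.single_zero, map_zero, zero_add, monomial_zero', C_1, map_one]
        exact hu
      | succ n ih =>
        intro h u hu
        have hX : (monomial (Finsupp.single c (n + 1)) 1 : MvPolynomial σ K) =
            X c * monomial (Finsupp.single c n) 1 := by
          rw [X, monomial_mul, one_mul, add_comm, Finsupp.single_add]
        rw [hX, map_mul, Finsupp.weight_single, succ_nsmul', add_assoc]
        change (act (X c) (act (monomial (Finsupp.single c n) 1) u) : Alg K d) ∈ _
        rw [hact]
        have := ih h u hu
        rw [Finsupp.weight_single] at this
        exact lie_mem_weightSpan (mem_weightSpan w e c) this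
  rw [f.as_sum, map_sum, LinearMap.sum_apply, AddSubmonoidClass.coe_finsetSum]
  refine Submodule.sum_mem _ fun s hs => ?_
  have hs' : monomial s (coeff s f) = coeff s f • (monomial s 1 : MvPolynomial σ K) := by
    rw [smul_monomial, smul_eq_mul, mul_one]
  rw [hs', map_smul, ← hf (mem_support_iff.1 hs)]
  exact Submodule.smul_mem _ _ (key s h u hu)

theorem snd_lie_gen [DecidableEq σ]
    {φ : Alg K d →ₗ⁅K⁆ MagnusAlgebra (MvPolynomial σ K) (σ → MvPolynomial σ K)}
    (hφ : ∀ c, φ (e c) = magnusGen K c) (b c : σ) :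
    (φ ⁅e b, e c⁆).2 = Pi.single c (X b) - Pi.single b (X c) := by
  rw [LieHom.map_lie, MagnusAlgebra.snd_lie, hφ, hφ, fst_magnusGen, fst_magnusGen, snd_magnusGen,
    snd_magnusGen, ← Pi.single_smul', ← Pi.single_smul', smul_eq_mul, smul_eq_mul, mul_one, mul_one]

variable [Fintype σ]

variable (e act) in
/-- The map `f dx_c ↦ ∑_b (∂f/∂x_b) ⁅e_b, e_c⁆`, the exterior derivative followed by the
identification of `dx_b ∧ dx_c` with `⁅e_b, e_c⁆`. Up to the degree it inverts the Magnus
embedding on the derived algebra. -/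
noncomputable def exteriorMap : (σ → MvPolynomial σ K) →ₗ[K] Alg K d :=
  ∑ c, ∑ b, (LieAlgebra.derivedSeries K (Alg K d) 1).toSubmodule.subtype ∘ₗ
    act.toLinearMap.flip ⟨⁅e b, e c⁆, lie_mem_derivedSeries_one _ _⟩ ∘ₗ
      (pderiv b).toLinearMap ∘ₗ LinearMap.proj c

theorem exteriorMap_apply (ω : σ → MvPolynomial σ K) :
    exteriorMap e act ω = ∑ c, ∑ b,
      (act (pderiv b (ω c)) ⟨⁅e b, e c⁆, lie_mem_derivedSeries_one _ _⟩ : Alg K d) := by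
  simp only [exteriorMap, LinearMap.sum_apply]
  rfl

variable (hact : ∀ c (u : LieAlgebra.derivedSeries K (Alg K d) 1), act (X c) u = ⁅e c, u⁆)

include hact

theorem exteriorMap_mem_weightSpan {G : Type*} [AddCommGroup G] {w : σ → G}
    {ω : σ → MvPolynomial σ K} {g : G} (hω : ω ∈ homogeneousForms K w g) :
    exteriorMap e act ω ∈ weightSpan K w e g := by
  rw [exteriorMap_apply]
  refine Submodule.sum_mem _ fun c _ => Submodule.sum_mem _ fun b _ => ?_
  have h := mem_homogeneousForms.1 hω c
  have hb : IsWeightedHomogeneous w (pderiv b (ω c)) (g - w c - w b) :=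
    IsWeightedHomogeneous.pderiv h (sub_add_cancel _ _)
  have := act_mem_weightSpan hact hb ⟨⁅e b, e c⁆, lie_mem_derivedSeries_one _ _⟩
    (lie_mem_weightSpan (mem_weightSpan w e b) (mem_weightSpan w e c))
  rwa [sub_sub, add_comm (w c), sub_add_cancel] at this

/-- The product rule `d (x_a ω) = x_a dω + dx_a ∧ ω`. -/
theorem exteriorMap_X_smul (a : σ) (ω : σ → MvPolynomial σ K)
    (u : LieAlgebra.derivedSeries K (Alg K d) 1) (hu : exteriorMap e act ω = u) :
    exteriorMap e act ((X a : MvPolynomial σ K) • ω) = ⁅e a, (u : Alg K d)⁆ +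
      ∑ c, (act (ω c) ⟨⁅e a, e c⁆, lie_mem_derivedSeries_one _ _⟩ : Alg K d) := by
  classical
  rw [← hu, exteriorMap_apply, exteriorMap_apply, lie_sum, ← Finset.sum_add_distrib]
  refine Finset.sum_congr rfl fun c _ => ?_
  rw [lie_sum]
  have hb : ∀ b, (act (pderiv b (((X a : MvPolynomial σ K) • ω) c))
      ⟨⁅e b, e c⁆, lie_mem_derivedSeries_one _ _⟩ : Alg K d) =
      ⁅e a, (act (pderiv b (ω c)) ⟨⁅e b, e c⁆, lie_mem_derivedSeries_one _ _⟩ : Alg K d)⁆ +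
        if b = a then
          (act (ω c) ⟨⁅e a, e c⁆, lie_mem_derivedSeries_one _ _⟩ : Alg K d) else 0 := by
    intro b
    rw [Pi.smul_apply, smul_eq_mul, Derivation.leibniz, smul_eq_mul, smul_eq_mul, map_add, map_mul]
    change ((act (X a) (act (pderiv b (ω c)) _) : Alg K d) + _ = _)
    rw [hact]
    congr 1
    split_ifs with hba
    · subst hba
      rw [pderiv_X_self, mul_one]
    · rw [pderiv_X_of_ne (Ne.symm hba), mul_zero, map_zero]
      rfl
  rw [Finset.sum_congr rfl fun b _ => hb b, Finset.sum_add_distrib,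
    Finset.sum_ite_eq' Finset.univ a]
  simp

variable [DecidableEq σ]
  {φ : Alg K d →ₗ⁅K⁆ MagnusAlgebra (MvPolynomial σ K) (σ → MvPolynomial σ K)}
  (hφ : ∀ c, φ (e c) = magnusGen K c)

include hφ

omit [Fintype σ] in
/-- The Magnus embedding is linear over the polynomial ring on the derived algebra. -/
theorem snd_act (f : MvPolynomial σ K) (u : LieAlgebra.derivedSeries K (Alg K d) 1) :
    (φ (act f u : Alg K d)).2 = f • (φ (u : Alg K d)).2 := by
  induction f using MvPolynomial.induction_on generalizing u with
  | C r =>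
    have : act (C r) u = r • u := by
      rw [← algebraMap_eq, AlgHom.commutes]
      rfl
    rw [this, LieSubmodule.coe_smul, map_smul, MagnusAlgebra.snd_smul, ← algebraMap_eq,
      algebraMap_smul]
  | add p q hp hq =>
    rw [map_add act, add_smul, ← hp, ← hq, ← MagnusAlgebra.snd_add, ← map_add φ]
    rfl
  | mul_X p c hp =>
    rw [map_mul]
    change (φ (act p (act (X c) u) : Alg K d)).2 = _
    rw [hp, hact]
    change p • (φ ⁅e c, (u : Alg K d)⁆).2 = _
    rw [LieHom.map_lie, MagnusAlgebra.snd_lie, fst_apply_of_mem_derivedSeries_one u.2, hφ,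
      zero_smul, sub_zero, fst_magnusGen, mul_smul]

/-- Cartan's formula for the Euler vector field: on forms of degree `n`, the contraction with the
Euler field of the exterior derivative of `ω` is `n ω` minus the derivative of the contraction. -/
theorem snd_exteriorMap {n : ℕ} {ω : σ → MvPolynomial σ K} (hω : ∀ c, (ω c).IsHomogeneous n) :
    (φ (exteriorMap e act ω)).2 =
      ((n : K) + 1) • ω - fun c => pderiv c (contraction σ K ω) := by
  have h1 : (φ (exteriorMap e act ω)).2 = ∑ c, ∑ b,
      pderiv b (ω c) • (Pi.single c (X b) - Pi.single b (X c) : σ → MvPolynomial σ K) := by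
    rw [exteriorMap_apply, ← MagnusAlgebra.sndₗ_apply (K := K), ← LieHom.coe_toLinearMap, map_sum,
      map_sum]
    refine Finset.sum_congr rfl fun c _ => ?_
    rw [map_sum, map_sum]
    refine Finset.sum_congr rfl fun b _ => ?_
    rw [MagnusAlgebra.sndₗ_apply, LieHom.coe_toLinearMap, snd_act hact hφ]
    exact congrArg _ (snd_lie_gen hφ b c)
  rw [h1]
  funext a
  have h2 : ∀ c b, (pderiv b (ω c) •
      (Pi.single c (X b) - Pi.single b (X c) : σ → MvPolynomial σ K)) a =
      (if a = c then X b * pderiv b (ω c) else 0) -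
        (if a = b then X c * pderiv b (ω c) else 0) := by
    intro c b
    simp only [Pi.smul_apply, Pi.sub_apply, Pi.single_apply, smul_eq_mul]
    split_ifs <;> ring
  rw [Finset.sum_apply]
  simp only [Finset.sum_apply, h2, Finset.sum_sub_distrib, Finset.sum_ite_eq, Finset.mem_univ,
    if_true]
  rw [Finset.sum_comm]
  simp only [Finset.sum_ite_eq, Finset.mem_univ, if_true, (hω a).sum_X_mul_pderiv]
  rw [contraction_apply, Pi.sub_apply, map_sum]
  have h3 : ∀ c, pderiv a (X c * ω c) = X c * pderiv a (ω c) + if a = c then ω c else 0 := by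
    intro c
    rw [Derivation.leibniz, smul_eq_mul, smul_eq_mul]
    congr 1
    split_ifs with h
    · subst h; rw [pderiv_X_self, mul_one]
    · rw [pderiv_X_of_ne (Ne.symm h), mul_zero]
  simp only [h3, Finset.sum_add_distrib, Finset.sum_ite_eq, Finset.mem_univ, if_true,
    Pi.smul_apply, add_smul, one_smul, Nat.cast_smul_eq_nsmul]
  ring

/-- On Lie monomials of degree `n ≥ 2`, the exterior map after the Magnus embedding is
multiplication by `n`. The first conjunct, an instance of the Jacobi identity, carries the
induction. -/
theorem exteriorMap_snd_lieMonomial {m : FreeMagma σ} (hm : 2 ≤ m.length) :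
    (∀ a, ∑ c, (act ((φ (lieMonomial e m)).2 c)
      ⟨⁅e a, e c⁆, lie_mem_derivedSeries_one _ _⟩ : Alg K d) = ⁅e a, lieMonomial e m⁆) ∧
    exteriorMap e act (φ (lieMonomial e m)).2 = (m.length : K) • lieMonomial e m := by
  have commute : ∀ a b, ∀ u ∈ LieAlgebra.derivedSeries K (Alg K d) 1,
      ⁅e b, ⁅e a, u⁆⁆ = ⁅e a, ⁅e b, u⁆⁆ := by
    intro a b u hu
    rw [leibniz_lie, lie_eq_zero_of_mem_derivedSeries_one (lie_mem_derivedSeries_one _ _) hu,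
      zero_add]
  refine lieMonomial_induction (P := fun n u => (∀ a, ∑ c, (act ((φ u).2 c)
      ⟨⁅e a, e c⁆, lie_mem_derivedSeries_one _ _⟩ : Alg K d) = ⁅e a, u⁆) ∧
    exteriorMap e act (φ u).2 = (n : K) • u) ?_ ?_ ?_ ?_ m hm
  · intro n
    have h0 : (φ 0).2 = 0 := by rw [map_zero]; rfl
    rw [h0]
    simp
  · intro n u ⟨h1, h2⟩
    have hneg : (φ (-u)).2 = -(φ u).2 := by rw [map_neg]; rfl
    refine ⟨fun a => ?_, ?_⟩
    · rw [lie_neg, ← h1, hneg, ← Finset.sum_neg_distrib]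
      simp
    · rw [hneg, map_neg, h2, smul_neg]
  · intro b c
    have hsum : ∀ a, ∑ x, (act ((Pi.single c (X b) - Pi.single b (X c) :
        σ → MvPolynomial σ K) x) ⟨⁅e a, e x⁆, lie_mem_derivedSeries_one _ _⟩ : Alg K d) =
        ⁅e a, ⁅e b, e c⁆⁆ := by
      intro a
      have hx : ∀ x, (act ((Pi.single c (X b) - Pi.single b (X c) :
          σ → MvPolynomial σ K) x) ⟨⁅e a, e x⁆, lie_mem_derivedSeries_one _ _⟩ : Alg K d) =
          (if x = c then ⁅e b, ⁅e a, e x⁆⁆ else 0) - (if x = b then ⁅e c, ⁅e a, e x⁆⁆ else 0) := by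
        intro x
        rw [Pi.sub_apply, map_sub, LinearMap.sub_apply, LieSubmodule.coe_sub, Pi.single_apply,
          Pi.single_apply]
        congr 1
        · split_ifs with h
          · rw [hact]; rfl
          · rw [map_zero]; rfl
        · split_ifs with h
          · rw [hact]; rfl
          · rw [map_zero]; rfl
      simp only [hx, Finset.sum_sub_distrib, Finset.sum_ite_eq', Finset.mem_univ, if_true]
      rw [leibniz_lie (e a) (e b) (e c), ← lie_skew ⁅e a, e b⁆ (e c)]
      abel
    refine ⟨fun a => by rw [snd_lie_gen hφ]; exact hsum a, ?_⟩
    rw [snd_lie_gen hφ, exteriorMap_apply]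
    have hx : ∀ x y, (act (pderiv y ((Pi.single c (X b) - Pi.single b (X c) :
        σ → MvPolynomial σ K) x)) ⟨⁅e y, e x⁆, lie_mem_derivedSeries_one _ _⟩ : Alg K d) =
        (if x = c then if y = b then ⁅e y, e x⁆ else 0 else 0) -
          (if x = b then if y = c then ⁅e y, e x⁆ else 0 else 0) := by
      intro x y
      rw [Pi.sub_apply, map_sub, map_sub, LinearMap.sub_apply, LieSubmodule.coe_sub,
        Pi.single_apply, Pi.single_apply]
      have h1 : ∀ z, (act (pderiv y (X z)) ⟨⁅e y, e x⁆, lie_mem_derivedSeries_one _ _⟩ :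
          Alg K d) = if y = z then ⁅e y, e x⁆ else 0 := by
        intro z
        split_ifs with h
        · rw [h, pderiv_X_self, map_one]; rfl
        · rw [pderiv_X_of_ne (Ne.symm h), map_zero]; rfl
      congr 1
      · split_ifs with h h'
        · rw [h1, if_pos h']
        · rw [h1, if_neg h']
        · rw [map_zero, map_zero]; rfl
      · split_ifs with h h'
        · rw [h1, if_pos h']
        · rw [h1, if_neg h']
        · rw [map_zero, map_zero]; rfl
    simp only [hx, Finset.sum_sub_distrib]
    have hS : ∀ p q, ∑ x, ∑ y, (if x = p then if y = q then ⁅e y, e x⁆ else 0 else 0) =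
        ⁅e q, e p⁆ := by
      intro p q
      rw [Finset.sum_eq_single p]
      · simp
      · intro x _ hxp
        simp [hxp]
      · simp
    rw [hS, hS, ← lie_skew (e b) (e c), Nat.cast_ofNat, two_smul]
    abel
  · intro n b u hu ⟨h1, h2⟩
    have hstep : (φ ⁅e b, u⁆).2 = (X b : MvPolynomial σ K) • (φ u).2 := by
      rw [LieHom.map_lie, MagnusAlgebra.snd_lie, fst_apply_of_mem_derivedSeries_one hu, hφ,
        zero_smul, sub_zero, fst_magnusGen]
    refine ⟨fun a => ?_, ?_⟩
    · rw [hstep, ← commute a b u hu, ← h1, lie_sum]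
      refine Finset.sum_congr rfl fun c _ => ?_
      rw [Pi.smul_apply, smul_eq_mul, map_mul]
      change (act (X b) (act ((φ u).2 c) _) : Alg K d) = _
      rw [hact]
      rfl
    · rw [hstep, exteriorMap_X_smul hact b _ ((n : K) • ⟨u, hu⟩) h2, h1, Nat.cast_add, Nat.cast_one,
        add_smul, one_smul]
      congr 1
      change ⁅e b, (n : K) • u⁆ = _
      rw [lie_smul]

end Inverse

/-! ### Representations of `sl₂` -/

section Sl2

open MvPolynomial

variable {K V : Type*} [Field K] [AddCommGroup V] [Module K V]
  {E F : V →ₗ[K] V} {W : ℤ → Submodule K V} {a : ℤ}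
  (hE : ∀ k, ∀ v ∈ W k, E v ∈ W (k + 1)) (hF : ∀ k, ∀ v ∈ W (k + 1), F v ∈ W k)
  (hEF : ∀ k, ∀ v ∈ W k, E (F v) - F (E v) = ((a + 2 * k : ℤ) : K) • v)

include hF in
theorem pow_lower_mem (k : ℕ) {v : V} {j : ℤ} (hv : v ∈ W j) : (F ^ k) v ∈ W (j - k) := by
  induction k with
  | zero => simpa using hv
  | succ k ih =>
    rw [pow_succ', Module.End.mul_apply]
    apply hF
    convert ih using 2
    push_cast
    ring

include hE in
theorem pow_raise_mem (k : ℕ) {v : V} {j : ℤ} (hv : v ∈ W j) : (E ^ k) v ∈ W (j + k) := by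
  induction k with
  | zero => simpa using hv
  | succ k ih =>
    rw [pow_succ', Module.End.mul_apply, Nat.cast_succ, ← add_assoc]
    exact hE _ _ ih

variable [CharZero K]

include hF hEF in
/-- In an `sl₂`-representation of weights `a + 2k` on `W k` in which the lowering operator is
locally nilpotent, the raising operator is injective on the spaces of negative weight. -/
theorem raise_injective {j : ℤ} (hj : a + 2 * j < 0) (hbot : ∃ k : ℕ, W (j - k) = ⊥) {v : V}
    (hv : v ∈ W j) (h0 : E v = 0) : v = 0 := by
  have hp : ∀ k : ℕ, F ((F ^ k) v) = (F ^ (k + 1)) v := fun k => by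
    rw [pow_succ', Module.End.mul_apply]
  -- as `E v = 0`, the powers `F ^ k v` span a module with the usual structure constants
  have key : ∀ k : ℕ, E ((F ^ (k + 1)) v) =
      (((k + 1) * (a + 2 * j - k) : ℤ) : K) • (F ^ k) v := by
    intro k
    induction k with
    | zero =>
      have := hEF j v hv
      rw [h0, map_zero, sub_zero] at this
      simpa using this
    | succ k ih =>
      have h := hEF _ _ (pow_lower_mem hF (k + 1) hv)
      rw [ih, map_smul, hp, hp, sub_eq_iff_eq_add] at h
      rw [h, ← add_smul]
      congr 1
      push_cast
      ring
  -- the factors `(k + 1) (a + 2 j - k)` are negative, so `F ^ k v = 0` is traced back to `v = 0`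
  have descend : ∀ k : ℕ, (F ^ k) v = 0 → v = 0 := by
    intro k
    induction k with
    | zero => exact id
    | succ k ih =>
      intro hk
      have h := key k
      rw [hk, map_zero] at h
      exact ih ((smul_eq_zero.1 h.symm).resolve_left
        (Int.cast_ne_zero.2 (mul_ne_zero (by omega) (by omega))))
  obtain ⟨k, hk⟩ := hbot
  refine descend k ?_
  have := pow_lower_mem hF k hv
  rwa [hk, Submodule.mem_bot] at this

include hE hF hEF in
/-- In an `sl₂`-representation of weights `a + 2k` on `W k` in which the raising operator is
locally nilpotent, the raising operator is surjective onto the spaces of positive weight. -/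
theorem raise_surjective {j : ℤ} (hj : 0 < a + 2 * (j + 1)) (hbot : ∃ k : ℕ, W (j + 1 + k) = ⊥)
    {v : V} (hv : v ∈ W (j + 1)) : ∃ u ∈ W j, E u = v := by
  -- the commutator of `E ^ (r + 1)` with `F`
  have key : ∀ r : ℕ, ∀ v ∈ W (j + 1), (E ^ (r + 1)) (F v) =
      F ((E ^ (r + 1)) v) + (((r + 1) * (a + 2 * (j + 1) + r) : ℤ) : K) • (E ^ r) v := by
    intro r v hv
    induction r with
    | zero =>
      have := hEF _ v hv
      rw [sub_eq_iff_eq_add'] at this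
      simpa using this
    | succ r ih =>
      have h := hEF _ _ (pow_raise_mem hE (r + 1) hv)
      rw [sub_eq_iff_eq_add'] at h
      rw [pow_succ' E (r + 1), Module.End.mul_apply, ih, map_add, h, map_smul,
        Module.End.mul_apply, ← Module.End.mul_apply (f := E) (g := E ^ r), ← pow_succ', add_assoc,
        ← add_smul]
      congr 2
      push_cast
      ring
  have main : ∀ r : ℕ, ∀ v ∈ W (j + 1), (E ^ r) v = 0 → ∃ u ∈ W j, E u = v := by
    intro r
    induction r with
    | zero => exact fun v _ h => ⟨0, zero_mem _, by rw [map_zero]; exact h.symm⟩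
    | succ r ih =>
      intro v hv h
      -- subtracting a multiple of `E F v` lowers the nilpotency order of `v`
      set c : K := (((r + 1) * (a + 2 * (j + 1) + r) : ℤ) : K) with hc
      have hc0 : c ≠ 0 := by
        rw [hc, Int.cast_ne_zero]
        exact mul_ne_zero (by omega) (by omega)
      have hEFv : E (F v) ∈ W (j + 1) := hE _ _ (hF _ _ hv)
      obtain ⟨u, hu, huv⟩ := ih (v - c⁻¹ • E (F v))
        (sub_mem hv (Submodule.smul_mem _ _ hEFv)) (by
          rw [map_sub, map_smul, ← Module.End.mul_apply (f := E ^ r), ← pow_succ, key r v hv, h,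
            map_zero, zero_add, smul_smul, inv_mul_cancel₀ hc0, one_smul, sub_self])
      refine ⟨u + c⁻¹ • F v, add_mem hu (Submodule.smul_mem _ _ (hF _ _ hv)), ?_⟩
      rw [map_add, huv, map_smul, sub_add_cancel]
  obtain ⟨k, hk⟩ := hbot
  refine main k v hv ?_
  have := pow_raise_mem hE k hv
  rwa [hk, Submodule.mem_bot] at this

include hE hF hEF in
/-- Highest weight vectors of weight `a ≥ 0` are counted by the difference of the dimensions of
the weight spaces of weights `a` and `a + 2`. -/
theorem finrank_ker_raise_add [Module.Finite K (W 0)] (ha : 0 ≤ a)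
    (hbot : ∃ k : ℕ, W (1 + k) = ⊥) :
    Module.finrank K (LinearMap.ker E ⊓ W 0 : Submodule K V) + Module.finrank K (W 1) =
      Module.finrank K (W 0) := by
  let T : W 0 →ₗ[K] W 1 := E.restrict (hE 0)
  have hT : Function.Surjective T := by
    rintro ⟨v, hv⟩
    obtain ⟨u, hu, rfl⟩ := raise_surjective (j := 0) hE hF hEF (by omega) hbot hv
    exact ⟨⟨u, hu⟩, rfl⟩
  have h := T.finrank_range_add_finrank_ker
  rw [LinearMap.range_eq_top.2 hT, finrank_top] at h
  have hker : (LinearMap.ker T).map (W 0).subtype = LinearMap.ker E ⊓ W 0 := by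
    ext v
    constructor
    · rintro ⟨⟨u, hu⟩, hu0, rfl⟩
      exact ⟨congrArg Subtype.val hu0, hu⟩
    · rintro ⟨h0, hv⟩
      exact ⟨⟨v, hv⟩, Subtype.ext h0, rfl⟩
  rw [← hker, Submodule.finrank_map_subtype_eq, add_comm]
  exact h

end Sl2

/-! ### Lie derivatives along linear vector fields -/

section Derivations

open MvPolynomial

variable {σ K : Type*} [Field K] [Fintype σ]

/-- The derivation of the polynomial ring that acts on the span of the variables by the
matrix `A`. -/
noncomputable def linDer (A : Matrix σ σ K) :
    Derivation K (MvPolynomial σ K) (MvPolynomial σ K) :=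
  ∑ b, (∑ a, A a b • (X a : MvPolynomial σ K)) • pderiv b

theorem linDer_apply (A : Matrix σ σ K) (f : MvPolynomial σ K) :
    linDer A f = ∑ b, (∑ a, A a b • (X a : MvPolynomial σ K)) * pderiv b f := by
  rw [linDer, ← Derivation.coeFnAddMonoidHom_apply, map_sum, Finset.sum_apply]
  rfl

theorem linDer_X (A : Matrix σ σ K) (c : σ) : linDer A (X c) = ∑ a, A a c • X a := by
  classical
  rw [linDer_apply, Finset.sum_eq_single c]
  · rw [pderiv_X_self, mul_one]
  · intro b _ hb
    rw [pderiv_X_of_ne hb.symm, mul_zero]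
  · simp

theorem linDer_commutator (A B : Matrix σ σ K) (f : MvPolynomial σ K) :
    linDer A (linDer B f) - linDer B (linDer A f) = linDer (A * B - B * A) f := by
  have hX : ∀ (A B : Matrix σ σ K) c, linDer A (linDer B (X c)) = ∑ a, (A * B) a c • X a := by
    intro A B c
    simp only [linDer_X, map_sum, Derivation.map_smul, Finset.smul_sum, smul_smul,
      Matrix.mul_apply, Finset.sum_smul]
    rw [Finset.sum_comm]
    simp only [mul_comm]
  have h : ⁅linDer A, linDer B⁆ = linDer (A * B - B * A) := by
    refine derivation_ext fun c => ?_
    rw [Derivation.commutator_apply, hX, hX, linDer_X, ← Finset.sum_sub_distrib]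
    simp only [Matrix.sub_apply, sub_smul]
  rw [← h, Derivation.commutator_apply]

/-- The action on differential forms of the linear vector field with matrix `A` (the Lie
derivative). -/
noncomputable def formDer (A : Matrix σ σ K) :
    (σ → MvPolynomial σ K) →ₗ[K] (σ → MvPolynomial σ K) :=
  LinearMap.pi fun a => (linDer A).toLinearMap ∘ₗ LinearMap.proj a + ∑ b, A a b • LinearMap.proj b

theorem formDer_apply (A : Matrix σ σ K) (ω : σ → MvPolynomial σ K) (a : σ) :
    formDer A ω a = linDer A (ω a) + ∑ b, A a b • ω b := by
  simp [formDer]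

theorem formDer_commutator (A B : Matrix σ σ K) (ω : σ → MvPolynomial σ K) :
    formDer A (formDer B ω) - formDer B (formDer A ω) = formDer (A * B - B * A) ω := by
  funext a
  have h : ∀ A B : Matrix σ σ K, formDer A (formDer B ω) a =
      linDer A (linDer B (ω a)) + ∑ b, B a b • linDer A (ω b) + ∑ b, A a b • linDer B (ω b) +
        ∑ c, (A * B) a c • ω c := by
    intro A B
    simp only [formDer_apply, map_add, map_sum, Derivation.map_smul, smul_add,
      Finset.sum_add_distrib, Finset.smul_sum, smul_smul, Matrix.mul_apply, Finset.sum_smul]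
    rw [Finset.sum_comm (s := Finset.univ) (t := Finset.univ)
      (f := fun b c => (A a b * B b c) • ω c)]
    abel
  rw [Pi.sub_apply, h, h, formDer_apply, ← linDer_commutator]
  simp only [Matrix.sub_apply, sub_smul, Finset.sum_sub_distrib]
  abel

theorem formDer_smul (A : Matrix σ σ K) (f : MvPolynomial σ K) (ω : σ → MvPolynomial σ K) :
    formDer A (f • ω) = linDer A f • ω + f • formDer A ω := by
  funext a
  simp only [formDer_apply, Pi.add_apply, Pi.smul_apply, smul_eq_mul, Derivation.leibniz, mul_add,
    Finset.mul_sum, mul_smul_comm]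
  ring

theorem contraction_formDer (A : Matrix σ σ K) (ω : σ → MvPolynomial σ K) :
    contraction σ K (formDer A ω) = linDer A (contraction σ K ω) := by
  simp only [contraction_apply, formDer_apply, map_sum, Derivation.leibniz, linDer_X, mul_add,
    Finset.sum_add_distrib, Finset.mul_sum, smul_eq_mul, mul_smul_comm]
  congr 1
  rw [Finset.sum_comm]
  simp only [mul_comm]

theorem linDer_homogeneous {G : Type*} [AddCommGroup G] {w : σ → G} {A : Matrix σ σ K} {ε : G}
    (hA : ∀ a b, A a b ≠ 0 → w a = w b + ε) {f : MvPolynomial σ K} {g : G}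
    (hf : IsWeightedHomogeneous w f g) : IsWeightedHomogeneous w (linDer A f) (g + ε) := by
  rw [linDer_apply]
  refine IsWeightedHomogeneous.sum _ _ _ fun b _ => ?_
  have h1 : IsWeightedHomogeneous w (pderiv b f) (g - w b) :=
    IsWeightedHomogeneous.pderiv hf (sub_add_cancel _ _)
  have h2 : IsWeightedHomogeneous w (∑ a, A a b • (X a : MvPolynomial σ K)) (w b + ε) := by
    refine IsWeightedHomogeneous.sum _ _ _ fun a _ => ?_
    by_cases h : A a b = 0
    · rw [h, zero_smul]
      exact isWeightedHomogeneous_zero K w _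
    · rw [← hA a b h]
      exact (weightedHomogeneousSubmodule K w (w a)).smul_mem _ (isWeightedHomogeneous_X K w a)
  convert h2.mul h1 using 1
  abel

theorem formDer_mem_homogeneousForms {G : Type*} [AddCommGroup G] {w : σ → G} {A : Matrix σ σ K}
    {ε : G} (hA : ∀ a b, A a b ≠ 0 → w a = w b + ε) {ω : σ → MvPolynomial σ K} {g : G}
    (hω : ω ∈ homogeneousForms K w g) : formDer A ω ∈ homogeneousForms K w (g + ε) := by
  rw [mem_homogeneousForms] at *
  intro a
  rw [formDer_apply]
  refine IsWeightedHomogeneous.add ?_ (IsWeightedHomogeneous.sum _ _ _ fun b _ => ?_)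
  · rw [add_sub_right_comm]
    exact linDer_homogeneous hA (hω a)
  · by_cases h : A a b = 0
    · rw [h, zero_smul]
      exact isWeightedHomogeneous_zero K w _
    · rw [hA a b h, add_sub_add_right_eq_sub]
      exact (weightedHomogeneousSubmodule K w _).smul_mem _ (hω b)

/-- Euler's identity for weighted homogeneous polynomials. -/
theorem linDer_diagonal [DecidableEq σ] {G : Type*} [AddCommGroup G] {w : σ → G} (l : G →+ ℤ)
    {f : MvPolynomial σ K} {g : G} (hf : IsWeightedHomogeneous w f g) :
    linDer (Matrix.diagonal fun c => ((l (w c) : ℤ) : K)) f = ((l g : ℤ) : K) • f := by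
  have hmon : ∀ s : σ →₀ ℕ, ∀ r : K,
      linDer (Matrix.diagonal fun c => ((l (w c) : ℤ) : K)) (monomial s r) =
        ((l (Finsupp.weight w s) : ℤ) : K) • monomial s r := by
    intro s r
    rw [linDer_apply]
    have h : ∀ b, (∑ a, Matrix.diagonal (fun c => ((l (w c) : ℤ) : K)) a b •
        (X a : MvPolynomial σ K)) * pderiv b (monomial s r) =
        (((l (w b) : ℤ) : K) * s b) • monomial s r := by
      intro b
      rw [Finset.sum_eq_single b]
      · rw [Matrix.diagonal_apply_eq, smul_mul_assoc, X_mul_pderiv_monomial, mul_smul,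
          Nat.cast_smul_eq_nsmul]
      · intro a _ hab
        rw [Matrix.diagonal_apply_ne _ hab, zero_smul]
      · simp
    rw [Finset.sum_congr rfl fun b _ => h b, ← Finset.sum_smul, Finsupp.weight_apply,
      Finsupp.sum_fintype _ _ (by simp), map_sum]
    congr 1
    push_cast
    refine Finset.sum_congr rfl fun b _ => ?_
    rw [map_nsmul, nsmul_eq_mul, mul_comm]
    push_cast
    rfl
  rw [f.as_sum, map_sum, Finset.smul_sum]
  refine Finset.sum_congr rfl fun s hs => ?_
  rw [hmon, hf (mem_support_iff.1 hs)]

theorem formDer_diagonal [DecidableEq σ] {G : Type*} [AddCommGroup G] {w : σ → G} (l : G →+ ℤ)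
    {ω : σ → MvPolynomial σ K} {g : G} (hω : ω ∈ homogeneousForms K w g) :
    formDer (Matrix.diagonal fun c => ((l (w c) : ℤ) : K)) ω = ((l g : ℤ) : K) • ω := by
  funext a
  rw [formDer_apply, linDer_diagonal l (mem_homogeneousForms.1 hω a), Finset.sum_eq_single a]
  · rw [Matrix.diagonal_apply_eq, ← add_smul, map_sub, ← Int.cast_add, sub_add_cancel,
      Pi.smul_apply]
  · intro b _ hb
    rw [Matrix.diagonal_apply_ne _ hb.symm, zero_smul]
  · simp

end Derivations

/-! ### The `sl₂`-triple of a nilpotent matrix -/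

section JordanMatrices

open MvPolynomial

variable (K : Type*) [Field K] (p : List ℕ)

/-- The matrix of a nilpotent operator with cells of sizes `p_i + 1` in its Jordan basis: the
column of the `b`-th vector of a cell is the image of that vector, the vector before it. -/
def raiseMatrix : Matrix (CellIndex p) (CellIndex p) K :=
  Matrix.blockDiagonal' fun i => Matrix.of fun a b : Fin (p.get i + 1) =>
    if (b : ℕ) = a + 1 then 1 else 0

/-- The matrix completing `raiseMatrix` to an `sl₂`-triple: in each cell, it maps the vector with
number `a - 1` to `a (p_i + 1 - a)` times the vector with number `a`. -/
def lowerMatrix : Matrix (CellIndex p) (CellIndex p) K :=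
  Matrix.blockDiagonal' fun i => Matrix.of fun a b : Fin (p.get i + 1) =>
    if (a : ℕ) = b + 1 then (a * (p.get i + 1 - a) : K) else 0

theorem raiseMatrix_lowerMatrix :
    raiseMatrix K p * lowerMatrix K p - lowerMatrix K p * raiseMatrix K p =
      Matrix.diagonal fun c : CellIndex p => ((p.get c.1 - 2 * (c.2 : ℕ) : ℤ) : K) := by
  rw [raiseMatrix, lowerMatrix, ← Matrix.blockDiagonal'_mul, ← Matrix.blockDiagonal'_mul,
    ← Matrix.blockDiagonal'_sub]
  have hd : (Matrix.diagonal fun c : CellIndex p => ((p.get c.1 - 2 * (c.2 : ℕ) : ℤ) : K)) =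
      Matrix.blockDiagonal' fun i => Matrix.diagonal fun a : Fin (p.get i + 1) =>
        ((p.get i - 2 * (a : ℕ) : ℤ) : K) := (Matrix.blockDiagonal'_diagonal
        fun i (a : Fin (p.get i + 1)) => ((p.get i - 2 * (a : ℕ) : ℤ) : K)).symm
  rw [hd]
  congr 1
  funext i
  ext a b
  simp only [Pi.sub_apply, Matrix.sub_apply, Matrix.mul_apply, Matrix.of_apply, ite_mul, one_mul,
    zero_mul, mul_ite, mul_one, mul_zero, Matrix.diagonal_apply]
  rw [Fin.sum_univ_eq_sum_range (fun x => if x = (b : ℕ) + 1 then if x = (a : ℕ) + 1 then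
      (x * ((p.get i : K) + 1 - x) : K) else 0 else 0),
    Fin.sum_univ_eq_sum_range (fun x => if (b : ℕ) = x + 1 then if (a : ℕ) = x + 1 then
      ((a : ℕ) * ((p.get i : K) + 1 - (a : ℕ)) : K) else 0 else 0), Finset.sum_ite_eq']
  have h2 : (∑ x ∈ Finset.range (p.get i + 1), if (b : ℕ) = x + 1 then if (a : ℕ) = x + 1 then
      ((a : ℕ) * ((p.get i : K) + 1 - (a : ℕ)) : K) else 0 else 0) =
      if a = b then ((a : ℕ) * ((p.get i : K) + 1 - (a : ℕ)) : K) else 0 := by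
    rcases Nat.eq_zero_or_pos (b : ℕ) with hb | hb
    · rw [Finset.sum_eq_zero fun x _ => if_neg (by omega)]
      split_ifs with h
      · rw [h, hb, Nat.cast_zero, zero_mul]
      · rfl
    · rw [Finset.sum_eq_single ((b : ℕ) - 1)]
      · rw [if_pos (by omega)]
        congr 1
        rw [Fin.ext_iff]
        exact propext ⟨fun h => by omega, fun h => by omega⟩
      · intro x _ hx
        exact if_neg (by omega)
      · intro h
        exact absurd (Finset.mem_range.2 (by omega)) h
  rw [h2]
  by_cases hab : a = b
  · subst hab
    by_cases ha : (a : ℕ) + 1 ∈ Finset.range (p.get i + 1)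
    · rw [if_pos ha, if_pos rfl, if_pos rfl, if_pos rfl]
      push_cast
      ring
    · have ha' : (a : ℕ) = p.get i := by
        rw [Finset.mem_range] at ha
        omega
      rw [if_neg ha, if_pos rfl, if_pos rfl, ha']
      push_cast
      ring
  · have hab' : ¬ (b : ℕ) + 1 = (a : ℕ) + 1 := fun h => hab (Fin.ext (by omega))
    rw [if_neg hab', if_neg hab, if_neg hab, ite_self, sub_zero]

end JordanMatrices

/-! ### Numbers of monomials -/

section Count

open MvPolynomial

variable {σ G : Type*} [AddCommGroup G] {w : σ → G}

/-- The number of monomials of weight `g`, where the `c`-th variable has weight `w c`. -/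
noncomputable def monomialCount (w : σ → G) (g : G) : ℕ :=
  Nat.card {s : σ →₀ ℕ // Finsupp.weight w s = g}

theorem finrank_weightedHomogeneousSubmodule (K : Type*) [Field K] (g : G) :
    Module.finrank K (weightedHomogeneousSubmodule K w g) = monomialCount w g := by
  rw [weightedHomogeneousSubmodule_eq_finsupp_supported]
  exact Module.finrank_eq_nat_card_basis
    (basisRestrictSupport K {s : σ →₀ ℕ | Finsupp.weight w s = g})

/-! In what follows the homomorphism `l` reads off the degree of a monomial from its weight. -/

variable {l : G →+ ℤ} (hl : ∀ c, l (w c) = 1)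

include hl

theorem degree_eq_of_weight (s : σ →₀ ℕ) : l (Finsupp.weight w s) = s.degree := by
  rw [Finsupp.weight_apply, map_finsuppSum, Finsupp.degree_apply, Finsupp.sum]
  push_cast
  refine Finset.sum_congr rfl fun c _ => ?_
  rw [map_nsmul, hl, nsmul_eq_mul, mul_one]

theorem finite_weight_eq [Finite σ] (g : G) : {s : σ →₀ ℕ | Finsupp.weight w s = g}.Finite := by
  refine (Finsupp.finite_of_degree_le (σ := σ) (l g).toNat).subset fun s hs => ?_
  have h := degree_eq_of_weight hl s
  rw [hs] at h
  change s.degree ≤ (l g).toNat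
  omega

theorem isHomogeneous_of_weight {K : Type*} [Field K] {f : MvPolynomial σ K} {g : G} {n : ℕ}
    (hg : l g = n) (hf : IsWeightedHomogeneous w f g) : f.IsHomogeneous n := by
  intro s hs
  have h := degree_eq_of_weight hl s
  rw [hf hs, hg] at h
  have h1 : Finsupp.weight (1 : σ → ℕ) s = s.degree :=
    (DFunLike.congr_fun Finsupp.degree_eq_weight_one s).symm
  rw [h1]
  exact_mod_cast h.symm

theorem monomialCount_degree_zero {g : G} (hg : l g = 0) [Decidable (g = 0)] :
    monomialCount w g = if g = 0 then 1 else 0 := by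
  have h0 : ∀ s : σ →₀ ℕ, Finsupp.weight w s = g → s = 0 := by
    intro s hs
    have h := degree_eq_of_weight hl s
    rw [hs, hg] at h
    rw [← Finsupp.degree_eq_zero_iff]
    omega
  split_ifs with h
  · have : Unique {s : σ →₀ ℕ // Finsupp.weight w s = g} :=
      ⟨⟨⟨0, by rw [map_zero, h]⟩⟩, fun s => Subtype.ext (h0 s.1 s.2)⟩
    exact Nat.card_unique
  · have : IsEmpty {s : σ →₀ ℕ // Finsupp.weight w s = g} :=
      ⟨fun s => h (by rw [← s.2, h0 s.1 s.2, map_zero])⟩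
    exact Nat.card_of_isEmpty

theorem monomialCount_degree_one [Fintype σ] [DecidableEq G] {g : G} (hg : l g = 1) :
    monomialCount w g = ∑ c, if w c = g then 1 else 0 := by
  rw [Finset.sum_boole, Nat.cast_id, ← Fintype.card_subtype, ← Nat.card_eq_fintype_card]
  symm
  refine Nat.card_congr (Equiv.ofBijective
    (fun c : {c // w c = g} => ⟨Finsupp.single c.1 1, by
      rw [Finsupp.weight_single, one_smul, c.2]⟩) ⟨?_, ?_⟩)
  · rintro ⟨a, ha⟩ ⟨b, hb⟩ h
    exact Subtype.ext (Finsupp.single_left_injective one_ne_zero (congrArg Subtype.val h))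
  · rintro ⟨s, hs⟩
    have h := degree_eq_of_weight hl s
    rw [hs, hg] at h
    have hs1 : s ∈ {s : σ →₀ ℕ | s.degree = 1} := by exact_mod_cast h.symm
    rw [← Finsupp.range_single_one] at hs1
    obtain ⟨c, hc⟩ := hs1
    refine ⟨⟨c, ?_⟩, Subtype.ext hc⟩
    rw [← hs, ← hc, Finsupp.weight_single, one_smul]

end Count

/-! ### Dimensions of spaces of differential forms -/

section Dimensions

open MvPolynomial

variable {σ G K : Type*} [AddCommGroup G] {w : σ → G} [Field K]

/-- The space of forms of weight `g` is the product of the spaces of their coefficients. -/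
noncomputable def homogeneousFormsEquiv (w : σ → G) (g : G) :
    homogeneousForms K w g ≃ₗ[K] ∀ c, weightedHomogeneousSubmodule K w (g - w c) where
  toFun ω c := ⟨ω.1 c, mem_homogeneousForms.1 ω.2 c⟩
  invFun f := ⟨fun c => f c, mem_homogeneousForms.2 fun c => (f c).2⟩
  map_add' _ _ := rfl
  map_smul' _ _ := rfl
  left_inv _ := rfl
  right_inv _ := rfl

variable [Fintype σ] {l : G →+ ℤ} (hl : ∀ c, l (w c) = 1)

include hl

theorem finite_weightedHomogeneousSubmodule (g : G) :
    Module.Finite K (weightedHomogeneousSubmodule K w g) := by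
  rw [weightedHomogeneousSubmodule_eq_finsupp_supported]
  have := (finite_weight_eq hl g).to_subtype
  exact Module.Finite.of_basis
    (basisRestrictSupport K {s : σ →₀ ℕ | Finsupp.weight w s = g})

theorem finite_homogeneousForms (g : G) : Module.Finite K (homogeneousForms K w g) := by
  have := fun g => finite_weightedHomogeneousSubmodule (K := K) hl g
  exact Module.Finite.equiv (homogeneousFormsEquiv w g).symm

theorem finrank_homogeneousForms (g : G) :
    Module.finrank K (homogeneousForms K w g) = ∑ c, monomialCount w (g - w c) := by
  have := fun g => finite_weightedHomogeneousSubmodule (K := K) hl g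
  rw [(homogeneousFormsEquiv w g).finrank_eq, Module.finrank_pi_fintype]
  simp only [finrank_weightedHomogeneousSubmodule]

omit hl in
theorem contraction_homogeneous {g : G} {ω : σ → MvPolynomial σ K}
    (hω : ω ∈ homogeneousForms K w g) : IsWeightedHomogeneous w (contraction σ K ω) g := by
  rw [contraction_apply]
  refine IsWeightedHomogeneous.sum _ _ _ fun c _ => ?_
  have := (isWeightedHomogeneous_X K w c).mul (mem_homogeneousForms.1 hω c)
  rwa [add_sub_cancel] at this

/-- By Euler's identity the contraction maps forms of positive degree onto the polynomials of the
same degree, and this gives the dimension of its kernel. -/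
theorem finrank_ker_contraction_add [CharZero K] {g : G} (hg : 1 ≤ l g) :
    Module.finrank K (LinearMap.ker ((contraction σ K).restrictScalars K) ⊓
      homogeneousForms K w g : Submodule K (σ → MvPolynomial σ K)) + monomialCount w g =
        ∑ c, monomialCount w (g - w c) := by
  have := finite_homogeneousForms (K := K) hl g
  have hmap : ∀ ω ∈ homogeneousForms K w g,
      (contraction σ K).restrictScalars K ω ∈ weightedHomogeneousSubmodule K w g := by
    exact fun ω hω => contraction_homogeneous hω
  let T := ((contraction σ K).restrictScalars K).restrict hmap
  have hT : Function.Surjective T := by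
    rintro ⟨f, hf⟩
    obtain ⟨n, hn⟩ : ∃ n : ℕ, l g = n := ⟨(l g).toNat, by omega⟩
    have hn0 : (n : K) ≠ 0 := Nat.cast_ne_zero.2 (by omega)
    have hf' : f.IsHomogeneous n := isHomogeneous_of_weight hl hn hf
    refine ⟨⟨(n : K)⁻¹ • fun c => pderiv c f, Submodule.smul_mem _ _
      (mem_homogeneousForms.2 fun c => IsWeightedHomogeneous.pderiv hf (sub_add_cancel _ _))⟩,
      Subtype.ext ?_⟩
    change contraction σ K ((n : K)⁻¹ • fun c => pderiv c f) = f
    rw [LinearMap.map_smul_of_tower, contraction_apply, hf'.sum_X_mul_pderiv,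
      ← Nat.cast_smul_eq_nsmul K, smul_smul, inv_mul_cancel₀ hn0, one_smul]
  have h := T.finrank_range_add_finrank_ker
  rw [LinearMap.range_eq_top.2 hT, finrank_top, finrank_weightedHomogeneousSubmodule,
    finrank_homogeneousForms hl] at h
  have hker : (LinearMap.ker T).map (homogeneousForms K w g).subtype =
      LinearMap.ker ((contraction σ K).restrictScalars K) ⊓ homogeneousForms K w g := by
    ext v
    constructor
    · rintro ⟨⟨u, hu⟩, hu0, rfl⟩
      exact ⟨congrArg Subtype.val hu0, hu⟩
    · rintro ⟨h0, hv⟩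
      exact ⟨⟨v, hv⟩, Subtype.ext h0, rfl⟩
  rw [← hker, Submodule.finrank_map_subtype_eq, add_comm]
  exact h

variable (σ K) in
omit hl in
/-- The forms of degree `n` in the image of the Magnus embedding: there is no condition in degree
one, and in higher degrees the contraction with the Euler field has to vanish. -/
noncomputable def magnusForms (n : ℤ) : Submodule K (σ → MvPolynomial σ K) :=
  if n = 1 then ⊤ else LinearMap.ker ((contraction σ K).restrictScalars K)

omit hl in
theorem formDer_mem_magnusForms (A : Matrix σ σ K) {n : ℤ} {ω : σ → MvPolynomial σ K}
    (hω : ω ∈ magnusForms σ K n) : formDer A ω ∈ magnusForms σ K n := by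
  rw [magnusForms] at *
  split_ifs at * with h
  · exact Submodule.mem_top
  · rw [LinearMap.mem_ker, LinearMap.restrictScalars_apply] at *
    rw [contraction_formDer, hω, map_zero]

/-- The dimension of the space of forms of weight `g` in the image of the Magnus embedding, in terms
of numbers of monomials; in degree one no form has to be discarded. -/
theorem finrank_magnusForms_add [CharZero K] {g : G} (hg : 1 ≤ l g) :
    Module.finrank K (magnusForms σ K (l g) ⊓ homogeneousForms K w g :
      Submodule K (σ → MvPolynomial σ K)) + monomialCount w g =
        ∑ c, monomialCount w (g - w c) + if l g = 1 then monomialCount w g else 0 := by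
  rw [magnusForms]
  split_ifs with h
  · rw [if_pos h, top_inf_eq, finrank_homogeneousForms hl]
  · rw [if_neg h, finrank_ker_contraction_add hl hg, add_zero]

omit [Fintype σ] in
theorem homogeneousForms_le_degree (g : G) :
    homogeneousForms K w g ≤ homogeneousForms K (fun _ => (1 : ℤ)) (l g) := by
  refine fun ω hω => mem_homogeneousForms.2 fun c s hs => ?_
  have h := degree_eq_of_weight hl s
  rw [mem_homogeneousForms.1 hω c hs, map_sub, hl] at h
  rw [h]
  exact degree_eq_of_weight (l := AddMonoidHom.id ℤ) (fun _ => rfl) s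

omit [Fintype σ] in
/-- If the absolute value of a linear functional `L` on the weights is bounded by `B` on the
variables, it is bounded by `B n` on the forms of degree `n`. -/
theorem homogeneousForms_eq_bot (L : G →+ ℤ) {B : ℤ} (hB : ∀ c, |L (w c)| ≤ B) {g : G}
    (hg : B * l g < |L g|) : homogeneousForms K w g = ⊥ := by
  rw [eq_bot_iff]
  intro ω hω
  rw [Submodule.mem_bot]
  funext c
  refine (mem_homogeneousForms.1 hω c).eq_zero_of_no_monomials fun s hs => ?_
  have hl' := degree_eq_of_weight hl s
  have hL : |L (Finsupp.weight w s)| ≤ B * s.degree := by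
    rw [Finsupp.weight_apply, map_finsuppSum, Finsupp.sum, Finsupp.degree_apply]
    push_cast
    rw [Finset.mul_sum]
    refine (Finset.abs_sum_le_sum_abs _ _).trans (Finset.sum_le_sum fun b _ => ?_)
    rw [map_nsmul, nsmul_eq_mul, abs_mul, mul_comm, abs_of_nonneg (Int.natCast_nonneg (s b))]
    exact mul_le_mul_of_nonneg_right (hB b) (Int.natCast_nonneg _)
  rw [hs, map_sub, hl] at hl'
  rw [hs, map_sub, ← hl', mul_sub, mul_one] at hL
  have h1 := hB c
  have h2 := abs_sub_abs_le_abs_sub (L g) (L (w c))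
  linarith

end Dimensions

/-! ### The image of the Magnus embedding -/

section Embedding

open MvPolynomial

variable {σ G K : Type*} [AddCommGroup G] {w : σ → G} {l : G →+ ℤ} (hl : ∀ c, l (w c) = 1)

include hl in
theorem length_eq_of_weight (m : FreeMagma σ) : l (weight w m) = m.length := by
  rw [← weight_map, ← weight_one, ← Nat.coe_castAddMonoidHom, ← weight_map]
  congr 1
  funext c
  rw [hl]
  rfl

variable [Field K] {d : ℕ} {e : σ → Alg K d}
  {φ : Alg K d →ₗ⁅K⁆ MagnusAlgebra (MvPolynomial σ K) (σ → MvPolynomial σ K)}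

variable (φ) in
/-- The linear component of the Magnus embedding, with values in the differential forms. -/
noncomputable def magnusForm : Alg K d →ₗ[K] (σ → MvPolynomial σ K) :=
  MagnusAlgebra.sndₗ (MvPolynomial σ K) (σ → MvPolynomial σ K) K ∘ₗ
    (φ : Alg K d →ₗ[K] MagnusAlgebra (MvPolynomial σ K) (σ → MvPolynomial σ K))

theorem magnusForm_apply (u : Alg K d) : magnusForm φ u = (φ u).2 := rfl

variable [Fintype σ]

include hl in
/-- The elements of degree one are the linear combinations of the generators. -/
theorem exists_sum_of_mem_weightSpan {g : G} (hg : l g = 1) {u : Alg K d}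
    (hu : u ∈ weightSpan K w e g) : ∃ r : σ → K, ∑ c, r c • e c = u := by
  rw [← Submodule.mem_span_range_iff_exists_fun]
  refine Submodule.span_le.2 ?_ hu
  rintro _ ⟨m, hm, rfl⟩
  have h := length_eq_of_weight hl m
  rw [hm, hg] at h
  cases m with
  | of c => exact Submodule.subset_span ⟨c, rfl⟩
  | mul a b =>
    have ha := a.length_pos
    have hb := b.length_pos
    have : ((FreeMagma.mul a b).length : ℤ) = a.length + b.length := Nat.cast_add _ _
    omega

variable [DecidableEq σ] (hφ : ∀ c, φ (e c) = magnusGen K c)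

include hφ

theorem magnusForm_sum (r : σ → K) :
    magnusForm φ (∑ c, r c • e c) = fun c => C (r c) := by
  funext c
  rw [map_sum, Finset.sum_apply, Finset.sum_eq_single c]
  · rw [map_smul, magnusForm_apply, hφ, snd_magnusGen, Pi.smul_apply, Pi.single_eq_same,
      smul_eq_C_mul, mul_one]
  · intro b _ hb
    rw [map_smul, magnusForm_apply, hφ, snd_magnusGen, Pi.smul_apply, Pi.single_eq_of_ne hb.symm,
      smul_zero]
  · simp

include hl

/-- In degree `n ≥ 2` the exterior map is a left inverse of the Magnus embedding, up to the factor
`n`. -/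
theorem exteriorMap_magnusForm
    {act : MvPolynomial σ K →ₐ[K] Module.End K (LieAlgebra.derivedSeries K (Alg K d) 1)}
    (hact : ∀ c (u : LieAlgebra.derivedSeries K (Alg K d) 1), act (X c) u = ⁅e c, u⁆)
    {g : G} {n : ℕ} (hn : 2 ≤ n) (hg : l g = n) {u : Alg K d} (hu : u ∈ weightSpan K w e g) :
    exteriorMap e act (magnusForm φ u) = (n : K) • u := by
  induction hu using Submodule.span_induction with
  | zero => rw [map_zero, map_zero, smul_zero]
  | add a b _ _ ha hb => rw [map_add, map_add, smul_add, ha, hb]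
  | smul r a _ ha => rw [map_smul, map_smul, ha, smul_comm]
  | mem a ha =>
    obtain ⟨m, hm, rfl⟩ := ha
    have h := length_eq_of_weight hl m
    rw [hm, hg] at h
    have h' : n = m.length := by exact_mod_cast h
    rw [h']
    exact (exteriorMap_snd_lieMonomial hact hφ (h' ▸ hn)).2

variable [CharZero K]

/-- The Magnus embedding is injective, even its linear component. -/
theorem magnusForm_injective {g : G} (hg : 1 ≤ l g) {u : Alg K d}
    (hu : u ∈ weightSpan K w e g) (h0 : magnusForm φ u = 0) : u = 0 := by
  obtain ⟨n, hn⟩ : ∃ n : ℕ, l g = n := ⟨(l g).toNat, by omega⟩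
  by_cases h1 : l g = 1
  · obtain ⟨r, rfl⟩ := exists_sum_of_mem_weightSpan hl h1 hu
    rw [magnusForm_sum hφ] at h0
    have hr : ∀ c, r c = 0 := fun c => by
      have := congrFun h0 c
      rwa [Pi.zero_apply, C_eq_zero] at this
    simp [hr]
  · obtain ⟨act, hact⟩ := exists_polynomial_action e
    have h := exteriorMap_magnusForm hl hφ hact (by omega) hn hu
    rw [h0, map_zero] at h
    exact (smul_eq_zero.1 h.symm).resolve_left (Nat.cast_ne_zero.2 (by omega))

/-- The image of the Magnus embedding. In degree one it consists of the forms with constant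
coefficients; in degree `n ≥ 2` the exterior map, divided by `n`, provides preimages. -/
theorem map_weightSpan {g : G} (hg : 1 ≤ l g) :
    (weightSpan K w e g).map (magnusForm φ) =
      magnusForms σ K (l g) ⊓ homogeneousForms K w g := by
  obtain ⟨n, hn⟩ : ∃ n : ℕ, l g = n := ⟨(l g).toNat, by omega⟩
  apply le_antisymm
  · rw [Submodule.map_le_iff_le_comap, weightSpan, Submodule.span_le]
    rintro _ ⟨m, hm, rfl⟩
    have h := length_eq_of_weight hl m
    rw [hm] at h
    refine ⟨?_, ?_⟩
    · rw [SetLike.mem_coe, magnusForms]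
      split_ifs with h1
      · exact Submodule.mem_top
      · rw [LinearMap.mem_ker, LinearMap.restrictScalars_apply, magnusForm_apply,
          ← fst_lieMonomial hφ]
        cases m with
        | of c => exact absurd h h1
        | mul a b => exact fst_apply_of_mem_derivedSeries_one (lieMonomial_mul_mem a b)
    · rw [← show weight w m = g from hm]
      exact (lieMonomial_homogeneous hφ w m).2
  · rintro ω ⟨hω, hωg⟩
    by_cases h1 : l g = 1
    · have hconst : ∀ c, ω c = C (coeff 0 (ω c)) := by
        intro c
        have hc : (ω c).IsHomogeneous 0 :=
          isHomogeneous_of_weight hl (by rw [map_sub, h1, hl]; rfl) (mem_homogeneousForms.1 hωg c)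
        exact totalDegree_eq_zero_iff_eq_C.1 ((totalDegree_zero_iff_isHomogeneous _).2 hc)
      refine ⟨∑ c, coeff 0 (ω c) • e c, Submodule.sum_mem _ fun c _ => ?_, ?_⟩
      · by_cases h : coeff 0 (ω c) = 0
        · rw [h, zero_smul]
          exact zero_mem _
        · have hw := mem_homogeneousForms.1 hωg c h
          rw [map_zero] at hw
          rw [sub_eq_zero.1 hw.symm]
          exact Submodule.smul_mem _ _ (mem_weightSpan w e c)
      · rw [magnusForm_sum hφ]
        funext c
        exact (hconst c).symm
    · obtain ⟨act, hact⟩ := exists_polynomial_action e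
      have hn0 : (n : K) ≠ 0 := Nat.cast_ne_zero.2 (by omega)
      refine ⟨(n : K)⁻¹ • exteriorMap e act ω,
        Submodule.smul_mem _ _ (exteriorMap_mem_weightSpan hact hωg), ?_⟩
      rw [SetLike.mem_coe, magnusForms, if_neg h1, LinearMap.mem_ker,
        LinearMap.restrictScalars_apply] at hω
      have hh : ∀ c, (ω c).IsHomogeneous (n - 1) := fun c =>
        isHomogeneous_of_weight hl (by rw [map_sub, hn, hl]; omega) (mem_homogeneousForms.1 hωg c)
      have hcast : ((n - 1 : ℕ) : K) + 1 = n := by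
        exact_mod_cast Nat.sub_add_cancel (by omega : 1 ≤ n)
      rw [map_smul, magnusForm_apply, snd_exteriorMap hact hφ hh, hω, hcast]
      simp only [map_zero]
      rw [show (fun _ => 0 : σ → MvPolynomial σ K) = 0 from rfl, sub_zero, smul_smul,
        inv_mul_cancel₀ hn0, one_smul]

omit hl [CharZero K] in
/-- The Magnus embedding turns a derivation acting on the generators by the matrix `A` into the
action of the linear vector field with matrix `A`. -/
theorem map_derivation_lieMonomial {δ : LieDerivation K (Alg K d) (Alg K d)} {A : Matrix σ σ K}
    (hδ : ∀ b, δ (e b) = ∑ a, A a b • e a) (m : FreeMagma σ) :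
    (φ (δ (lieMonomial e m))).1 = linDer A (φ (lieMonomial e m)).1 ∧
      (φ (δ (lieMonomial e m))).2 = formDer A (φ (lieMonomial e m)).2 := by
  induction m using FreeMagma.rec with
  | of b =>
    change (φ (δ (e b))).1 = linDer A (φ (e b)).1 ∧ (φ (δ (e b))).2 = formDer A (φ (e b)).2
    rw [hδ, hφ]
    constructor
    · rw [fst_magnusGen, linDer_X, map_sum]
      have : ∀ (f : σ → MagnusAlgebra (MvPolynomial σ K) (σ → MvPolynomial σ K)),
          (∑ c, f c).1 = ∑ c, (f c).1 := fun f =>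
        map_sum (AddMonoidHom.fst (MvPolynomial σ K) (σ → MvPolynomial σ K)) f Finset.univ
      rw [this]
      refine Finset.sum_congr rfl fun a _ => ?_
      rw [map_smul, MagnusAlgebra.fst_smul, hφ, fst_magnusGen]
    · rw [← magnusForm_apply, magnusForm_sum hφ, snd_magnusGen]
      funext a
      rw [formDer_apply, Finset.sum_eq_single b]
      · rw [Pi.single_eq_same, smul_eq_C_mul, mul_one]
        by_cases h : a = b
        · rw [h, Pi.single_eq_same, Derivation.map_one_eq_zero, zero_add]
        · rw [Pi.single_eq_of_ne h, map_zero, zero_add]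
      · intro c _ hc
        rw [Pi.single_eq_of_ne hc, smul_zero]
      · simp
  | mul a b ha hb =>
    change (φ (δ ⁅lieMonomial e a, lieMonomial e b⁆)).1 =
      linDer A (φ ⁅lieMonomial e a, lieMonomial e b⁆).1 ∧
      (φ (δ ⁅lieMonomial e a, lieMonomial e b⁆)).2 =
      formDer A (φ ⁅lieMonomial e a, lieMonomial e b⁆).2
    rw [LieDerivation.apply_lie_eq_add, map_add, LieHom.map_lie, LieHom.map_lie, LieHom.map_lie,
      MagnusAlgebra.fst_add, MagnusAlgebra.snd_add]
    simp only [MagnusAlgebra.fst_lie, MagnusAlgebra.snd_lie, map_zero, add_zero, true_and, map_sub,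
      formDer_smul, ha, hb]
    abel

omit hl [CharZero K] in
theorem magnusForm_derivation {δ : LieDerivation K (Alg K d) (Alg K d)} {A : Matrix σ σ K}
    (hδ : ∀ b, δ (e b) = ∑ a, A a b • e a) {g : G} {u : Alg K d} (hu : u ∈ weightSpan K w e g) :
    magnusForm φ (δ u) = formDer A (magnusForm φ u) := by
  induction hu using Submodule.span_induction with
  | zero => simp only [map_zero]
  | add a b _ _ ha hb => simp only [map_add, ha, hb]
  | smul r a _ ha => simp only [map_smul, ha]
  | mem a ha =>
    obtain ⟨m, -, rfl⟩ := ha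
    exact (map_derivation_lieMonomial hφ hδ m).2

/-- The constants of a derivation that acts on the generators by the matrix `A`, in terms of
differential forms. Here `ε` is the amount by which the derivation shifts the weights. -/
theorem finrank_constants {δ : LieDerivation K (Alg K d) (Alg K d)} {A : Matrix σ σ K}
    (hδ : ∀ b, δ (e b) = ∑ a, A a b • e a) {ε : G} (hε : l ε = 0)
    (hA : ∀ a b, A a b ≠ 0 → w a = w b + ε) {g : G} (hg : 1 ≤ l g) :
    Module.finrank K (LinearMap.ker (δ : Alg K d →ₗ[K] Alg K d) ⊓ weightSpan K w e g :
      Submodule K (Alg K d)) =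
    Module.finrank K (LinearMap.ker (formDer A) ⊓ (magnusForms σ K (l g) ⊓
      homogeneousForms K w g) : Submodule K (σ → MvPolynomial σ K)) := by
  have hδmem : ∀ u ∈ weightSpan K w e g, δ u ∈ weightSpan K w e (g + ε) := by
    intro u hu
    refine derivation_mem_weightSpan δ (fun b => ?_) hu
    rw [hδ]
    refine Submodule.sum_mem _ fun a _ => ?_
    by_cases h : A a b = 0
    · rw [h, zero_smul]
      exact zero_mem _
    · rw [← hA a b h]
      exact Submodule.smul_mem _ _ (mem_weightSpan w e a)
  set U : Submodule K (Alg K d) := LinearMap.ker (δ : Alg K d →ₗ[K] Alg K d) ⊓ weightSpan K w e g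
    with hU
  have hinj : Function.Injective ((magnusForm φ).domRestrict U) := by
    rw [← LinearMap.ker_eq_bot, eq_bot_iff]
    rintro ⟨u, hu⟩ h0
    exact Subtype.ext (magnusForm_injective hl hφ hg hu.2 h0)
  have himage : LinearMap.range ((magnusForm φ).domRestrict U) =
      LinearMap.ker (formDer A) ⊓ (magnusForms σ K (l g) ⊓ homogeneousForms K w g) := by
    rw [← map_weightSpan hl hφ hg]
    ext ω
    constructor
    · rintro ⟨⟨u, hu⟩, rfl⟩
      refine ⟨?_, u, hu.2, rfl⟩
      have h := magnusForm_derivation hφ hδ hu.2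
      have h0 : δ u = 0 := hu.1
      rw [h0, map_zero] at h
      exact h.symm
    · rintro ⟨h0, u, hu, rfl⟩
      refine ⟨⟨u, ?_, hu⟩, rfl⟩
      refine magnusForm_injective (g := g + ε) hl hφ (by rw [map_add, hε, add_zero]; exact hg)
        (hδmem u hu) ((magnusForm_derivation hφ hδ hu).trans h0)
  rw [← himage, LinearMap.finrank_range_of_inj hinj]

end Embedding

/-! ### The kernel of the raising operator -/

section Raise

open MvPolynomial

/-! The homomorphisms `l` and `L` read off the degree and the `sl₂`-weight from the weight of a
variable, and `ε` is the weight of the raising operator. -/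

variable {K G : Type*} [Field K] [CharZero K] [AddCommGroup G] {p : List ℕ} {w : CellIndex p → G}
  {l L : G →+ ℤ} {ε : G} (hl : ∀ c, l (w c) = 1) (hL : ∀ c, L (w c) = p.get c.1 - 2 * (c.2 : ℕ))
  (hlε : l ε = 0) (hLε : L ε = 2)
  (hwε : ∀ (i : Fin p.length) (j k : Fin (p.get i + 1)), (k : ℕ) = j + 1 →
    w ⟨i, j⟩ = w ⟨i, k⟩ + ε)

variable (K w) in
/-- The forms of weight `g` and degree `n` in the image of the Magnus embedding. -/
noncomputable def magnusWeightSpace (n : ℤ) (g : G) :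
    Submodule K (CellIndex p → MvPolynomial (CellIndex p) K) :=
  magnusForms (CellIndex p) K n ⊓ homogeneousForms K w g

omit [CharZero K] in
include hwε in
theorem weight_of_raiseMatrix_ne_zero {a b : CellIndex p} (h : raiseMatrix K p a b ≠ 0) :
    w a = w b + ε := by
  obtain ⟨i, a⟩ := a
  obtain ⟨j, b⟩ := b
  by_cases hij : i = j
  · subst hij
    rw [raiseMatrix, Matrix.blockDiagonal'_apply_eq, Matrix.of_apply] at h
    exact hwε i a b (by by_contra h'; exact h (if_neg h'))
  · rw [raiseMatrix, Matrix.blockDiagonal'_apply_ne _ _ _ hij] at h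
    exact absurd rfl h

omit [CharZero K] in
include hwε in
theorem weight_of_lowerMatrix_ne_zero {a b : CellIndex p} (h : lowerMatrix K p a b ≠ 0) :
    w a = w b + -ε := by
  obtain ⟨i, a⟩ := a
  obtain ⟨j, b⟩ := b
  by_cases hij : i = j
  · subst hij
    rw [lowerMatrix, Matrix.blockDiagonal'_apply_eq, Matrix.of_apply] at h
    rw [hwε i b a (by by_contra h'; exact h (if_neg h')), add_neg_cancel_right]
  · rw [lowerMatrix, Matrix.blockDiagonal'_apply_ne _ _ _ hij] at h
    exact absurd rfl h

omit [CharZero K] in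
include hl hL hlε hLε in
/-- In each degree only finitely many `sl₂`-weights occur. -/
theorem exists_magnusWeightSpace_eq_bot (g : G) :
    (∃ k : ℕ, magnusWeightSpace K w (l g) (g + (1 + (k : ℤ)) • ε) = ⊥) ∧
      ∃ k : ℕ, magnusWeightSpace K w (l g) (g + (0 - (k : ℤ)) • ε) = ⊥ := by
  have hB : ∀ c, |L (w c)| ≤ p.sum := by
    intro c
    have h1 : p.get c.1 ≤ p.sum := List.le_sum_of_mem (List.get_mem p c.1)
    have h2 := c.2.isLt
    rw [hL, abs_le]
    constructor <;> omega
  have hbot : ∀ k : ℤ, p.sum * l g < |L g + 2 * k| →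
      magnusWeightSpace K w (l g) (g + k • ε) = ⊥ := by
    intro k hk
    rw [magnusWeightSpace, homogeneousForms_eq_bot hl L hB, inf_bot_eq]
    rwa [map_add, map_add, map_zsmul, map_zsmul, hlε, hLε, smul_zero, add_zero, smul_eq_mul,
      mul_comm k]
  obtain ⟨M, hM⟩ : ∃ M : ℕ, p.sum * l g ≤ M := ⟨(p.sum * l g).toNat, Int.self_le_toNat _⟩
  refine ⟨⟨M + (L g).natAbs, hbot _ ?_⟩, ⟨M + (L g).natAbs + 1, hbot _ ?_⟩⟩
  · rw [lt_abs]
    left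
    rw [Nat.cast_add]
    omega
  · rw [lt_abs]
    right
    rw [Nat.cast_add, Nat.cast_add]
    omega

omit [CharZero K] in
include hL hwε in
theorem raise_lower_magnusWeightSpace (n : ℤ) (g : G) :
    (∀ v ∈ magnusWeightSpace K w n g,
      formDer (raiseMatrix K p) v ∈ magnusWeightSpace K w n (g + ε)) ∧
    (∀ v ∈ magnusWeightSpace K w n (g + ε),
      formDer (lowerMatrix K p) v ∈ magnusWeightSpace K w n g) ∧
    ∀ v ∈ magnusWeightSpace K w n g,
      formDer (raiseMatrix K p) (formDer (lowerMatrix K p) v) -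
        formDer (lowerMatrix K p) (formDer (raiseMatrix K p) v) = ((L g : ℤ) : K) • v := by
  refine ⟨fun v hv => ⟨formDer_mem_magnusForms _ hv.1, formDer_mem_homogeneousForms
    (fun a b h => weight_of_raiseMatrix_ne_zero (K := K) hwε h) hv.2⟩,
    fun v hv => ⟨formDer_mem_magnusForms _ hv.1, ?_⟩, fun v hv => ?_⟩
  · have := formDer_mem_homogeneousForms
      (fun a b h => weight_of_lowerMatrix_ne_zero (K := K) hwε h) hv.2
    rwa [add_neg_cancel_right] at this
  · rw [formDer_commutator, raiseMatrix_lowerMatrix, ← formDer_diagonal L hv.2]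
    simp only [hL]

include hl hL hlε hLε hwε

/-- The dimensions of the weight spaces in the kernel of the raising operator. There are no vectors
of highest weight in the spaces of negative `sl₂`-weight, where the raising operator is injective;
elsewhere it is surjective onto the next space. -/
theorem finrank_ker_formDer_raise (g : G) :
    (Module.finrank K (LinearMap.ker (formDer (raiseMatrix K p)) ⊓ magnusWeightSpace K w (l g) g :
      Submodule K (CellIndex p → MvPolynomial (CellIndex p) K)) : ℤ) =
    if 0 ≤ L g then (Module.finrank K (magnusWeightSpace K w (l g) g) : ℤ) -
      Module.finrank K (magnusWeightSpace K w (l g) (g + ε)) else 0 := by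
  let W : ℤ → Submodule K (CellIndex p → MvPolynomial (CellIndex p) K) := fun k =>
    magnusWeightSpace K w (l g) (g + k • ε)
  have hW0 : W 0 = magnusWeightSpace K w (l g) g := by simp only [W, zero_smul, add_zero]
  have hW1 : W 1 = magnusWeightSpace K w (l g) (g + ε) := by simp only [W, one_smul]
  have hstep : ∀ k : ℤ, W (k + 1) = magnusWeightSpace K w (l g) (g + k • ε + ε) := fun k => by
    simp only [W, add_smul, one_smul, add_assoc]
  have hE : ∀ k, ∀ v ∈ W k, formDer (raiseMatrix K p) v ∈ W (k + 1) := fun k v hv => by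
    rw [hstep]
    exact (raise_lower_magnusWeightSpace hL hwε _ _).1 v hv
  have hF : ∀ k, ∀ v ∈ W (k + 1), formDer (lowerMatrix K p) v ∈ W k := fun k v hv => by
    rw [hstep] at hv
    exact (raise_lower_magnusWeightSpace hL hwε _ _).2.1 v hv
  have hEF : ∀ k, ∀ v ∈ W k, formDer (raiseMatrix K p) (formDer (lowerMatrix K p) v) -
      formDer (lowerMatrix K p) (formDer (raiseMatrix K p) v) =
        ((L g + 2 * k : ℤ) : K) • v := fun k v hv => by
    rw [(raise_lower_magnusWeightSpace hL hwε _ _).2.2 v hv, map_add, map_zsmul, hLε,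
      smul_eq_mul, mul_comm k]
  have hbot := exists_magnusWeightSpace_eq_bot (K := K) hl hL hlε hLε g
  rw [← hW0, ← hW1]
  have hfin : Module.Finite K (W 0) := by
    have := finite_homogeneousForms (K := K) hl g
    rw [hW0]
    exact Submodule.finiteDimensional_of_le (S₂ := homogeneousForms K w g) inf_le_right
  split_ifs with h
  · rw [← finrank_ker_raise_add hE hF hEF h hbot.1]
    push_cast
    ring
  · have hker : LinearMap.ker (formDer (raiseMatrix K p)) ⊓ W 0 = ⊥ := by
      rw [eq_bot_iff]
      intro v hv
      exact raise_injective (j := 0) hF hEF (by omega) hbot.2 hv.2 hv.1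
    rw [hker, finrank_bot, Nat.cast_zero]

end Raise

/-! ### Decomposition into weight spaces -/

section Decomposition

open MvPolynomial

/-- The dimension of a space that is the direct sum of the images of finitely many projections. -/
theorem finrank_eq_sum_of_projections {K V ι : Type*} [Field K] [AddCommGroup V] [Module K V]
    (Z : Submodule K V) (I : Finset ι) (Y : ι → Submodule K V) [∀ i, Module.Finite K (Y i)]
    (π : ι → V →ₗ[K] V) (hπ : ∀ i, ∀ v ∈ Y i, π i v = v)
    (hπ' : ∀ i j, i ≠ j → ∀ v ∈ Y j, π i v = 0) (hY : ∀ i, Y i ≤ Z)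
    (hZ : ∀ i ∈ I, ∀ v ∈ Z, π i v ∈ Y i) (hsum : ∀ v ∈ Z, ∑ i ∈ I, π i v = v) :
    Module.finrank K Z = ∑ i ∈ I, Module.finrank K (Y i) := by
  classical
  let T : (∀ i : I, Y i) →ₗ[K] V := ∑ i : I, (Y i).subtype ∘ₗ LinearMap.proj i
  have hT : ∀ z, T z = ∑ i : I, (z i : V) := fun z => by
    simp only [T, LinearMap.sum_apply]
    rfl
  have hinj : Function.Injective T := by
    rw [← LinearMap.ker_eq_bot, eq_bot_iff]
    intro z hz
    have hz' : T z = 0 := hz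
    rw [Submodule.mem_bot]
    funext i
    have h : π i (T z) = z i := by
      rw [hT, map_sum, Finset.sum_eq_single i]
      · exact hπ i _ (z i).2
      · intro j _ hj
        exact hπ' _ _ (fun h => hj (Subtype.ext h.symm)) _ (z j).2
      · exact fun h => absurd (Finset.mem_univ i) h
    rw [hz', map_zero] at h
    exact Subtype.ext h.symm
  have hrange : LinearMap.range T = Z := by
    ext v
    constructor
    · rintro ⟨z, rfl⟩
      rw [hT]
      exact Submodule.sum_mem _ fun i _ => hY i (z i).2
    · intro hv
      refine ⟨fun i => ⟨π i v, hZ i i.2 v hv⟩, ?_⟩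
      rw [hT]
      exact (Finset.sum_coe_sort I fun i => π i v).trans (hsum v hv)
  rw [← hrange, LinearMap.finrank_range_of_inj hinj, Module.finrank_pi_fintype]
  exact Finset.sum_coe_sort I fun i => Module.finrank K (Y i)

variable {K : Type*} [Field K] {p : List ℕ}

variable (p) in
/-- The weight and the degree of the variables: the `k`-th vector of the `i`-th cell has
`sl₂`-weight `p_i - 2k`. -/
def cellWeight (c : CellIndex p) : ℤ × ℤ :=
  (p.get c.1 - 2 * (c.2 : ℕ), 1)

theorem abs_cellWeight_le (c : CellIndex p) : |(cellWeight p c).1| ≤ p.sum := by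
  have h1 : p.get c.1 ≤ p.sum := List.le_sum_of_mem (List.get_mem p c.1)
  have h2 := c.2.isLt
  rw [cellWeight, abs_le]
  constructor <;> dsimp only <;> omega

variable (K p) in
/-- The projection of differential forms to the forms of weight `g`. -/
noncomputable def formComponent (g : ℤ × ℤ) :
    (CellIndex p → MvPolynomial (CellIndex p) K) →ₗ[K]
      (CellIndex p → MvPolynomial (CellIndex p) K) :=
  LinearMap.pi fun c => weightedHomogeneousComponent (cellWeight p) (g - cellWeight p c) ∘ₗ
    LinearMap.proj c

theorem formComponent_apply (g : ℤ × ℤ) (ω : CellIndex p → MvPolynomial (CellIndex p) K)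
    (c : CellIndex p) : formComponent K p g ω c =
      weightedHomogeneousComponent (cellWeight p) (g - cellWeight p c) (ω c) := rfl

theorem formComponent_mem (g : ℤ × ℤ) (ω : CellIndex p → MvPolynomial (CellIndex p) K) :
    formComponent K p g ω ∈ homogeneousForms K (cellWeight p) g :=
  mem_homogeneousForms.2 fun c => weightedHomogeneousComponent_mem _ (ω c) _

theorem formComponent_of_mem {g h : ℤ × ℤ} {ω : CellIndex p → MvPolynomial (CellIndex p) K}
    (hω : ω ∈ homogeneousForms K (cellWeight p) h) :
    formComponent K p g ω = if g = h then ω else 0 := by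
  funext c
  rw [formComponent_apply,
    weightedHomogeneousComponent_of_mem (mem_homogeneousForms.1 hω c)]
  split_ifs with h1 h2 h2
  · rfl
  · exact absurd (sub_left_injective h1) h2
  · exact absurd (by rw [h2]) h1
  · rfl

/-- A form of degree `n` is the sum of its components of `sl₂`-weights between `-B` and `B`, where
`B` is any bound for the weights in degree `n`. -/
theorem sum_formComponent {n : ℤ} {ω : CellIndex p → MvPolynomial (CellIndex p) K}
    (hω : ω ∈ homogeneousForms K (fun _ => (1 : ℤ)) n) {B : ℤ} (hB : p.sum * n ≤ B) :
    ∑ j ∈ Finset.Icc (-B) B, formComponent K p (j, n) ω = ω := by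
  funext c
  rw [Finset.sum_apply]
  ext s
  simp only [formComponent_apply, coeff_sum, coeff_weightedHomogeneousComponent]
  by_cases hs : coeff s (ω c) = 0
  · simp [hs]
  have hn := mem_homogeneousForms.1 hω c hs
  have hl : ∀ c, AddMonoidHom.snd ℤ ℤ (cellWeight p c) = 1 := fun _ => rfl
  have h1 : (Finsupp.weight (cellWeight p) s).2 = n - 1 := by
    rw [← hn, ← AddMonoidHom.coe_snd, degree_eq_of_weight hl]
    exact (degree_eq_of_weight (l := AddMonoidHom.id ℤ) (fun _ => rfl) s).symm
  set j := (Finsupp.weight (cellWeight p) s).1 + (cellWeight p c).1 with hj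
  have hg : ∀ i, Finsupp.weight (cellWeight p) s = (i, n) - cellWeight p c ↔ i = j := by
    intro i
    rw [Prod.ext_iff, Prod.fst_sub, Prod.snd_sub, h1, hj]
    constructor
    · rintro ⟨h, -⟩
      rw [h]
      ring
    · rintro rfl
      exact ⟨by ring, rfl⟩
  simp only [hg, Finset.sum_ite_eq']
  rw [if_pos]
  by_contra hjB
  have hj' : (p.sum : ℤ) * n < |j| := by
    rw [Finset.mem_Icc, ← abs_le] at hjB
    omega
  have hbot := homogeneousForms_eq_bot (K := K) (g := (j, n)) hl (AddMonoidHom.fst ℤ ℤ)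
    abs_cellWeight_le hj'
  have hmem := formComponent_mem (j, n) ω
  rw [hbot, Submodule.mem_bot] at hmem
  have := congrArg (coeff s) (congrFun hmem c)
  rw [formComponent_apply, coeff_weightedHomogeneousComponent, if_pos ((hg j).2 rfl)] at this
  exact hs this

end Decomposition

/-! ### Dimensions of spaces of constants -/

section JordanBasis

open MvPolynomial

variable {K : Type*} [Field K] {d : ℕ}

theorem gen_mem_linearPart (j : Fin d) : gen K d j ∈ linearPart K d :=
  Submodule.subset_span ⟨j, rfl⟩

/-- Every basis of the span of the generators is a system of free generators; the corresponding
Magnus embedding. -/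
theorem exists_magnus_embedding {σ : Type*} [DecidableEq σ] {e : σ → Alg K d}
    (hli : LinearIndependent K e) (hspan : Submodule.span K (Set.range e) = linearPart K d) :
    ∃ φ : Alg K d →ₗ⁅K⁆ MagnusAlgebra (MvPolynomial σ K) (σ → MvPolynomial σ K),
      ∀ c, φ (e c) = magnusGen K c := by
  let T := (Module.Basis.span hli).constr K (magnusGen K)
  have hmem : ∀ {u}, u ∈ linearPart K d → u ∈ Submodule.span K (Set.range e) := fun {u} hu => by
    rwa [hspan]
  obtain ⟨φ, hφ⟩ := exists_lieHom_gen (MagnusAlgebra.derivedSeries_two_eq_bot (K := K)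
    (S := MvPolynomial σ K) (N := σ → MvPolynomial σ K))
    (fun j => T ⟨gen K d j, hmem (gen_mem_linearPart j)⟩)
  have hφT : ∀ u (hu : u ∈ linearPart K d), φ u = T ⟨u, hmem hu⟩ := by
    intro u hu
    induction hu using Submodule.span_induction with
    | zero => rw [map_zero]; exact (map_zero T).symm
    | add a b ha hb ha' hb' => rw [map_add, ha', hb', ← map_add]; rfl
    | smul r a ha ha' => rw [map_smul, ha', ← map_smul]; rfl
    | mem a ha =>
      obtain ⟨j, rfl⟩ := ha
      exact hφ j
  refine ⟨φ, fun c => ?_⟩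
  have hc : e c ∈ linearPart K d := by
    rw [← hspan]
    exact Submodule.subset_span ⟨c, rfl⟩
  rw [hφT _ hc]
  have : (⟨e c, hmem hc⟩ : Submodule.span K (Set.range e)) = Module.Basis.span hli c :=
    (Module.Basis.span_apply hli c).symm
  rw [this]
  exact (Module.Basis.span hli).constr_basis K _ c

/-- The generators are linearly independent, as the Magnus embedding separates them. -/
theorem linearIndependent_gen : LinearIndependent K (gen K d) := by
  obtain ⟨φ, hφ⟩ := exists_lieHom_gen (d := d) (MagnusAlgebra.derivedSeries_two_eq_bot (K := K)
    (S := MvPolynomial (Fin d) K) (N := Fin d → MvPolynomial (Fin d) K)) (magnusGen K)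
  refine LinearIndependent.of_comp (magnusForm φ) ?_
  rw [Fintype.linearIndependent_iff]
  intro r hr c
  have h : magnusForm φ (∑ c, r c • gen K d c) = 0 := by
    rw [map_sum, ← hr]
    simp only [map_smul, Function.comp_apply]
  rw [magnusForm_sum hφ] at h
  have := congrFun h c
  rwa [Pi.zero_apply, C_eq_zero] at this

variable {δ : LieDerivation K (Alg K d) (Alg K d)} {p : List ℕ} {e : CellIndex p → Alg K d}

/-- The sum of the sizes `p_i + 1` of the cells is the number of generators. -/
theorem IsJordanBasis.sum_eq (he : IsJordanBasis δ p e) : p.sum + p.length = d := by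
  have h1 : Module.finrank K (linearPart K d) = d := by
    rw [linearPart, finrank_span_eq_card linearIndependent_gen, Fintype.card_fin]
  rw [← he.span_eq, finrank_span_eq_card he.linearIndependent, Fintype.card_sigma] at h1
  simp only [Fintype.card_fin, Finset.sum_add_distrib, Finset.sum_const, Finset.card_univ,
    smul_eq_mul, mul_one] at h1
  rw [← h1]
  congr 1
  simp only [List.get_eq_getElem]
  exact (Fin.sum_univ_getElem p).symm

theorem IsJordanBasis.apply_eq (he : IsJordanBasis δ p e) (b : CellIndex p) :
    δ (e b) = ∑ a, raiseMatrix K p a b • e a := by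
  obtain ⟨i, b⟩ := b
  rw [Fintype.sum_sigma, Finset.sum_eq_single i]
  · simp only [raiseMatrix, Matrix.blockDiagonal'_apply_eq, Matrix.of_apply, ite_smul, one_smul,
      zero_smul]
    refine Fin.cases ?_ (fun k => ?_) b
    · rw [he.map_zero i, Finset.sum_eq_zero]
      intro a _
      exact if_neg (by simp)
    · rw [he.map_succ i k, Finset.sum_eq_single k.castSucc]
      · rw [if_pos (by simp)]
      · intro a _ ha
        refine if_neg fun h => ha (Fin.ext ?_)
        rw [Fin.val_succ] at h
        rw [Fin.val_castSucc]
        omega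
      · simp
  · intro j _ hj
    refine Finset.sum_eq_zero fun a _ => ?_
    rw [raiseMatrix, Matrix.blockDiagonal'_apply_ne _ _ _ hj, zero_smul]
  · simp

theorem weightSpan_comp {ι L A B : Type*} [AddCommMonoid A] [AddCommMonoid B] [LieRing L]
    [LieAlgebra K L] (f : A →+ B) (hf : Function.Injective f) (w : ι → A) (e : ι → L) (g : A) :
    weightSpan K (fun i => f (w i)) e (f g) = weightSpan K w e g := by
  rw [weightSpan, weightSpan]
  simp only [weight_map, hf.eq_iff]

theorem IsJordanBasis.component_eq (he : IsJordanBasis δ p e) (n : ℕ) :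
    component K d n = weightSpan K (fun _ => (1 : ℤ)) e n := by
  have h1 : component K d n = weightSpan K (fun _ => 1) (gen K d) n := by
    rw [component, weightSpan]
    simp only [weight_one]
  have h2 : weightSpan K (fun _ => (1 : ℤ)) e n = weightSpan K (fun _ => (1 : ℕ)) e n :=
    weightSpan_comp (Nat.castAddMonoidHom ℤ) Nat.cast_injective _ e n
  rw [h1, h2]
  apply le_antisymm
  · refine weightSpan_one_le (fun j => ?_) n
    rw [he.span_eq]
    exact gen_mem_linearPart j
  · refine weightSpan_one_le (fun c => ?_) n
    change e c ∈ linearPart K d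
    rw [← he.span_eq]
    exact Submodule.subset_span ⟨c, rfl⟩

variable (p) in
/-- The bidegree and the degree of the variables. -/
def cellBidegree (c : CellIndex p) : ℤ × ℤ × ℤ :=
  ((p.get c.1 : ℤ) - (c.2 : ℕ), (c.2 : ℕ), 1)

theorem bicomponent_eq (n₁ n₂ n : ℕ) :
    bicomponent p e n₁ n₂ n = weightSpan K (cellBidegree p) e (n₁, n₂, n) := by
  have h : ∀ m : FreeMagma (CellIndex p), weight (cellBidegree p) m =
      (((weight (bidegree p) m).1 : ℤ), ((weight (bidegree p) m).2 : ℤ), (m.length : ℤ)) := by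
    intro m
    let f : (ℕ × ℕ) × ℕ →+ ℤ × ℤ × ℤ :=
      { toFun := fun a => (a.1.1, a.1.2, a.2)
        map_zero' := rfl
        map_add' := fun a b => by simp }
    have hw : cellBidegree p = fun c => f (bidegree p c, 1) := by
      funext c
      have := c.2.isLt
      simp only [cellBidegree, bidegree, f, AddMonoidHom.coe_mk, ZeroHom.coe_mk, Nat.cast_one]
      rw [Nat.cast_sub (by omega)]
    rw [hw, weight_map f (fun c => (bidegree p c, 1))]
    have h1 : (weight (fun c : CellIndex p => (bidegree p c, 1)) m).1 = weight (bidegree p) m :=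
      (weight_map (AddMonoidHom.fst (ℕ × ℕ) ℕ) _ m).symm
    have h2 : (weight (fun c : CellIndex p => (bidegree p c, 1)) m).2 = m.length := by
      rw [← weight_one]
      exact (weight_map (AddMonoidHom.snd (ℕ × ℕ) ℕ) _ m).symm
    rw [← h1, ← h2]
    rfl
  rw [bicomponent, weightSpan]
  congr 2
  ext m
  simp only [Set.mem_ofPred_eq, h, Prod.ext_iff, Nat.cast_inj]
  tauto

variable (K) [CharZero K]

/-- The dimension of the space of forms of weight `g` and degree `l g` in the image of the Magnus
embedding, in terms of numbers of monomials. -/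
theorem finrank_magnusWeightSpace {G : Type*} [AddCommGroup G] {w : CellIndex p → G} {l : G →+ ℤ}
    (hl : ∀ c, l (w c) = 1) {g : G} (hg : 1 ≤ l g) :
    (Module.finrank K (magnusWeightSpace K w (l g) g) : ℤ) =
      ∑ c, (monomialCount w (g - w c) : ℤ) - monomialCount w g +
        if l g = 1 then (monomialCount w g : ℤ) else 0 := by
  have h := finrank_magnusForms_add (K := K) hl hg
  have h' : (Module.finrank K (magnusWeightSpace K w (l g) g) : ℤ) + monomialCount w g =
      ∑ c, (monomialCount w (g - w c) : ℤ) +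
        if l g = 1 then (monomialCount w g : ℤ) else 0 := by
    have := congrArg (Nat.cast : ℕ → ℤ) h
    push_cast at this
    exact this
  linarith

variable {K}

/-- The number of constants of bidegree `(n₁, n₂)`: the raising operator has bidegree `(1, -1)`, and
the `sl₂`-weight is `n₁ - n₂`. -/
theorem IsJordanBasis.finrank_biconstants (he : IsJordanBasis δ p e) {n₁ n₂ n : ℕ} (hn : 1 ≤ n) :
    (Module.finrank K (biconstants δ p e n₁ n₂ n) : ℤ) = if n₂ ≤ n₁ then
      (Module.finrank K (magnusWeightSpace K (cellBidegree p) n (n₁, n₂, n)) : ℤ) -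
      Module.finrank K (magnusWeightSpace K (cellBidegree p) n (n₁ + 1, n₂ - 1, n)) else 0 := by
  obtain ⟨φ, hφ⟩ := exists_magnus_embedding he.linearIndependent he.span_eq
  let l : ℤ × ℤ × ℤ →+ ℤ := (AddMonoidHom.snd ℤ ℤ).comp (AddMonoidHom.snd ℤ (ℤ × ℤ))
  let L : ℤ × ℤ × ℤ →+ ℤ := AddMonoidHom.fst ℤ (ℤ × ℤ) -
    (AddMonoidHom.fst ℤ ℤ).comp (AddMonoidHom.snd ℤ (ℤ × ℤ))
  have hl : ∀ c, l (cellBidegree p c) = 1 := fun _ => rfl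
  have hL : ∀ c, L (cellBidegree p c) = p.get c.1 - 2 * (c.2 : ℕ) := fun c => by
    change (p.get c.1 : ℤ) - (c.2 : ℕ) - (c.2 : ℕ) = _
    ring
  have hwε : ∀ (i : Fin p.length) (j k : Fin (p.get i + 1)), (k : ℕ) = j + 1 →
      cellBidegree p ⟨i, j⟩ = cellBidegree p ⟨i, k⟩ + (1, -1, 0) := fun i j k h => by
    simp only [cellBidegree, h, Prod.mk_add_mk]
    push_cast
    refine Prod.ext ?_ (Prod.ext ?_ ?_) <;> dsimp only <;> ring
  have hg : l (n₁, n₂, n) = n := rfl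
  rw [biconstants, bicomponent_eq,
    finrank_constants (ε := (1, -1, 0)) hl hφ he.apply_eq rfl
      (fun a b h => weight_of_raiseMatrix_ne_zero (K := K) hwε h) (by rw [hg]; omega)]
  have h := finrank_ker_formDer_raise (K := K) hl hL rfl rfl hwε (n₁, n₂, n)
  rw [hg] at h
  refine h.trans ?_
  have hL0 : 0 ≤ L (n₁, n₂, n) ↔ n₂ ≤ n₁ := by
    change (0 : ℤ) ≤ n₁ - n₂ ↔ _
    omega
  have hadd : ((n₁ : ℤ), (n₂ : ℤ), (n : ℤ)) + (1, -1, 0) =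
      ((n₁ : ℤ) + 1, (n₂ : ℤ) - 1, (n : ℤ)) := by
    rw [Prod.mk_add_mk, Prod.mk_add_mk, add_zero, sub_eq_add_neg]
  rw [hadd]
  simp only [hL0]

theorem telescope_two (f : ℤ → ℤ) (N : ℕ) :
    ∑ k ∈ Finset.range N, (f k - f (k + 2)) = f 0 + f 1 - f N - f (N + 1) := by
  induction N with
  | zero => simp
  | succ N ih =>
    rw [Finset.sum_range_succ, ih]
    push_cast
    rw [add_assoc (N : ℤ) 1 1]
    norm_num
    ring

/-- Every irreducible `sl₂`-module of finite dimension contains exactly one vector of weight `0` or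
`1`, up to a factor. So the number of highest weight vectors is the sum of the dimensions of the
spaces of these two weights. -/
theorem IsJordanBasis.finrank_constants (he : IsJordanBasis δ p e) {n : ℕ} (hn : 1 ≤ n) :
    (Module.finrank K (constants δ n) : ℤ) =
      Module.finrank K (magnusWeightSpace K (cellWeight p) n (0, n)) +
      Module.finrank K (magnusWeightSpace K (cellWeight p) n (1, n)) := by
  obtain ⟨φ, hφ⟩ := exists_magnus_embedding he.linearIndependent he.span_eq
  have hl : ∀ c, AddMonoidHom.snd ℤ ℤ (cellWeight p c) = 1 := fun _ => rfl
  have hL : ∀ c, AddMonoidHom.fst ℤ ℤ (cellWeight p c) = p.get c.1 - 2 * (c.2 : ℕ) := fun _ => rfl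
  have hwε : ∀ (i : Fin p.length) (j k : Fin (p.get i + 1)), (k : ℕ) = j + 1 →
      cellWeight p ⟨i, j⟩ = cellWeight p ⟨i, k⟩ + (2, 0) := fun i j k h => by
    simp only [cellWeight, h, Prod.mk_add_mk]
    push_cast
    exact Prod.ext (by dsimp only; ring) (by dsimp only)
  rw [constants, he.component_eq,
    FreeMetabelian.finrank_constants (w := fun _ => (1 : ℤ)) (l := AddMonoidHom.id ℤ) (ε := 0)
      (fun _ => rfl) hφ he.apply_eq
      rfl (fun _ _ _ => rfl) (by rw [AddMonoidHom.id_apply]; omega), AddMonoidHom.id_apply]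
  set D := formDer (raiseMatrix K p)
  set Y : ℤ → Submodule K (CellIndex p → MvPolynomial (CellIndex p) K) := fun j =>
    LinearMap.ker D ⊓ magnusWeightSpace K (cellWeight p) n (j, n) with hY
  obtain ⟨B, hB⟩ : ∃ B : ℕ, (p.sum : ℤ) * n ≤ B := ⟨p.sum * n, by push_cast; exact le_rfl⟩
  have hle : ∀ j : ℤ, homogeneousForms K (cellWeight p) (j, n) ≤
      homogeneousForms K (fun _ => (1 : ℤ)) n := fun j => homogeneousForms_le_degree hl (j, n)
  have hfin : ∀ j, Module.Finite K (Y j) := fun j => by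
    have := finite_homogeneousForms (K := K) hl (j, n)
    exact Submodule.finiteDimensional_of_le
      (S₂ := homogeneousForms K (cellWeight p) (j, n)) (inf_le_right.trans inf_le_right)
  -- `D` shifts the weights by two and the contraction preserves them, so the components of a form
  -- in the kernels of both lie in these kernels
  have hproj : ∀ i ∈ Finset.Icc (-(B : ℤ)) B, ∀ v ∈ LinearMap.ker D ⊓
      (magnusForms (CellIndex p) K n ⊓ homogeneousForms K (fun _ => (1 : ℤ)) n),
      formComponent K p (i, n) v ∈ Y i := by
    intro i hi v hv
    have hsum := sum_formComponent hv.2.2 hB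
    refine ⟨?_, ?_, formComponent_mem _ _⟩
    · have hshift : ∀ j : ℤ, formComponent K p (i + 2, n) (D (formComponent K p (j, n) v)) =
          if i = j then D (formComponent K p (j, n) v) else 0 := by
        intro j
        have hmem : D (formComponent K p (j, n) v) ∈
            homogeneousForms K (cellWeight p) ((j, (n : ℤ)) + (2, 0)) :=
          formDer_mem_homogeneousForms (fun a b h => weight_of_raiseMatrix_ne_zero (K := K) hwε h)
            (formComponent_mem _ _)
        rw [formComponent_of_mem hmem]
        simp
      have h : formComponent K p (i + 2, n) (D v) = D (formComponent K p (i, n) v) := by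
        conv_lhs => rw [← hsum]
        rw [map_sum, map_sum]
        simp only [hshift, Finset.sum_ite_eq, if_pos hi]
      have h0 : D v = 0 := hv.1
      change D (formComponent K p (i, n) v) = 0
      rw [← h, h0, _root_.map_zero]
    · have hμ := hv.2.1
      rw [magnusForms] at hμ ⊢
      split_ifs at hμ ⊢ with h1
      · exact Submodule.mem_top
      have hshift : ∀ j : ℤ, weightedHomogeneousComponent (cellWeight p) (i, (n : ℤ))
          (contraction (CellIndex p) K (formComponent K p (j, n) v)) =
          if i = j then contraction (CellIndex p) K (formComponent K p (j, n) v) else 0 := by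
        intro j
        rw [weightedHomogeneousComponent_of_mem (contraction_homogeneous (formComponent_mem _ _))]
        simp
      have h : weightedHomogeneousComponent (cellWeight p) (i, (n : ℤ))
          (contraction (CellIndex p) K v) =
          contraction (CellIndex p) K (formComponent K p (i, n) v) := by
        conv_lhs => rw [← hsum]
        rw [map_sum, map_sum]
        simp only [hshift, Finset.sum_ite_eq, if_pos hi]
      have hμ' : contraction (CellIndex p) K v = 0 := hμ
      change contraction (CellIndex p) K (formComponent K p (i, n) v) = 0
      rw [← h, hμ', _root_.map_zero]
  have hdecomp := finrank_eq_sum_of_projections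
    (LinearMap.ker D ⊓ (magnusForms (CellIndex p) K n ⊓ homogeneousForms K (fun _ => (1 : ℤ)) n))
    (Finset.Icc (-(B : ℤ)) B) Y (fun j => formComponent K p (j, n))
    (fun i v hv => by rw [formComponent_of_mem hv.2.2, if_pos rfl])
    (fun i j hij v hv => by
      rw [formComponent_of_mem hv.2.2, if_neg fun h => hij (Prod.ext_iff.1 h).1])
    (fun i => inf_le_inf_left _ (inf_le_inf_left _ (hle i)))
    hproj
    (fun v hv => sum_formComponent hv.2.2 hB)
  set f : ℤ → ℤ := fun j => Module.finrank K (magnusWeightSpace K (cellWeight p) n (j, n)) with hf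
  have hYf : ∀ j, (Module.finrank K (Y j) : ℤ) = if 0 ≤ j then f j - f (j + 2) else 0 := by
    intro j
    have h := finrank_ker_formDer_raise (K := K) hl hL rfl rfl hwε (j, n)
    rw [Prod.mk_add_mk, add_zero] at h
    exact h
  -- no form of degree `n` has a weight greater than `B`
  have hf0 : ∀ j : ℤ, (B : ℤ) < j → f j = 0 := by
    intro j hj
    have hbot := homogeneousForms_eq_bot (K := K) (g := (j, (n : ℤ))) hl (AddMonoidHom.fst ℤ ℤ)
      abs_cellWeight_le (lt_of_le_of_lt hB (lt_of_lt_of_le hj (le_abs_self j)))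
    have hbot' : magnusWeightSpace K (cellWeight p) n (j, n) = ⊥ := by
      rw [magnusWeightSpace, hbot, inf_bot_eq]
    change ((Module.finrank K (magnusWeightSpace K (cellWeight p) n (j, n)) : ℕ) : ℤ) = 0
    rw [hbot', finrank_bot, Nat.cast_zero]
  -- the sum over the weights `j ≥ 0` telescopes with step two: only `f 0` and `f 1` remain
  have hrange : ∑ j ∈ Finset.Icc (-(B : ℤ)) B, (if 0 ≤ j then f j - f (j + 2) else 0) =
      ∑ k ∈ Finset.range (B + 1), (f k - f (k + 2)) := by
    rw [← Finset.sum_filter]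
    refine Finset.sum_nbij' Int.toNat (fun k => (k : ℤ)) ?_ ?_ ?_ ?_ ?_
    · intro j hj
      rw [Finset.mem_filter, Finset.mem_Icc] at hj
      rw [Finset.mem_range]
      omega
    · intro k hk
      rw [Finset.mem_range] at hk
      rw [Finset.mem_filter, Finset.mem_Icc]
      omega
    · intro j hj
      rw [Finset.mem_filter] at hj
      exact Int.toNat_of_nonneg hj.2
    · intro k _
      exact Int.toNat_natCast k
    · intro j hj
      rw [Finset.mem_filter] at hj
      rw [Int.toNat_of_nonneg hj.2]
  rw [hdecomp, Nat.cast_sum, Finset.sum_congr rfl fun j _ => hYf j, hrange, telescope_two,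
    hf0 ((B + 1 : ℕ) : ℤ) (by push_cast; omega),
    hf0 (((B + 1 : ℕ) : ℤ) + 1) (by push_cast; omega), sub_zero, sub_zero]

end JordanBasis

/-! ### The graded Hilbert series as a constant term -/

section GradedSeries

open LaurentPolynomial

theorem coeff_T_mul (w j : ℤ) (f : ℚ[T;T⁻¹]) : (T w * f).coeff j = f.coeff (j - w) := by
  have h := AddMonoidAlgebra.coeff_single_mul_add f (1 : ℚ) w (j - w)
  rwa [add_sub_cancel, one_mul] at h

theorem geometricSeries_mul {A : Type*} [CommRing A] (t : A) :
    (PowerSeries.mk fun k => t ^ k) * (1 - PowerSeries.C t * PowerSeries.X) = 1 := by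
  ext n
  rw [mul_sub, mul_one, map_sub, ← mul_assoc]
  cases n with
  | zero => simp
  | succ n => simp [pow_succ, PowerSeries.coeff_succ_mul_X]

variable (p : List ℕ)

/-- The product of the geometric series of the variables, with `u ^ j * z ^ n` recording weight
`j` and degree `n`. The variable `u` is that of the Laurent polynomials, `T j` being `u ^ j`, and
`z` is the variable of the power series. -/
noncomputable def countSeries : PowerSeries ℚ[T;T⁻¹] :=
  ∏ c : CellIndex p, PowerSeries.mk fun k => T (cellWeight p c).1 ^ k

theorem countSeries_mul : countSeries p *
    ∏ c : CellIndex p, (1 - PowerSeries.C (T (cellWeight p c).1) * PowerSeries.X) = 1 := by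
  rw [countSeries, ← Finset.prod_mul_distrib]
  exact Finset.prod_eq_one fun c _ => geometricSeries_mul _

theorem coeff_countSeries (n : ℕ) (j : ℤ) :
    (PowerSeries.coeff n (countSeries p)).coeff j = monomialCount (cellWeight p) (j, n) := by
  classical
  rw [countSeries, PowerSeries.coeff_prod]
  have h : ∀ s : CellIndex p →₀ ℕ,
      ∏ c, PowerSeries.coeff (s c) (PowerSeries.mk fun k => T (R := ℚ) (cellWeight p c).1 ^ k) =
        T (∑ c, s c * (cellWeight p c).1) := by
    intro s
    simp only [PowerSeries.coeff_mk, T_pow]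
    induction (Finset.univ : Finset (CellIndex p)) using Finset.induction_on with
    | empty => simp
    | insert c S hc ih => rw [Finset.prod_insert hc, Finset.sum_insert hc, ih, T_add]
  simp only [h, AddMonoidAlgebra.coeff_sum, Finsupp.finsetSum_apply, T_apply]
  rw [Finset.sum_boole, monomialCount]
  congr 1
  symm
  refine Nat.subtype_card _ fun s => ?_
  rw [Finset.mem_filter, Finset.mem_finsuppAntidiag, Finsupp.weight_apply,
    Finsupp.sum_fintype s (fun c k => k • cellWeight p c) (fun _ => zero_smul _ _), Prod.ext_iff,
    Prod.fst_sum, Prod.snd_sum]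
  have h1 : ∀ c, (s c • cellWeight p c).1 = s c * (cellWeight p c).1 := fun c => nsmul_eq_mul _ _
  have h2 : ∀ c, (s c • cellWeight p c).2 = s c := fun c => (nsmul_eq_mul _ _).trans (mul_one _)
  simp only [h1, h2, Finset.subset_univ, and_true]
  rw [and_comm, ← Nat.cast_sum, Nat.cast_inj]

/-- Each cell contains exactly one vector of weight `0` or `1`. -/
theorem sum_cellWeight_eq_zero_or_one :
    ∑ c : CellIndex p, (if (cellWeight p c).1 = 0 ∨ (cellWeight p c).1 = 1 then 1 else 0) =
      p.length := by
  have h : ∀ c : CellIndex p, ((cellWeight p c).1 = 0 ∨ (cellWeight p c).1 = 1) ↔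
      (c.2 : ℕ) = p.get c.1 / 2 := by
    intro c
    simp only [cellWeight]
    omega
  rw [Fintype.sum_sigma]
  have h1 : ∀ i : Fin p.length, ∑ k : Fin (p.get i + 1),
      (if (cellWeight p ⟨i, k⟩).1 = 0 ∨ (cellWeight p ⟨i, k⟩).1 = 1 then 1 else 0) = 1 := by
    intro i
    rw [Finset.sum_eq_single ⟨p.get i / 2, by omega⟩, if_pos ((h _).2 rfl)]
    · exact fun k _ hk => if_neg fun hk' => hk (Fin.ext ((h _).1 hk'))
    · exact fun hk => absurd (Finset.mem_univ _) hk
  rw [Finset.sum_congr rfl fun i _ => h1 i, Finset.sum_const, Finset.card_univ, Fintype.card_fin,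
    smul_eq_mul, mul_one]

/-- The series of the coefficients of `u ^ 0`. -/
noncomputable def constantTermSeries (f : PowerSeries ℚ[T;T⁻¹]) : PowerSeries ℚ :=
  PowerSeries.mk fun n => (PowerSeries.coeff n f).coeff 0

theorem constants_zero {K : Type*} [Field K] {d : ℕ}
    (δ : LieDerivation K (Alg K d) (Alg K d)) : Module.finrank K (constants δ 0) = 0 := by
  have h : component K d 0 = ⊥ := by
    rw [component, Submodule.span_eq_bot]
    rintro _ ⟨m, hm, -⟩
    exact absurd (hm : m.length = 0) m.length_pos.ne'
  rw [constants, h, inf_bot_eq, finrank_bot]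

variable {p} in
/-- The Hilbert series as a constant term. The factor `1 + u⁻¹` collects the weights `0` and `1`.
The first two summands are corrections: in degree zero there are no constants, and in degree one the
image of the Magnus embedding is not cut down by the contraction. -/
theorem IsJordanBasis.hilbertSeries_eq {K : Type*} [Field K] [CharZero K] {d : ℕ}
    {δ : LieDerivation K (Alg K d) (Alg K d)} {e : CellIndex p → Alg K d}
    (he : IsJordanBasis δ p e) :
    hilbertSeries δ = 1 + (p.length : PowerSeries ℚ) * PowerSeries.X + constantTermSeries
      ((1 + PowerSeries.C (T (-1))) * ((∑ c, PowerSeries.C (T (cellWeight p c).1)) *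
        PowerSeries.X - 1) * countSeries p) := by
  have hl : ∀ c, AddMonoidHom.snd ℤ ℤ (cellWeight p c) = 1 := fun _ => rfl
  have hC : ∀ n, PowerSeries.coeff n (p.length : PowerSeries ℚ) =
      if n = 0 then (p.length : ℚ) else 0 := by
    intro n
    rw [← map_natCast (PowerSeries.C : ℚ →+* PowerSeries ℚ), PowerSeries.coeff_C]
  ext n
  rw [hilbertSeries, PowerSeries.coeff_mk]
  simp only [map_add, constantTermSeries, PowerSeries.coeff_mk, add_mul, one_mul, sub_mul,
    Finset.sum_mul, map_sub, map_sum, mul_assoc, PowerSeries.coeff_C_mul,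
    AddMonoidAlgebra.coeff_add, AddMonoidAlgebra.coeff_sub, AddMonoidAlgebra.coeff_sum,
    Finsupp.add_apply, Finsupp.sub_apply, Finsupp.finsetSum_apply, coeff_T_mul, coeff_countSeries,
    mul_sub, Finset.mul_sum]
  cases n with
  | zero =>
    have h0 : ∀ j : ℤ, monomialCount (cellWeight p) (j, ((0 : ℕ) : ℤ)) =
        if j = 0 then 1 else 0 := by
      intro j
      rw [monomialCount_degree_zero hl (g := (j, ((0 : ℕ) : ℤ))) rfl]
      simp [Prod.ext_iff]
    rw [constants_zero, h0, h0]
    simp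
  | succ n =>
    have h1 : ∀ j : ℤ, (Module.finrank K
        (magnusWeightSpace K (cellWeight p) (n + 1 : ℕ) (j, (n + 1 : ℕ))) : ℚ) =
      ∑ c, (monomialCount (cellWeight p) (j - (cellWeight p c).1, n) : ℚ) -
        monomialCount (cellWeight p) (j, (n + 1 : ℕ)) +
        if n = 0 then ∑ c, (if (cellWeight p c).1 = j then 1 else 0) else 0 := by
      intro j
      have h := finrank_magnusWeightSpace K hl (g := (j, ((n + 1 : ℕ) : ℤ)))
        (by change (1 : ℤ) ≤ ((n + 1 : ℕ) : ℤ); push_cast; omega)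
      have h2 : ∀ c, (j, ((n + 1 : ℕ) : ℤ)) - cellWeight p c =
          (j - (cellWeight p c).1, (n : ℤ)) := by
        intro c
        refine Prod.ext rfl ?_
        change ((n + 1 : ℕ) : ℤ) - 1 = n
        push_cast
        ring
      have h3 : (if AddMonoidHom.snd ℤ ℤ (j, ((n + 1 : ℕ) : ℤ)) = 1 then
          (monomialCount (cellWeight p) (j, ((n + 1 : ℕ) : ℤ)) : ℤ) else 0) =
          if n = 0 then ∑ c, (if (cellWeight p c).1 = j then 1 else 0) else 0 := by
        have hn : AddMonoidHom.snd ℤ ℤ (j, ((n + 1 : ℕ) : ℤ)) = 1 ↔ n = 0 := by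
          change ((n + 1 : ℕ) : ℤ) = 1 ↔ _
          omega
        simp only [hn]
        split_ifs with h0
        · rw [monomialCount_degree_one hl (hn.2 h0), h0]
          push_cast
          refine Finset.sum_congr rfl fun c _ => ?_
          refine if_congr ?_ rfl rfl
          rw [Prod.ext_iff]
          simp [cellWeight]
        · rfl
      rw [h3] at h
      simp only [h2] at h
      have h' := congrArg (Int.cast : ℤ → ℚ) h
      push_cast at h' ⊢
      exact h'
    have h2 := congrArg (Int.cast : ℤ → ℚ) (he.finrank_constants (n := n + 1) (by omega))
    simp only [Int.cast_add, Int.cast_natCast] at h2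
    rw [h2, h1, h1]
    have hs : (if n = 0 then ∑ c, (if (cellWeight p c).1 = 0 then (1 : ℚ) else 0) else 0) +
        (if n = 0 then ∑ c, (if (cellWeight p c).1 = 1 then (1 : ℚ) else 0) else 0) =
        if n = 0 then (p.length : ℚ) else 0 := by
      split_ifs
      · have hs' := congrArg (Nat.cast : ℕ → ℚ) (sum_cellWeight_eq_zero_or_one p)
        push_cast at hs'
        rw [← Finset.sum_add_distrib]
        refine Eq.trans ?_ hs'
        refine Finset.sum_congr rfl fun c _ => ?_
        by_cases h0 : (cellWeight p c).1 = 0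
        · simp [h0]
        · simp [h0]
      · rw [add_zero]
    rw [PowerSeries.coeff_succ_mul_X, hC, ← hs]
    simp only [PowerSeries.coeff_succ_X_mul, coeff_countSeries, PowerSeries.coeff_one,
      Nat.succ_ne_zero, if_false, sub_neg_eq_add, zero_add]
    rw [Finset.sum_add_distrib]
    ring_nf

/-- The power series whose coefficients are polynomials in `u`, as series with Laurent
polynomials as coefficients. -/
noncomputable def posPart : PowerSeries (Polynomial ℚ) →+* PowerSeries ℚ[T;T⁻¹] :=
  PowerSeries.map Polynomial.toLaurent

/-- The power series whose coefficients are polynomials in `u⁻¹`: `u⁻¹` is substituted for the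
variable of the polynomials. -/
noncomputable def negPart : PowerSeries (Polynomial ℚ) →+* PowerSeries ℚ[T;T⁻¹] :=
  PowerSeries.map ((invert : ℚ[T;T⁻¹] ≃ₐ[ℚ] ℚ[T;T⁻¹]).toRingEquiv.toRingHom.comp
    Polynomial.toLaurent)

theorem coeff_toLaurent_neg_one (f : Polynomial ℚ) : (Polynomial.toLaurent f).coeff (-1) = 0 := by
  rw [coeff_toLaurent]
  refine Finsupp.mapDomain_of_notMem_range _ _ ?_
  rintro ⟨k, hk⟩
  have : (k : ℤ) = -1 := hk
  omega

theorem constantTermSeries_decomposition (R : PowerSeries ℚ) (P Q : PowerSeries (Polynomial ℚ)) :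
    constantTermSeries (PowerSeries.map C R + PowerSeries.C (T 1) * posPart P +
      PowerSeries.C (T (-1)) * negPart Q) = R := by
  ext n
  rw [constantTermSeries, PowerSeries.coeff_mk]
  simp only [map_add, PowerSeries.coeff_C_mul, posPart, negPart, PowerSeries.coeff_map,
    AddMonoidAlgebra.coeff_add, Finsupp.add_apply, coeff_T_mul]
  have h1 := coeff_toLaurent_neg_one (PowerSeries.coeff n P)
  have h2 : (((invert : ℚ[T;T⁻¹] ≃ₐ[ℚ] ℚ[T;T⁻¹]).toRingEquiv.toRingHom.comp
      Polynomial.toLaurent) (PowerSeries.coeff n Q)).coeff (0 - -1) = 0 := by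
    refine (invert_apply _ _).trans ?_
    exact coeff_toLaurent_neg_one (PowerSeries.coeff n Q)
  rw [h2, zero_sub, h1, C_apply, if_pos rfl, add_zero, add_zero]

variable {p} in
/-- If the generating function of the weights is decomposed into a part `N / D` without `u`, a part
`P / (D A)` with positive powers of `u` only and a part `Q / (D B)` with negative powers of `u`
only, then the first part gives the Hilbert series. -/
theorem IsJordanBasis.hilbertSeries_eq_of_decomposition {K : Type*} [Field K] [CharZero K] {d : ℕ}
    {δ : LieDerivation K (Alg K d) (Alg K d)} {e : CellIndex p → Alg K d}
    (he : IsJordanBasis δ p e) {N D : PowerSeries ℚ} {P Q A B : PowerSeries (Polynomial ℚ)}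
    {E : PowerSeries ℚ[T;T⁻¹]}
    (hD : PowerSeries.constantCoeff D = 1) (hA : PowerSeries.constantCoeff A = 1)
    (hB : PowerSeries.constantCoeff B = 1)
    (hprod : ∏ c : CellIndex p, (1 - PowerSeries.C (T (cellWeight p c).1) * PowerSeries.X) =
      E * posPart A * negPart B)
    (h : (1 + PowerSeries.C (T (-1))) * ((∑ c, PowerSeries.C (T (cellWeight p c).1)) *
        PowerSeries.X - 1) * PowerSeries.map C D =
      E * (PowerSeries.map C (N - D) * posPart A * negPart B +
        PowerSeries.C (T 1) * posPart P * negPart B +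
        PowerSeries.C (T (-1)) * negPart Q * posPart A)) :
    hilbertSeries δ = (p.length : PowerSeries ℚ) * PowerSeries.X + N * D⁻¹ := by
  have hD' : D * D⁻¹ = 1 := PowerSeries.mul_inv_cancel D (by rw [hD]; exact one_ne_zero)
  obtain ⟨A', hA'⟩ : ∃ A', A * A' = 1 :=
    (PowerSeries.isUnit_iff_constantCoeff.2 (by rw [hA]; exact isUnit_one)).exists_right_inv
  obtain ⟨B', hB'⟩ : ∃ B', B * B' = 1 :=
    (PowerSeries.isUnit_iff_constantCoeff.2 (by rw [hB]; exact isUnit_one)).exists_right_inv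
  set ι : ℚ →+* Polynomial ℚ := Polynomial.C
  have hpos : posPart (PowerSeries.map ι D⁻¹) = PowerSeries.map C D⁻¹ := by
    ext1 n
    simp only [posPart, PowerSeries.coeff_map, ι, Polynomial.toLaurent_C]
  have hneg : negPart (PowerSeries.map ι D⁻¹) = PowerSeries.map C D⁻¹ := by
    ext1 n
    simp only [negPart, PowerSeries.coeff_map, ι, RingHom.comp_apply, Polynomial.toLaurent_C]
    exact invert_C _
  have key : (1 + PowerSeries.C (T (-1))) * ((∑ c, PowerSeries.C (T (cellWeight p c).1)) *
        PowerSeries.X - 1) * countSeries p =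
      PowerSeries.map C ((N - D) * D⁻¹) + PowerSeries.C (T 1) * posPart (P * A' *
        PowerSeries.map ι D⁻¹) + PowerSeries.C (T (-1)) * negPart (Q * B' *
        PowerSeries.map ι D⁻¹) := by
    have hF := countSeries_mul p
    rw [hprod] at hF
    have hD1 : PowerSeries.map (C : ℚ →+* ℚ[T;T⁻¹]) D * PowerSeries.map C D⁻¹ = 1 := by
      rw [← map_mul, hD', map_one]
    have hA1 : posPart A * posPart A' = 1 := by rw [← map_mul, hA', map_one]
    have hB1 : negPart B * negPart B' = 1 := by rw [← map_mul, hB', map_one]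
    simp only [map_mul, hpos, hneg]
    linear_combination (exp := 1) -((1 + PowerSeries.C (T (-1))) *
        ((∑ c, PowerSeries.C (T (cellWeight p c).1)) * PowerSeries.X - 1) * countSeries p) * hD1 +
      countSeries p * PowerSeries.map C D⁻¹ * h +
      PowerSeries.map C (N - D) * PowerSeries.map C D⁻¹ * hF +
      PowerSeries.C (T 1) * posPart P * PowerSeries.map C D⁻¹ *
        (posPart A' * hF - E * negPart B * countSeries p * hA1) +
      PowerSeries.C (T (-1)) * negPart Q * PowerSeries.map C D⁻¹ *
        (negPart B' * hF - E * posPart A * countSeries p * hB1)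
  rw [he.hilbertSeries_eq, key, constantTermSeries_decomposition, sub_mul, hD']
  ring

end GradedSeries

/-! ### Partial fraction decompositions with polynomial numerators -/

section GradedCases

open LaurentPolynomial

/-- The list of the `sl₂`-weights of the variables. -/
def cellWeights (p : List ℕ) : List ℤ :=
  p.flatMap fun a => (List.range (a + 1)).map fun k => (a : ℤ) - 2 * (k : ℕ)

@[to_additive]
theorem prod_cellIndex {M : Type*} [CommMonoid M] (p : List ℕ) (f : ℕ → ℕ → M) :
    ∏ c : CellIndex p, f (p.get c.1) c.2 =
      (p.map fun a => ∏ k ∈ Finset.range (a + 1), f a k).prod := by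
  rw [Fintype.prod_sigma, ← Fin.prod_univ_fun_getElem]
  refine Finset.prod_congr rfl fun i _ => ?_
  rw [Finset.prod_range]
  rfl

@[to_additive]
theorem prod_cellWeight {M : Type*} [CommMonoid M] (p : List ℕ) (f : ℤ → M) :
    ∏ c : CellIndex p, f (cellWeight p c).1 = ((cellWeights p).map f).prod := by
  refine (prod_cellIndex p fun a k => f ((a : ℤ) - 2 * (k : ℕ))).trans ?_
  rw [cellWeights]
  induction p with
  | nil => rfl
  | cons a p ih =>
    rw [List.map_cons, List.prod_cons, ih, List.flatMap_cons, List.map_append, List.prod_append,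
      List.map_map]
    rfl

theorem C_T (n : ℕ) :
    (PowerSeries.C (T n) : PowerSeries ℚ[T;T⁻¹]) = PowerSeries.C (T 1) ^ n := by
  rw [← map_pow, T_pow, mul_one]

theorem C_T_neg (n : ℕ) :
    (PowerSeries.C (T (-n)) : PowerSeries ℚ[T;T⁻¹]) = PowerSeries.C (T (-1)) ^ n := by
  rw [← map_pow, T_pow, mul_neg, mul_one]

/-- The value at `x` of the polynomial with the given coefficients, in Horner form. -/
def horner {R : Type*} [CommRing R] (x : R) : List ℤ → R
  | [] => 0
  | c :: l => c + x * horner x l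

/-- The value at `(a, x)` of the polynomial in two variables whose coefficients at the powers of
the first variable are the polynomials in the second variable with the given coefficients. -/
def horner₂ {R : Type*} [CommRing R] (a x : R) : List (List ℤ) → R
  | [] => 0
  | l :: L => horner x l + a * horner₂ a x L

section Ring

variable {R S : Type*} [CommRing R] [CommRing S]

theorem map_horner (f : R →+* S) (x : R) (l : List ℤ) : f (horner x l) = horner (f x) l := by
  induction l with
  | nil => exact map_zero f
  | cons c l ih => rw [horner, horner, map_add, map_mul, map_intCast, ih]

theorem map_horner₂ (f : R →+* S) (a x : R) (L : List (List ℤ)) :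
    f (horner₂ a x L) = horner₂ (f a) (f x) L := by
  induction L with
  | nil => exact map_zero f
  | cons l L ih => rw [horner₂, horner₂, map_add, map_mul, map_horner, ih]

theorem horner₂_append (a x : R) (L : List (List ℤ)) (l : List ℤ) :
    horner₂ a x (L ++ [l]) = horner₂ a x L + a ^ L.length * horner x l := by
  induction L with
  | nil => simp [horner₂]
  | cons m L ih =>
    rw [List.cons_append, horner₂, horner₂, ih, List.length_cons, pow_succ]
    ring

variable {a b : R} (hab : a * b = 1)

include hab

theorem horner₂_reverse (x : R) (L : List (List ℤ)) :
    a ^ L.length * (b * horner₂ b x L) = horner₂ a x L.reverse := by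
  induction L with
  | nil => simp [horner₂]
  | cons l L ih =>
    rw [List.reverse_cons, horner₂_append, ← ih, horner₂, List.length_cons, List.length_reverse]
    linear_combination a ^ L.length * (horner x l + b * horner₂ b x L) * hab

theorem prod_one_sub_pow (x : R) (ws : List ℕ) :
    a ^ ws.sum * (ws.map fun w => 1 - b ^ w * x).prod = (ws.map fun w => a ^ w - x).prod := by
  induction ws with
  | nil => simp
  | cons w ws ih =>
    have h : a ^ w * b ^ w = 1 := by rw [← mul_pow, hab, one_pow]
    rw [List.map_cons, List.map_cons, List.prod_cons, List.prod_cons, ← ih, List.sum_cons, pow_add]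
    linear_combination -a ^ ws.sum * (ws.map fun w => 1 - b ^ w * x).prod * x * h

theorem sum_pow_add_pow {k : ℕ} (ws : List ℕ) (hk : ∀ w ∈ ws, w ≤ k) :
    a ^ k * (ws.map fun w => a ^ w + b ^ w).sum =
      (ws.map fun w => a ^ (k + w) + a ^ (k - w)).sum := by
  induction ws with
  | nil => simp
  | cons w ws ih =>
    have h : a ^ w * b ^ w = 1 := by rw [← mul_pow, hab, one_pow]
    have hw : a ^ k = a ^ (k - w) * a ^ w := by rw [← pow_add, Nat.sub_add_cancel (hk w (by simp))]
    rw [List.map_cons, List.map_cons, List.sum_cons, List.sum_cons,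
      ← ih fun v hv => hk v (List.mem_cons_of_mem _ hv), pow_add]
    linear_combination a ^ (k - w) * h + b ^ w * hw

end Ring

/-- The Hilbert series is `N / D` in degree at least two, if the generating function of the weights
has a decomposition as in `IsJordanBasis.hilbertSeries_eq_of_decomposition`, given by polynomials.
Here the weights of the variables are `r` times `0`, the members of `ws` and their negatives;
`posNum` and `negNum` are the coefficients of the numerators of the parts with positive and with
negative powers of `u`. The hypothesis `h` is the decomposition multiplied by the power
`m₁ + k + 1` of `u`, so that only polynomials in `a = u` occur: the weights need `k` of these
factors, the denominator with negative powers `ws.sum` and its numerator `negNum.length`. -/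
theorem HasJordanCells.hilbertSeries_eq {K : Type*} [Field K] [CharZero K] {d : ℕ}
    {δ : LieDerivation K (Alg K d) (Alg K d)} {p : List ℕ} (hδ : HasJordanCells δ p)
    (r : ℕ) (ws : List ℕ) (posNum negNum : List (List ℤ)) {N D : PowerSeries ℚ}
    (hD : PowerSeries.constantCoeff D = 1)
    (hws : (cellWeights p).Perm (List.replicate r 0 ++ ws.map (fun w : ℕ => (w : ℤ)) ++
      ws.map fun w : ℕ => -(w : ℤ)))
    (k m₁ m₂ m₃ : ℕ) (hk : ∀ w ∈ ws, w ≤ k) (h₂ : m₁ + k + 1 = m₂ + ws.sum)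
    (h₃ : m₁ + k + 1 = m₃ + negNum.length)
    (h : ∀ a : PowerSeries ℚ[T;T⁻¹],
      a ^ m₁ * (a + 1) * (((ws.map fun w => a ^ (k + w) + a ^ (k - w)).sum +
        (r : PowerSeries ℚ[T;T⁻¹]) * a ^ k) *
        PowerSeries.X - a ^ k) * PowerSeries.map C D =
      (1 - PowerSeries.X) ^ r *
        (a ^ m₂ * (PowerSeries.map C (N - D) * (ws.map fun w => 1 - a ^ w * PowerSeries.X).prod +
            a * horner₂ a PowerSeries.X posNum) * (ws.map fun w => a ^ w - PowerSeries.X).prod +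
          a ^ m₃ * horner₂ a PowerSeries.X negNum.reverse *
            (ws.map fun w => 1 - a ^ w * PowerSeries.X).prod)) :
    hilbertSeries δ = (p.length : PowerSeries ℚ) * PowerSeries.X + N * D⁻¹ := by
  obtain ⟨-, e, he⟩ := hδ
  set u : PowerSeries (Polynomial ℚ) := PowerSeries.C Polynomial.X
  set a : PowerSeries ℚ[T;T⁻¹] := PowerSeries.C (T 1) with ha
  set b : PowerSeries ℚ[T;T⁻¹] := PowerSeries.C (T (-1)) with hb
  have hab : a * b = 1 := by rw [ha, hb, ← map_mul, ← T_add, add_neg_cancel, T_zero, map_one]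
  have hu : posPart u = a := by rw [posPart, PowerSeries.map_C, Polynomial.toLaurent_X]
  have hu' : negPart u = b := by
    rw [negPart, PowerSeries.map_C, RingHom.comp_apply, Polynomial.toLaurent_X]
    exact congrArg _ (invert_T 1)
  have hz : posPart PowerSeries.X = PowerSeries.X := PowerSeries.map_X _
  have hz' : negPart PowerSeries.X = PowerSeries.X := PowerSeries.map_X _
  set A : PowerSeries (Polynomial ℚ) := (ws.map fun w => 1 - u ^ w * PowerSeries.X).prod
  have hA0 : PowerSeries.constantCoeff A = 1 := by
    simp only [A, map_list_prod, List.map_map]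
    refine List.prod_eq_one fun y hy => ?_
    obtain ⟨w, -, rfl⟩ := List.mem_map.1 hy
    simp
  have hA : posPart A = (ws.map fun w => 1 - a ^ w * PowerSeries.X).prod := by
    simp only [A, map_list_prod, List.map_map, Function.comp_def, map_sub, map_mul, map_pow,
      map_one, hu, hz]
  have hB : negPart A = (ws.map fun w => 1 - b ^ w * PowerSeries.X).prod := by
    simp only [A, map_list_prod, List.map_map, Function.comp_def, map_sub, map_mul, map_pow,
      map_one, hu', hz']
  refine he.hilbertSeries_eq_of_decomposition (N := N) (P := horner₂ u PowerSeries.X posNum)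
    (Q := horner₂ u PowerSeries.X negNum) (E := (1 - PowerSeries.X) ^ r) hD hA0 hA0 ?_ ?_
  · rw [prod_cellWeight p fun w => 1 - PowerSeries.C (T w) * PowerSeries.X,
      (hws.map _).prod_eq, hA, hB]
    simp only [List.map_append, List.prod_append, List.map_replicate, List.prod_replicate,
      List.map_map, Function.comp_def, T_zero, map_one, one_mul, C_T, C_T_neg, ha, hb]
  · have hV : ∑ c : CellIndex p, (PowerSeries.C (T (cellWeight p c).1) : PowerSeries ℚ[T;T⁻¹]) =
        (r : PowerSeries ℚ[T;T⁻¹]) + (ws.map fun w => a ^ w + b ^ w).sum := by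
      rw [sum_cellWeight p fun w => PowerSeries.C (T w), (hws.map _).sum_eq]
      simp only [List.map_append, List.sum_append, List.map_replicate, List.sum_replicate,
        List.map_map, Function.comp_def, T_zero, map_one, C_T, C_T_neg, List.sum_map_add,
        nsmul_eq_mul, mul_one, add_assoc, ha, hb]
    rw [hV, map_horner₂, map_horner₂, hA, hB, hu, hz, hu', hz']
    refine ((IsUnit.of_mul_eq_one b hab).pow (m₁ + k + 1)).mul_left_cancel ?_
    have e1 := h a
    have e2 := sum_pow_add_pow hab ws hk
    have e3 := prod_one_sub_pow hab PowerSeries.X ws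
    have e4 := horner₂_reverse hab PowerSeries.X negNum
    rw [← e2, ← e3, ← e4] at e1
    have e5 : a ^ (m₁ + k + 1) = a ^ m₂ * a ^ ws.sum := by rw [h₂, pow_add]
    have e6 : a ^ (m₁ + k + 1) = a ^ m₃ * a ^ negNum.length := by rw [h₃, pow_add]
    generalize horner₂ b PowerSeries.X negNum = Q at e1 ⊢
    generalize horner₂ a PowerSeries.X posNum = P at e1 ⊢
    generalize (ws.map fun w => 1 - a ^ w * PowerSeries.X).prod = A₁ at e1 ⊢
    generalize (ws.map fun w => 1 - b ^ w * PowerSeries.X).prod = B₁ at e1 ⊢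
    generalize (ws.map fun w => a ^ w + b ^ w).sum = V at e1 ⊢
    generalize PowerSeries.map C D = D₁ at e1 ⊢
    generalize PowerSeries.map C (N - D) = N₁ at e1 ⊢
    generalize (1 - PowerSeries.X : PowerSeries ℚ[T;T⁻¹]) ^ r = E at e1 ⊢
    generalize (r : PowerSeries ℚ[T;T⁻¹]) = r' at e1 ⊢
    have e7 : a ^ (m₁ + k + 1) * ((1 + b) * ((r' + V) * PowerSeries.X - 1) * D₁) =
        a ^ m₁ * (a + 1) * ((a ^ k * V + r' * a ^ k) * PowerSeries.X - a ^ k) * D₁ := by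
      rw [pow_succ, pow_add]
      linear_combination a ^ m₁ * a ^ k * ((r' + V) * PowerSeries.X - 1) * D₁ * hab
    rw [e7, e1]
    linear_combination (-(E * (N₁ * A₁ * B₁ + a * P * B₁))) * e5 - E * (b * Q * A₁) * e6

end GradedCases

/-! ### The graded Hilbert series in small dimensions -/

section GradedTable

/-! Each proof supplies the partial fraction decomposition of
`(1 + u⁻¹) (V z - 1) / ∏ (1 - u ^ w z)`, the product extending over all weights `w`. The common
denominator of the three parts in `z` alone is `D`, that of the series, and the numerators of the
parts with positive and negative powers of `u` are `posNum` and `negNum`; what has to be verified is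
a polynomial identity in `u` and `z`. -/

open LaurentPolynomial PowerSeries

variable {K : Type*} [Field K] [CharZero K]

theorem hilbertSeries_one {δ : LieDerivation K (Alg K 2) (Alg K 2)}
    (hδ : HasJordanCells δ [1]) :
    hilbertSeries δ = X + X ^ 2 * (1 - X)⁻¹ := by
  have h := hδ.hilbertSeries_eq (r := 0) (ws := [1])
    (posNum := [[0, 0, 0, 1]])
    (negNum := [[-1, 1, 1], [0, 1, -1]])
    (N := X ^ 2)
    (D := 1 - X)
    (by simp) (by decide) (k := 1) (m₁ := 0) (m₂ := 1) (m₃ := 0) (by simp) rfl rfl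
    fun a => by
      simp only [map_sub, map_pow, map_one, PowerSeries.map_X,
        List.map_cons, List.map_nil, List.sum_cons, List.sum_nil, List.prod_cons, List.prod_nil,
        List.reverse_cons, List.reverse_nil, List.nil_append, List.cons_append, horner₂, horner]
      push_cast
      generalize (X : PowerSeries ℚ[T;T⁻¹]) = x
      ring
  refine h.trans ?_
  norm_num

theorem hilbertSeries_two {δ : LieDerivation K (Alg K 3) (Alg K 3)}
    (hδ : HasJordanCells δ [2]) :
    hilbertSeries δ = X + X ^ 2 * ((1 - X) ^ 2)⁻¹ := by
  have h := hδ.hilbertSeries_eq (r := 1) (ws := [2])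
    (posNum := [[0, 0, 1], [0, 0, 1]])
    (negNum := [[-1, 2], [0, 0, 1], [0, 1, -1]])
    (N := X ^ 2)
    (D := (1 - X) ^ 2)
    (by simp) (by decide) (k := 2) (m₁ := 0) (m₂ := 1) (m₃ := 0) (by simp) rfl rfl
    fun a => by
      simp only [map_sub, map_pow, map_one, PowerSeries.map_X,
        List.map_cons, List.map_nil, List.sum_cons, List.sum_nil, List.prod_cons, List.prod_nil,
        List.reverse_cons, List.reverse_nil, List.nil_append, List.cons_append, horner₂, horner]
      push_cast
      generalize (X : PowerSeries ℚ[T;T⁻¹]) = x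
      ring
  refine h.trans ?_
  norm_num

theorem hilbertSeries_three {δ : LieDerivation K (Alg K 4) (Alg K 4)}
    (hδ : HasJordanCells δ [3]) :
    hilbertSeries δ = X + X ^ 2 * (2 + X ^ 2 + X ^ 3 - X ^ 4) * ((1 - X) ^ 2 * (1 - X ^ 4))⁻¹ := by
  have h := hδ.hilbertSeries_eq (r := 0) (ws := [3, 1])
    (posNum := [[0, 0, 1, 2, 0, 1, -1], [0, 0, 1, 0, 0, -1], [0, 0, 1, 0, -1, 1, -1],
      [0, 0, 1, -2, -1, 0, -2, 1]])
    (negNum := [[-1, 2, 1, 0, 2, -1], [0, 1, -1, 1, 0, -1], [0, 0, 1, 0, 0, -1],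
      [0, 1, -1, -1, -1, -1]])
    (N := X ^ 2 * (2 + X ^ 2 + X ^ 3 - X ^ 4))
    (D := (1 - X) ^ 2 * (1 - X ^ 4))
    (by simp) (by decide) (k := 3) (m₁ := 0) (m₂ := 0) (m₃ := 0) (by simp) rfl rfl
    fun a => by
      simp only [map_add, map_sub, map_mul, map_pow, map_one, map_ofNat, PowerSeries.map_X,
        List.map_cons, List.map_nil, List.sum_cons, List.sum_nil, List.prod_cons, List.prod_nil,
        List.reverse_cons, List.reverse_nil, List.nil_append, List.cons_append, horner₂, horner]
      push_cast
      generalize (X : PowerSeries ℚ[T;T⁻¹]) = x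
      ring
  refine h.trans ?_
  norm_num

theorem hilbertSeries_one_one {δ : LieDerivation K (Alg K 4) (Alg K 4)}
    (hδ : HasJordanCells δ [1, 1]) :
    hilbertSeries δ = 2 * X + X ^ 2 * (4 - X ^ 2) * ((1 - X) ^ 2 * (1 - X ^ 2))⁻¹ := by
  have h := hδ.hilbertSeries_eq (r := 0) (ws := [1, 1])
    (posNum := [[0, 0, 1, 6, -4], [0, 0, 1, -2, -4, 2]])
    (negNum := [[-1, 2, 4, -2], [0, 2, -3, -2]])
    (N := X ^ 2 * (4 - X ^ 2))
    (D := (1 - X) ^ 2 * (1 - X ^ 2))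
    (by simp) (by decide) (k := 1) (m₁ := 0) (m₂ := 0) (m₃ := 0) (by simp) rfl rfl
    fun a => by
      simp only [map_sub, map_mul, map_pow, map_one, map_ofNat, PowerSeries.map_X,
        List.map_cons, List.map_nil, List.sum_cons, List.sum_nil, List.prod_cons, List.prod_nil,
        List.reverse_cons, List.reverse_nil, List.nil_append, List.cons_append, horner₂, horner]
      push_cast
      generalize (X : PowerSeries ℚ[T;T⁻¹]) = x
      ring
  refine h.trans ?_
  norm_num

theorem hilbertSeries_four {δ : LieDerivation K (Alg K 5) (Alg K 5)}
    (hδ : HasJordanCells δ [4]) :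
    hilbertSeries δ = X + X ^ 2 * (2 + 2 * X + X ^ 2 - 2 * X ^ 4 + X ^ 5) * ((1 - X) ^ 2 * (1 -
      X ^ 2) * (1 - X ^ 3))⁻¹ := by
  have h := hδ.hilbertSeries_eq (r := 1) (ws := [4, 2])
    (posNum := [[0, 0, 2, 2, 1, -1], [0, 0, 2, 2, 1, -1], [0, 0, 1, 1, -1, -1],
      [0, 0, 1, 1, -1, -1], [0, 0, 1, -2, -2, -1], [0, 0, 1, -2, -2, -1]])
    (negNum := [[-1, 2, 2, 1], [0, 0, 2, 2, 1, -1], [0, 1, 0, 0, 0, -1], [0, 0, 1, 1, -1, -1],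
      [0, 1, -1, -1, -2, -1], [0, 0, 1, -2, -2, -1]])
    (N := X ^ 2 * (2 + 2 * X + X ^ 2 - 2 * X ^ 4 + X ^ 5))
    (D := (1 - X) ^ 2 * (1 - X ^ 2) * (1 - X ^ 3))
    (by simp) (by decide) (k := 4) (m₁ := 1) (m₂ := 0) (m₃ := 0) (by simp) rfl rfl
    fun a => by
      simp only [map_add, map_sub, map_mul, map_pow, map_one, map_ofNat, PowerSeries.map_X,
        List.map_cons, List.map_nil, List.sum_cons, List.sum_nil, List.prod_cons, List.prod_nil,
        List.reverse_cons, List.reverse_nil, List.nil_append, List.cons_append, horner₂, horner]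
      push_cast
      generalize (X : PowerSeries ℚ[T;T⁻¹]) = x
      ring
  refine h.trans ?_
  norm_num

theorem hilbertSeries_two_one {δ : LieDerivation K (Alg K 5) (Alg K 5)}
    (hδ : HasJordanCells δ [2, 1]) :
    hilbertSeries δ = 2 * X + X ^ 2 * (4 + 2 * X ^ 2 - 3 * X ^ 3 + X ^ 4) * ((1 - X) ^ 3 * (1 -
      X ^ 3))⁻¹ := by
  have h := hδ.hilbertSeries_eq (r := 1) (ws := [2, 1])
    (posNum := [[0, 0, 3, 2, 0, -1], [0, 0, 2, -1, 0, -1], [0, 0, 1, -3, -1, -2, 1]])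
    (negNum := [[-1, 3, 1, 2, -1], [0, 1, 0, 1, -2], [0, 1, -1, -2, -2]])
    (N := X ^ 2 * (4 + 2 * X ^ 2 - 3 * X ^ 3 + X ^ 4))
    (D := (1 - X) ^ 3 * (1 - X ^ 3))
    (by simp) (by decide) (k := 2) (m₁ := 0) (m₂ := 0) (m₃ := 0) (by simp) rfl rfl
    fun a => by
      simp only [map_add, map_sub, map_mul, map_pow, map_one, map_ofNat, PowerSeries.map_X,
        List.map_cons, List.map_nil, List.sum_cons, List.sum_nil, List.prod_cons, List.prod_nil,
        List.reverse_cons, List.reverse_nil, List.nil_append, List.cons_append, horner₂, horner]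
      push_cast
      generalize (X : PowerSeries ℚ[T;T⁻¹]) = x
      ring
  refine h.trans ?_
  norm_num

set_option maxHeartbeats 2000000 in
theorem hilbertSeries_five {δ : LieDerivation K (Alg K 6) (Alg K 6)}
    (hδ : HasJordanCells δ [5]) :
    hilbertSeries δ = X + X ^ 2 * (3 + 3 * X + 7 * X ^ 2 + 10 * X ^ 3 + 11 * X ^ 4 + 14 * X ^ 5 +
      13 * X ^ 6 + 16 * X ^ 7 + 12 * X ^ 8 + 8 * X ^ 9 + 10 * X ^ 10 + 3 * X ^ 11 + 5 * X ^ 12 -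
      X ^ 13 + X ^ 14 - X ^ 16 + 2 * X ^ 17 - X ^ 18) * ((1 - X) ^ 2 * (1 - X ^ 4) * (1 - X ^ 6) *
      (1 - X ^ 8))⁻¹ := by
  have h := hδ.hilbertSeries_eq (r := 0) (ws := [5, 3, 1])
    (posNum := [[0, 0, 2, 5, 6, 10, 10, 16, 12, 16, 10, 12, 7, 5, 3, 1],
      [0, 0, 2, 2, 3, 1, 4, 1, 2, -2, 0, -2, -3, -3, -2, -2, -1],
      [0, 0, 2, 2, 1, 5, 1, 3, -1, 2, -2, -2, -4, -1, -3, -2, 0, -2, 1],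
      [0, 0, 2, -1, -2, -3, -7, -11, -11, -14, -16, -14, -14, -8, -10, -3, -3, -1, 1],
      [0, 0, 1, 1, -1, 2, -2, 1, 0, -2, 0, -2, 0, 0, 0, 0, 1, 0, 1],
      [0, 0, 1, -2, -4, -6, -10, -10, -16, -14, -16, -12, -12, -6, -7, -1, -2, 1, 1],
      [0, 0, 1, -2, -2, -1, -3, -2, -3, -2, 1, -2, 4, 0, 4, 2, 2, 2, 1],
      [0, 0, 1, -3, 0, -1, -5, 0, -5, 1, -3, 1, 2, 2, 2, 3, 2, 2, 1],
      [0, 0, 0, -1, 2, 2, 3, 8, 8, 13, 12, 15, 14, 12, 10, 8, 5, 3, 1]])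
    (negNum := [[-1, 2, 2, 3, 8, 8, 13, 12, 15, 14, 12, 10, 8, 5, 3, 1],
      [0, 1, 0, 3, 3, 2, 2, 3, 0, 1, -4, 0, -3, -3, -2, -2, -1],
      [0, 0, 2, 2, 3, 1, 4, 1, 2, -2, 0, -2, -3, -3, -2, -2, -1],
      [0, 1, 0, 0, -2, -3, -7, -10, -13, -13, -16, -14, -14, -9, -8, -5, -1, -2, 1],
      [0, 0, 1, 1, 0, 0, 1, -3, 2, -2, -1, 0, -2, 2, -2, 2, 0, 0, 1],
      [0, 1, -1, -1, -4, -6, -10, -12, -12, -17, -14, -14, -10, -8, -5, -3, 0, 0, 1],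
      [0, 0, 0, 0, -2, -3, -2, -2, -3, -2, -1, 2, 0, 4, 1, 4, 1, 2, 1],
      [0, 0, 1, -2, -2, -1, -3, -2, -3, -2, 1, -2, 4, 0, 4, 2, 2, 2, 1],
      [0, 0, 0, -1, 2, 2, 3, 8, 8, 13, 12, 15, 14, 12, 10, 8, 5, 3, 1]])
    (N := X ^ 2 * (3 + 3 * X + 7 * X ^ 2 + 10 * X ^ 3 + 11 * X ^ 4 + 14 * X ^ 5 + 13 * X ^ 6 +
      16 * X ^ 7 + 12 * X ^ 8 + 8 * X ^ 9 + 10 * X ^ 10 + 3 * X ^ 11 + 5 * X ^ 12 - X ^ 13 +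
      X ^ 14 - X ^ 16 + 2 * X ^ 17 - X ^ 18))
    (D := (1 - X) ^ 2 * (1 - X ^ 4) * (1 - X ^ 6) * (1 - X ^ 8))
    (by simp) (by decide) (k := 5) (m₁ := 3) (m₂ := 0) (m₃ := 0) (by simp) rfl rfl
    fun a => by
      simp only [map_add, map_sub, map_mul, map_pow, map_one, map_ofNat, PowerSeries.map_X,
        List.map_cons, List.map_nil, List.sum_cons, List.sum_nil, List.prod_cons, List.prod_nil,
        List.reverse_cons, List.reverse_nil, List.nil_append, List.cons_append, horner₂, horner]
      push_cast
      generalize (X : PowerSeries ℚ[T;T⁻¹]) = x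
      ring
  refine h.trans ?_
  norm_num

set_option maxHeartbeats 400000 in
theorem hilbertSeries_three_one {δ : LieDerivation K (Alg K 6) (Alg K 6)}
    (hδ : HasJordanCells δ [3, 1]) :
    hilbertSeries δ = 2 * X + X ^ 2 * (5 + 6 * X + 8 * X ^ 2 + 11 * X ^ 3 + 5 * X ^ 4 - 2 * X ^ 5 +
      3 * X ^ 6 - 2 * X ^ 7 + 2 * X ^ 9 - X ^ 10) * ((1 - X) ^ 2 * (1 - X ^ 2) * (1 -
      X ^ 4) ^ 2)⁻¹ := by
  have h := hδ.hilbertSeries_eq (r := 0) (ws := [3, 1, 1])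
    (posNum := [[0, 0, 3, 10, 5, 13, 1, 4, 0, -2, 1], [0, 0, 3, -1, -5, -9, -11, -5, -8, 0, 1],
      [0, 0, 2, 1, -4, 3, -1, -4, 1, 0, 2], [0, 0, 2, -5, -8, -3, -18, -3, -3, 1, 2],
      [0, 0, 0, -1, 2, 5, 4, 11, 7, 5, 2]])
    (negNum := [[-1, 2, 5, 4, 11, 7, 5, 2], [0, 2, -1, 0, -3, -9, -13, -6, -4, -2, 1],
      [0, 0, 2, 1, 0, -5, 0, 2, -3, 2, 1], [0, 1, 0, -4, -8, -8, -8, -9, -1, 0, 2],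
      [0, 0, 0, -1, 2, 5, 4, 11, 7, 5, 2]])
    (N := X ^ 2 * (5 + 6 * X + 8 * X ^ 2 + 11 * X ^ 3 + 5 * X ^ 4 - 2 * X ^ 5 + 3 * X ^ 6 -
      2 * X ^ 7 + 2 * X ^ 9 - X ^ 10))
    (D := (1 - X) ^ 2 * (1 - X ^ 2) * (1 - X ^ 4) ^ 2)
    (by simp) (by decide) (k := 3) (m₁ := 1) (m₂ := 0) (m₃ := 0) (by simp) rfl rfl
    fun a => by
      simp only [map_add, map_sub, map_mul, map_pow, map_one, map_ofNat, PowerSeries.map_X,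
        List.map_cons, List.map_nil, List.sum_cons, List.sum_nil, List.prod_cons, List.prod_nil,
        List.reverse_cons, List.reverse_nil, List.nil_append, List.cons_append, horner₂, horner]
      push_cast
      generalize (X : PowerSeries ℚ[T;T⁻¹]) = x
      ring
  refine h.trans ?_
  norm_num

theorem hilbertSeries_two_two {δ : LieDerivation K (Alg K 6) (Alg K 6)}
    (hδ : HasJordanCells δ [2, 2]) :
    hilbertSeries δ = 2 * X + X ^ 2 * (5 + 8 * X - 6 * X ^ 3 + 2 * X ^ 4 + 2 * X ^ 5 - X ^ 6) *
      ((1 - X) ^ 2 * (1 - X ^ 2) ^ 3)⁻¹ := by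
  have h := hδ.hilbertSeries_eq (r := 2) (ws := [2, 2])
    (posNum := [[0, 0, 4, 8, 0, -2], [0, 0, 4, 8, 0, -2], [0, 0, 1, -2, -7, -2],
      [0, 0, 1, -2, -7, -2]])
    (negNum := [[-1, 2, 7, 2], [0, 0, 4, 8, 0, -2], [0, 2, 0, -6, -4, -2], [0, 0, 1, -2, -7, -2]])
    (N := X ^ 2 * (5 + 8 * X - 6 * X ^ 3 + 2 * X ^ 4 + 2 * X ^ 5 - X ^ 6))
    (D := (1 - X) ^ 2 * (1 - X ^ 2) ^ 3)
    (by simp) (by decide) (k := 2) (m₁ := 1) (m₂ := 0) (m₃ := 0) (by simp) rfl rfl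
    fun a => by
      simp only [map_add, map_sub, map_mul, map_pow, map_one, map_ofNat, PowerSeries.map_X,
        List.map_cons, List.map_nil, List.sum_cons, List.sum_nil, List.prod_cons, List.prod_nil,
        List.reverse_cons, List.reverse_nil, List.nil_append, List.cons_append, horner₂, horner]
      push_cast
      generalize (X : PowerSeries ℚ[T;T⁻¹]) = x
      ring
  refine h.trans ?_
  norm_num

theorem hilbertSeries_one_one_one {δ : LieDerivation K (Alg K 6) (Alg K 6)}
    (hδ : HasJordanCells δ [1, 1, 1]) :
    hilbertSeries δ = 3 * X + X ^ 2 * (9 + 9 * X - 6 * X ^ 3 + 2 * X ^ 4 + 2 * X ^ 5 - X ^ 6) *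
      ((1 - X) ^ 2 * (1 - X ^ 2) ^ 3)⁻¹ := by
  have h := hδ.hilbertSeries_eq (r := 0) (ws := [1, 1, 1])
    (posNum := [[0, 0, 3, 21, -6, -6, 3], [0, 0, 3, -7, -31, 2, 3], [0, 0, 0, -1, 2, 11, 3]])
    (negNum := [[-1, 2, 11, 3], [0, 3, -3, -12, -15, -6, 3], [0, 0, 0, -1, 2, 11, 3]])
    (N := X ^ 2 * (9 + 9 * X - 6 * X ^ 3 + 2 * X ^ 4 + 2 * X ^ 5 - X ^ 6))
    (D := (1 - X) ^ 2 * (1 - X ^ 2) ^ 3)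
    (by simp) (by decide) (k := 1) (m₁ := 1) (m₂ := 0) (m₃ := 0) (by simp) rfl rfl
    fun a => by
      simp only [map_add, map_sub, map_mul, map_pow, map_one, map_ofNat, PowerSeries.map_X,
        List.map_cons, List.map_nil, List.sum_cons, List.sum_nil, List.prod_cons, List.prod_nil,
        List.reverse_cons, List.reverse_nil, List.nil_append, List.cons_append, horner₂, horner]
      push_cast
      generalize (X : PowerSeries ℚ[T;T⁻¹]) = x
      ring
  refine h.trans ?_
  norm_num

end GradedTable

/-! ### The bigraded Hilbert series and its antisymmetrization -/

section BigradedSeries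

open MvPowerSeries

/-- The product of the geometric series of monomials `X ^ v c` is the generating function of the
number of ways to write an exponent as a sum of exponents `v c`. -/
theorem geometricSeries_prod {σ τ : Type*} [Fintype σ] (v : σ → τ →₀ ℕ) (t : τ)
    (hv : ∀ c, v c t = 1) :
    (show MvPowerSeries τ ℚ from fun m => (Nat.card {f : σ →₀ ℕ // ∑ c, f c • v c = m} : ℚ)) *
      ∏ c, (1 - monomial (v c) 1) = 1 := by
  classical
  let geo : σ → MvPowerSeries τ ℚ := fun c m => if m = m t • v c then 1 else 0
  have hgeo : ∀ c, geo c * (1 - monomial (v c) 1) = 1 := by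
    intro c
    ext m
    rw [mul_sub, mul_one, map_sub, coeff_mul_monomial, mul_one, coeff_one]
    change (if m = m t • v c then (1 : ℚ) else 0) - _ = _
    by_cases hm : v c ≤ m
    · obtain ⟨m', rfl⟩ := exists_add_of_le hm
      have h0 : v c + m' ≠ 0 := fun h => by
        have := DFunLike.congr_fun h t
        rw [Finsupp.add_apply, hv, Finsupp.zero_apply] at this
        omega
      have h1 : v c + m' = (v c + m') t • v c ↔ m' = m' t • v c := by
        rw [Finsupp.add_apply, hv, add_smul, one_smul, add_right_inj]
      rw [if_pos hm, add_tsub_cancel_left, if_neg h0]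
      change _ - (if m' = m' t • v c then (1 : ℚ) else 0) = 0
      rw [if_congr h1 rfl rfl, sub_self]
    · rw [if_neg hm, sub_zero]
      refine if_congr ⟨fun h => ?_, fun h => by rw [h]; simp⟩ rfl rfl
      rcases Nat.eq_zero_or_pos (m t) with h0 | h0
      · rw [h, h0, zero_smul]
      · refine absurd ?_ hm
        rw [h]
        exact le_smul_of_one_le_left zero_le h0
  have hcount : (show MvPowerSeries τ ℚ from
      fun m => (Nat.card {f : σ →₀ ℕ // ∑ c, f c • v c = m} : ℚ)) = ∏ c, geo c := by
    ext m
    rw [coeff_prod]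
    change (Nat.card {f : σ →₀ ℕ // ∑ c, f c • v c = m} : ℚ) =
      ∑ l ∈ Finset.univ.finsuppAntidiag m, ∏ c, if l c = l c t • v c then (1 : ℚ) else 0
    simp only [Finset.prod_boole, Finset.mem_univ, true_imp_iff]
    rw [Finset.sum_boole, Nat.cast_inj, ← Fintype.card_coe, ← Nat.card_eq_fintype_card]
    refine Nat.card_congr (Equiv.ofBijective (fun f => ⟨Finsupp.equivFunOnFinite.symm
      fun c => f.1 c • v c, ?_⟩) ⟨?_, ?_⟩)
    · rw [Finset.mem_filter, Finset.mem_finsuppAntidiag]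
      refine ⟨⟨f.2, Finset.subset_univ _⟩, fun c => ?_⟩
      rw [Finsupp.equivFunOnFinite_symm_apply_apply, Finsupp.smul_apply, hv, smul_eq_mul, mul_one]
    · intro f g hfg
      refine Subtype.ext (Finsupp.ext fun c => ?_)
      have h := DFunLike.congr_fun (DFunLike.congr_fun (congrArg Subtype.val hfg) c) t
      simpa [hv] using h
    · rintro ⟨l, hl⟩
      rw [Finset.mem_filter, Finset.mem_finsuppAntidiag] at hl
      have h : ∀ c, (Finsupp.equivFunOnFinite.symm fun c => l c t) c • v c = l c := fun c => by
        rw [Finsupp.equivFunOnFinite_symm_apply_apply]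
        exact (hl.2 c).symm
      refine ⟨⟨Finsupp.equivFunOnFinite.symm fun c => l c t, ?_⟩, Subtype.ext (Finsupp.ext h)⟩
      rw [Finset.sum_congr rfl fun c _ => h c]
      exact hl.1.1
  rw [hcount, ← Finset.prod_mul_distrib]
  exact Finset.prod_eq_one fun c _ => hgeo c

/-- The series supported at the exponents where the first variable dominates the second one. -/
def dominantSubring : Subring (MvPowerSeries (Fin 3) ℚ) where
  carrier := {f | ∀ s : Fin 3 →₀ ℕ, s 0 < s 1 → coeff s f = 0}
  zero_mem' _ _ := map_zero _
  one_mem' s hs := by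
    classical
    rw [coeff_one, if_neg]
    rintro rfl
    exact lt_irrefl _ hs
  add_mem' hf hg s hs := by rw [map_add, hf s hs, hg s hs, add_zero]
  neg_mem' hf s hs := by rw [map_neg, hf s hs, neg_zero]
  mul_mem' {f g} hf hg s hs := by
    classical
    rw [coeff_mul]
    refine Finset.sum_eq_zero fun q hq => ?_
    rw [Finset.HasAntidiagonal.mem_antidiagonal] at hq
    rcases lt_or_ge (q.1 0) (q.1 1) with h | h
    · rw [hf _ h, zero_mul]
    · rw [hg q.2, mul_zero]
      rw [← hq, Finsupp.add_apply, Finsupp.add_apply] at hs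
      omega

theorem inv_mem_dominantSubring {f : MvPowerSeries (Fin 3) ℚ} (hf : f ∈ dominantSubring) :
    f⁻¹ ∈ dominantSubring := by
  classical
  intro s
  induction s using WellFoundedLT.induction with
  | _ s ih =>
    intro hs
    rw [coeff_inv, if_neg (by rintro rfl; exact lt_irrefl _ hs)]
    rw [Finset.sum_eq_zero, mul_zero]
    intro q hq
    rw [Finset.HasAntidiagonal.mem_antidiagonal] at hq
    split_ifs with h
    · rcases lt_or_ge (q.1 0) (q.1 1) with h1 | h1
      · rw [hf _ h1, zero_mul]
      · rw [ih q.2 h, mul_zero]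
        rw [← hq, Finsupp.add_apply, Finsupp.add_apply] at hs
        omega
    · rfl

theorem monomial_mem_dominantSubring {s : Fin 3 →₀ ℕ} (hs : s 1 ≤ s 0) (r : ℚ) :
    monomial s r ∈ dominantSubring := by
  classical
  intro m hm
  rw [coeff_monomial, if_neg]
  rintro rfl
  omega

/-- The exchange of the first two variables. -/
noncomputable def swapVars : MvPowerSeries (Fin 3) ℚ →ₐ[ℚ] MvPowerSeries (Fin 3) ℚ :=
  rename (Equiv.swap (0 : Fin 3) 1).toEmbedding

theorem coeff_swapVars {f : MvPowerSeries (Fin 3) ℚ} (hf : f ∈ dominantSubring) {s : Fin 3 →₀ ℕ}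
    (hs : s 1 < s 0) : coeff s (swapVars f) = 0 := by
  have h0 : (s.embDomain (Equiv.swap (0 : Fin 3) 1).toEmbedding) 0 = s 1 :=
    Finsupp.embDomain_apply_self (Equiv.swap (0 : Fin 3) 1).toEmbedding s 1
  have h1 : (s.embDomain (Equiv.swap (0 : Fin 3) 1).toEmbedding) 1 = s 0 :=
    Finsupp.embDomain_apply_self (Equiv.swap (0 : Fin 3) 1).toEmbedding s 0
  have h : (s.embDomain (Equiv.swap (0 : Fin 3) 1).toEmbedding).embDomain
      (Equiv.swap (0 : Fin 3) 1).toEmbedding = s := by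
    rw [← Finsupp.embDomain_trans_apply]
    ext i
    have := Finsupp.embDomain_apply_self ((Equiv.swap (0 : Fin 3) 1).toEmbedding.trans
      (Equiv.swap (0 : Fin 3) 1).toEmbedding) s i
    simpa using this
  rw [← h, swapVars, coeff_embDomain_rename]
  exact hf _ (by rw [h0, h1]; exact hs)

variable (p : List ℕ)

/-- The generating function of the number of monomials of given bidegree and degree. -/
noncomputable def bicountSeries : MvPowerSeries (Fin 3) ℚ := fun s =>
  (monomialCount (cellBidegree p) (s 0, s 1, s 2) : ℚ)

variable {p} in
/-- The exponent of the monomial `t₁ ^ (p_i - k) * t₂ ^ k * z`. -/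
noncomputable def cellExponent (c : CellIndex p) : Fin 3 →₀ ℕ :=
  Finsupp.single 0 (p.get c.1 - c.2) + Finsupp.single 1 (c.2 : ℕ) + Finsupp.single 2 1

variable {p} in
theorem cellExponent_apply (c : CellIndex p) : cellExponent c 0 = p.get c.1 - c.2 ∧
    cellExponent c 1 = c.2 ∧ cellExponent c 2 = 1 := by
  simp [cellExponent]

variable {p} in
theorem cellBidegree_eq (c : CellIndex p) :
    cellBidegree p c =
      ((cellExponent c 0 : ℤ), (cellExponent c 1 : ℤ), (cellExponent c 2 : ℤ)) := by
  obtain ⟨h0, h1, h2⟩ := cellExponent_apply c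
  have := c.2.isLt
  rw [h0, h1, h2, Nat.cast_sub (by omega)]
  rfl

theorem bicountSeries_mul :
    bicountSeries p * ∏ c : CellIndex p, (1 - monomial (cellExponent c) 1) = 1 := by
  refine Eq.trans ?_ (geometricSeries_prod (cellExponent (p := p)) 2
    fun c => (cellExponent_apply c).2.2)
  congr 1
  funext s
  change (monomialCount (cellBidegree p) (s 0, s 1, s 2) : ℚ) = (Nat.card _ : ℚ)
  rw [monomialCount, Nat.cast_inj]
  refine Nat.card_congr (Equiv.subtypeEquivRight fun f => ?_)
  rw [Finsupp.weight_apply, Finsupp.sum_fintype f (fun c k => k • cellBidegree p c)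
    (fun _ => zero_smul _ _)]
  have h : ∑ c, f c • cellBidegree p c = ((((∑ c, f c • cellExponent c) 0 : ℕ) : ℤ),
      (((∑ c, f c • cellExponent c) 1 : ℕ) : ℤ), (((∑ c, f c • cellExponent c) 2 : ℕ) : ℤ)) := by
    simp only [cellBidegree_eq, Finsupp.finsetSum_apply, Finsupp.smul_apply, smul_eq_mul]
    refine Prod.ext ?_ (Prod.ext ?_ ?_)
    all_goals
      simp only [Prod.fst_sum, Prod.snd_sum]
      push_cast
      exact Finset.sum_congr rfl fun c _ => nsmul_eq_mul _ _
  rw [h, Prod.ext_iff, Prod.ext_iff]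
  simp only [Nat.cast_inj]
  constructor
  · rintro ⟨h0, h1, h2⟩
    ext i
    fin_cases i
    exacts [h0, h1, h2]
  · rintro rfl
    exact ⟨rfl, rfl, rfl⟩

theorem monomialCount_neg {g : ℤ × ℤ × ℤ} (hg : g.1 < 0 ∨ g.2.1 < 0) :
    monomialCount (cellBidegree p) g = 0 := by
  have : IsEmpty {s : CellIndex p →₀ ℕ // Finsupp.weight (cellBidegree p) s = g} := by
    refine ⟨fun ⟨s, hs⟩ => ?_⟩
    rw [Finsupp.weight_apply, Finsupp.sum] at hs
    rcases hg with hg | hg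
    · refine hg.not_ge ?_
      rw [← hs, Prod.fst_sum]
      refine Finset.sum_nonneg fun c _ => ?_
      rw [cellBidegree_eq]
      exact nsmul_nonneg (Nat.cast_nonneg _) _
    · refine hg.not_ge ?_
      rw [← hs, Prod.snd_sum, Prod.fst_sum]
      refine Finset.sum_nonneg fun c _ => ?_
      rw [cellBidegree_eq]
      exact nsmul_nonneg (Nat.cast_nonneg _) _
  exact Nat.card_of_isEmpty

/-- The generating function of the dimensions of the spaces of forms of given weight in the image of
the Magnus embedding (`coeff_weightSeries`). The summands after the product are corrections in
degrees zero and one. -/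
noncomputable def weightSeries : MvPowerSeries (Fin 3) ℚ :=
  ((∑ c : CellIndex p, monomial (cellExponent c) 1) - 1) * bicountSeries p + 1 +
    ∑ c : CellIndex p, monomial (cellExponent c) 1

variable (K : Type*) [Field K] [CharZero K]

theorem finrank_magnusWeightSpace_neg {g : ℤ × ℤ × ℤ} (hg : g.2.1 < 0) (hn : 1 ≤ g.2.2) :
    Module.finrank K (magnusWeightSpace K (cellBidegree p) g.2.2 g) = 0 := by
  let l : ℤ × ℤ × ℤ →+ ℤ := (AddMonoidHom.snd ℤ ℤ).comp (AddMonoidHom.snd ℤ (ℤ × ℤ))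
  have h := finrank_magnusWeightSpace K (w := cellBidegree p) (l := l) (fun _ => rfl) hn
  have h0 : ∀ c, monomialCount (cellBidegree p) (g - cellBidegree p c) = 0 := fun c => by
    refine monomialCount_neg p (Or.inr ?_)
    rw [cellBidegree_eq]
    change g.2.1 - (cellExponent c 1 : ℤ) < 0
    omega
  simp only [h0, monomialCount_neg p (Or.inr hg)] at h
  have h' : (Module.finrank K (magnusWeightSpace K (cellBidegree p) (l g) g) : ℤ) = 0 := by
    simpa using h
  exact_mod_cast h'

theorem coeff_weightSeries_of_eq_zero {s : Fin 3 →₀ ℕ} (hs : s 2 = 0) :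
    coeff s (weightSeries p) = 0 := by
  classical
  have hle : ∀ c : CellIndex p, ¬ cellExponent c ≤ s := fun c h => by
    have := h 2
    rw [(cellExponent_apply c).2.2, hs] at this
    omega
  have hne : ∀ c : CellIndex p, s ≠ cellExponent c := fun c h => hle c h.ge
  let l : ℤ × ℤ × ℤ →+ ℤ := (AddMonoidHom.snd ℤ ℤ).comp (AddMonoidHom.snd ℤ (ℤ × ℤ))
  have h0 := monomialCount_degree_zero (w := cellBidegree p) (l := l) (fun _ => rfl)
    (g := ((s 0 : ℤ), (s 1 : ℤ), (s 2 : ℤ))) (by change (s 2 : ℤ) = 0; rw [hs]; rfl)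
  have h1 : coeff s (bicountSeries p) = if s = 0 then 1 else 0 := by
    change (monomialCount (cellBidegree p) _ : ℚ) = _
    rw [h0, Nat.cast_ite, Nat.cast_one, Nat.cast_zero]
    refine if_congr ?_ rfl rfl
    rw [Prod.ext_iff, Prod.ext_iff]
    simp only [Prod.fst_zero, Prod.snd_zero, Nat.cast_eq_zero]
    constructor
    · rintro ⟨h0, h1, h2⟩
      ext i
      fin_cases i
      exacts [h0, h1, h2]
    · rintro rfl
      exact ⟨rfl, rfl, rfl⟩
  simp only [weightSeries, sub_mul, one_mul, map_add, map_sub, Finset.sum_mul, map_sum,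
    coeff_monomial_mul, hle, if_false, coeff_monomial, hne, h1, coeff_one, Finset.sum_const_zero]
  ring

theorem coeff_weightSeries {s : Fin 3 →₀ ℕ} (hs : 1 ≤ s 2) : coeff s (weightSeries p) =
    Module.finrank K (magnusWeightSpace K (cellBidegree p) (s 2) (s 0, s 1, s 2)) := by
  classical
  let l : ℤ × ℤ × ℤ →+ ℤ := (AddMonoidHom.snd ℤ ℤ).comp (AddMonoidHom.snd ℤ (ℤ × ℤ))
  have hl : ∀ c, l (cellBidegree p c) = 1 := fun _ => rfl
  have h := finrank_magnusWeightSpace K hl (g := ((s 0 : ℤ), (s 1 : ℤ), (s 2 : ℤ)))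
    (by change (1 : ℤ) ≤ s 2; exact_mod_cast hs)
  have h1 : ∀ c : CellIndex p, coeff s (monomial (cellExponent c) 1 * bicountSeries p) =
      (monomialCount (cellBidegree p)
        (((s 0 : ℤ), (s 1 : ℤ), (s 2 : ℤ)) - cellBidegree p c) : ℚ) := by
    intro c
    rw [coeff_monomial_mul, one_mul]
    split_ifs with hle
    · change (monomialCount (cellBidegree p) _ : ℚ) = _
      congr 2
      rw [cellBidegree_eq]
      simp only [Finsupp.tsub_apply, Prod.mk_sub_mk]
      rw [Nat.cast_sub (hle 0), Nat.cast_sub (hle 1), Nat.cast_sub (hle 2)]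
    · rw [monomialCount_neg, Nat.cast_zero]
      rw [cellBidegree_eq]
      change (s 0 : ℤ) - cellExponent c 0 < 0 ∨ (s 1 : ℤ) - cellExponent c 1 < 0
      by_contra hcon
      push Not at hcon
      refine hle fun i => ?_
      have h2 := (cellExponent_apply c).2.2
      fin_cases i
      · change cellExponent c 0 ≤ s 0
        omega
      · change cellExponent c 1 ≤ s 1
        omega
      · change cellExponent c 2 ≤ s 2
        omega
  have h2 : (if l ((s 0 : ℤ), (s 1 : ℤ), (s 2 : ℤ)) = 1 then
      (monomialCount (cellBidegree p) ((s 0 : ℤ), (s 1 : ℤ), (s 2 : ℤ)) : ℤ) else 0) =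
      ∑ c : CellIndex p, if s = cellExponent c then 1 else 0 := by
    have hiff : ∀ c : CellIndex p, s = cellExponent c ↔
        cellBidegree p c = ((s 0 : ℤ), (s 1 : ℤ), (s 2 : ℤ)) := by
      intro c
      rw [cellBidegree_eq, Prod.ext_iff, Prod.ext_iff]
      simp only [Nat.cast_inj]
      constructor
      · rintro rfl
        exact ⟨rfl, rfl, rfl⟩
      · rintro ⟨h0, h1, h2⟩
        ext i
        fin_cases i
        exacts [h0.symm, h1.symm, h2.symm]
    split_ifs with h3
    · rw [monomialCount_degree_one hl h3]
      push_cast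
      exact Finset.sum_congr rfl fun c _ => (if_congr (hiff c) rfl rfl).symm
    · refine (Finset.sum_eq_zero fun c _ => if_neg fun hc => h3 ?_).symm
      rw [← (hiff c).1 hc]
      rfl
  rw [h2] at h
  have h' := congrArg (Int.cast : ℤ → ℚ) h
  push_cast at h'
  refine Eq.trans ?_ h'.symm
  simp only [weightSeries, sub_mul, one_mul, map_add, map_sub, Finset.sum_mul, map_sum, h1,
    coeff_monomial, coeff_one]
  have h0 : s ≠ 0 := by rintro rfl; exact absurd hs (by simp)
  rw [if_neg h0, add_zero]
  rfl

variable {p K}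

/-- The bigraded Hilbert series is the series `R` that is supported at the exponents with `n₁ ≥ n₂`
and has the antisymmetrization `t₁ R - t₂ R'`, where `R'` is the mirror image of `R`: the two terms
have disjoint supports. -/
theorem IsJordanBasis.bigradedHilbertSeries_eq_of_antisymm {d : ℕ}
    {δ : LieDerivation K (Alg K d) (Alg K d)} {e : CellIndex p → Alg K d}
    (he : IsJordanBasis δ p e) {R : MvPowerSeries (Fin 3) ℚ} (hR : R ∈ dominantSubring)
    (h : (X 0 - X 1) * weightSeries p = X 0 * R - X 1 * swapVars R) :
    bigradedHilbertSeries δ p e = R := by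
  classical
  have hX0 : ∀ (f : MvPowerSeries (Fin 3) ℚ) s, coeff (Finsupp.single 0 1 + s) (X 0 * f) =
      coeff s f := fun f s => by
    rw [X, coeff_add_monomial_mul, one_mul]
  -- the coefficients of the antisymmetrization at the exponents `(s 0 + 1, s 1, s 2)`
  have key : ∀ s : Fin 3 →₀ ℕ, s 1 ≤ s 0 → coeff s R = coeff s (weightSeries p) -
      if s 1 = 0 then 0 else
        coeff (Finsupp.single 0 1 + (s - Finsupp.single 1 1)) (weightSeries p) := by
    intro s hs
    have hX1 : ∀ f : MvPowerSeries (Fin 3) ℚ, coeff (Finsupp.single 0 1 + s) (X 1 * f) =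
        if s 1 = 0 then 0 else coeff (Finsupp.single 0 1 + (s - Finsupp.single 1 1)) f := by
      intro f
      rw [X, coeff_monomial_mul, one_mul]
      by_cases h1 : s 1 = 0
      · rw [if_pos h1, if_neg]
        intro hle
        have := hle 1
        simp [h1] at this
      · have hle : Finsupp.single 1 1 ≤ s := by
          rw [Finsupp.single_le_iff]
          omega
        rw [if_neg h1, if_pos (hle.trans le_add_self), add_tsub_assoc_of_le hle]
    have hc := congrArg (coeff (Finsupp.single 0 1 + s)) h
    rw [sub_mul, map_sub, map_sub, hX0, hX0, hX1, hX1] at hc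
    have h0 : (if s 1 = 0 then 0 else
        coeff (Finsupp.single 0 1 + (s - Finsupp.single 1 1)) (swapVars R)) = 0 := by
      split_ifs
      · rfl
      · refine coeff_swapVars hR ?_
        simp only [Finsupp.add_apply, Finsupp.tsub_apply]
        rw [Finsupp.single_eq_of_ne (by decide), Finsupp.single_eq_same,
          Finsupp.single_eq_same, Finsupp.single_eq_of_ne (by decide)]
        omega
    rw [h0, sub_zero] at hc
    exact hc.symm
  ext s
  change (Module.finrank K (biconstants δ p e (s 0) (s 1) (s 2)) : ℚ) = coeff s R
  rcases Nat.eq_zero_or_pos (s 2) with h2 | h2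
  · have hbot : bicomponent p e (s 0) (s 1) (s 2) = ⊥ := by
      rw [bicomponent, Submodule.span_eq_bot, h2]
      rintro _ ⟨m, hm, -⟩
      exact absurd hm.1 m.length_pos.ne'
    rw [biconstants, hbot, inf_bot_eq, finrank_bot, Nat.cast_zero]
    rcases le_or_gt (s 1) (s 0) with h1 | h1
    · rw [key s h1, coeff_weightSeries_of_eq_zero p h2, coeff_weightSeries_of_eq_zero p, ite_self,
        sub_zero]
      simp [h2]
    · exact (hR s h1).symm
  · have hfin := congrArg (Int.cast : ℤ → ℚ) (he.finrank_biconstants (n₁ := s 0) (n₂ := s 1) h2)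
    rw [Int.cast_natCast] at hfin
    rw [hfin]
    rcases le_or_gt (s 1) (s 0) with h1 | h1
    · rw [if_pos h1, key s h1, coeff_weightSeries p K h2]
      push_cast
      congr 1
      split_ifs with h3
      · rw [h3, finrank_magnusWeightSpace_neg p K
          (g := ((s 0 : ℤ) + 1, ((0 : ℕ) : ℤ) - 1, (s 2 : ℤ)))
          (by change ((0 : ℕ) : ℤ) - 1 < 0; norm_num) (by change (1 : ℤ) ≤ s 2; exact_mod_cast h2),
          Nat.cast_zero]
      · have e0 : (Finsupp.single 0 1 + (s - Finsupp.single 1 1) : Fin 3 →₀ ℕ) 0 = s 0 + 1 := by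
          simp [add_comm]
        have e1 : (Finsupp.single 0 1 + (s - Finsupp.single 1 1) : Fin 3 →₀ ℕ) 1 = s 1 - 1 := by
          simp
        have e2 : (Finsupp.single 0 1 + (s - Finsupp.single 1 1) : Fin 3 →₀ ℕ) 2 = s 2 := by
          simp
        rw [coeff_weightSeries p K (by rw [e2]; exact h2), e0, e1, e2, Nat.cast_add,
          Nat.cast_one, Nat.cast_sub (by omega), Nat.cast_one]
    · rw [if_neg (by omega), hR s h1, Int.cast_zero]

/-- The values of a polynomial at `t₁`, `t₁ t₂` and `z` belong to the subring. -/
theorem aeval_mem_dominantSubring (P : MvPolynomial (Fin 3) ℚ) :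
    MvPolynomial.aeval ![X 0, X 0 * X 1, X 2] P ∈ dominantSubring := by
  induction P using MvPolynomial.induction_on with
  | C r =>
    rw [MvPolynomial.aeval_C]
    exact monomial_mem_dominantSubring (s := 0) le_rfl r
  | add P Q hP hQ =>
    rw [map_add]
    exact add_mem hP hQ
  | mul_X P i hP =>
    rw [map_mul, MvPolynomial.aeval_X]
    refine mul_mem hP ?_
    fin_cases i
    · exact monomial_mem_dominantSubring (by simp) 1
    · change X 0 * X 1 ∈ dominantSubring
      rw [X, X, monomial_mul_monomial]
      exact monomial_mem_dominantSubring (by simp) _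
    · exact monomial_mem_dominantSubring (by simp) 1

theorem swapVars_aeval (P : MvPolynomial (Fin 3) ℚ) :
    swapVars (MvPolynomial.aeval ![X 0, X 0 * X 1, X 2] P) =
      MvPolynomial.aeval ![X 1, X 0 * X 1, X 2] P := by
  rw [MvPolynomial.comp_aeval_apply]
  congr 2
  funext i
  fin_cases i
  · exact rename_X _ 0
  · change swapVars (X 0 * X 1) = X 0 * X 1
    rw [map_mul, mul_comm]
    exact congrArg₂ _ (rename_X _ 1) (rename_X _ 0)
  · exact rename_X _ 2

/-- The bigraded Hilbert series is `L + N / D` for polynomials `L`, `N`, `D` in `t₁`, `t₁ t₂` and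
`z`, if the antisymmetrization, cleared of its denominators, is as it should be. Such polynomials
are supported at the exponents with `n₁ ≥ n₂`, and the exchange of `t₁` and `t₂` amounts to
evaluation at `t₂`, `t₁ t₂` and `z`. In `h`, `S` is the sum of the variables and `1 / U` the product
of their geometric series. -/
theorem IsJordanBasis.bigradedHilbertSeries_eq {d : ℕ}
    {δ : LieDerivation K (Alg K d) (Alg K d)} {e : CellIndex p → Alg K d}
    (he : IsJordanBasis δ p e) (L N D : MvPolynomial (Fin 3) ℚ)
    {L' N' D' : MvPowerSeries (Fin 3) ℚ} (hD : constantCoeff D' = 1)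
    (hL' : L' = MvPolynomial.aeval ![X 0, X 0 * X 1, X 2] L)
    (hN' : N' = MvPolynomial.aeval ![X 0, X 0 * X 1, X 2] N)
    (hD' : D' = MvPolynomial.aeval ![X 0, X 0 * X 1, X 2] D)
    (h : ∀ t₁ t₂ z S U : MvPowerSeries (Fin 3) ℚ,
      S = (p.map fun a => ∑ k ∈ Finset.range (a + 1), t₁ ^ (a - k) * t₂ ^ k * z).sum →
      U = (p.map fun a => ∏ k ∈ Finset.range (a + 1), (1 - t₁ ^ (a - k) * t₂ ^ k * z)).prod →
      (t₁ - t₂) * ((S - 1) + (1 + S) * U) * MvPolynomial.aeval ![t₁, t₁ * t₂, z] D *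
          MvPolynomial.aeval ![t₂, t₁ * t₂, z] D =
        U * (t₁ * MvPolynomial.aeval ![t₁, t₁ * t₂, z] (L * D + N) *
            MvPolynomial.aeval ![t₂, t₁ * t₂, z] D -
          t₂ * MvPolynomial.aeval ![t₂, t₁ * t₂, z] (L * D + N) *
            MvPolynomial.aeval ![t₁, t₁ * t₂, z] D)) :
    bigradedHilbertSeries δ p e = L' + N' * D'⁻¹ := by
  have hmon : ∀ c : CellIndex p, (monomial (cellExponent c) 1 : MvPowerSeries (Fin 3) ℚ) =
      X 0 ^ (p.get c.1 - c.2) * X 1 ^ (c.2 : ℕ) * X 2 := by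
    intro c
    rw [X_pow_eq, X_pow_eq, X, monomial_mul_monomial, monomial_mul_monomial, mul_one, mul_one]
    rfl
  have hS := sum_cellIndex p fun a k => (X 0 ^ (a - k) * X 1 ^ k * X 2 : MvPowerSeries (Fin 3) ℚ)
  have hP := prod_cellIndex p fun a k =>
    (1 - X 0 ^ (a - k) * X 1 ^ k * X 2 : MvPowerSeries (Fin 3) ℚ)
  have hF := bicountSeries_mul p
  refine he.bigradedHilbertSeries_eq_of_antisymm ?_ ?_
  · rw [hL', hN', hD']
    exact add_mem (aeval_mem_dominantSubring L) (mul_mem (aeval_mem_dominantSubring N)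
      (inv_mem_dominantSubring (aeval_mem_dominantSubring D)))
  have h' := h _ _ _ _ _ hS hP
  rw [← swapVars_aeval, ← swapVars_aeval, map_add, map_mul, ← hL', ← hN', ← hD'] at h'
  rw [weightSeries]
  simp only [hmon] at hF ⊢
  generalize ∑ c : CellIndex p, (X 0 ^ (p.get c.1 - c.2) * X 1 ^ (c.2 : ℕ) * X 2 :
    MvPowerSeries (Fin 3) ℚ) = S at h' ⊢
  generalize ∏ c : CellIndex p, (1 - X 0 ^ (p.get c.1 - c.2) * X 1 ^ (c.2 : ℕ) * X 2 :
    MvPowerSeries (Fin 3) ℚ) = U at h' hF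
  have hD2 : D' * D'⁻¹ = 1 := MvPowerSeries.mul_inv_cancel D' (by rw [hD]; exact one_ne_zero)
  have hD3 : swapVars D' * swapVars D'⁻¹ = 1 := by rw [← map_mul, hD2, map_one]
  have hu : IsUnit (D' * swapVars D') :=
    (IsUnit.of_mul_eq_one _ hD2).mul (IsUnit.of_mul_eq_one _ hD3)
  refine hu.mul_right_cancel ?_
  simp only [map_add, map_mul] at h' ⊢
  linear_combination bicountSeries p * h' - (X 0 - X 1) * (1 + S) * D' * swapVars D' * hF +
    (X 0 * (L' * D' + N') * swapVars D' - X 1 * (swapVars L' * swapVars D' + swapVars N') * D') *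
      hF - X 0 * N' * swapVars D' * hD2 + X 1 * swapVars N' * D' * hD3

end BigradedSeries

/-! ### The bigraded Hilbert series in small dimensions -/

section BigradedTable

/-! The three polynomials in each proof are the linear term, the numerator and the denominator of
the series, with `X 0`, `X 1` and `X 2` standing for `t₁`, `t₁ t₂` and `z`. -/

open MvPolynomial

set_option linter.unusedSimpArgs false

variable {K : Type*} [Field K] [CharZero K] {d : ℕ} {t₁ t₂ z : MvPowerSeries (Fin 3) ℚ}

theorem bigradedHilbertSeries_one (h₁ : t₁ = MvPowerSeries.X 0)
    (h₂ : t₂ = MvPowerSeries.X 1) (hz : z = MvPowerSeries.X 2)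
    {δ : LieDerivation K (Alg K d) (Alg K d)} {e : CellIndex [1] → Alg K d}
    (he : IsJordanBasis δ [1] e) :
    bigradedHilbertSeries δ [1] e =
      t₁ * z + t₁ * t₂ * z ^ 2 * (1 - t₁ * z)⁻¹ := by
  subst h₁ h₂ hz
  refine he.bigradedHilbertSeries_eq (X 0 * X 2)
    (X 1 * X 2 ^ 2)
    (1 - X 0 * X 2)
    (by simp) ?_ ?_ ?_ fun t₁ t₂ z S U hS hU => ?_
  · simp only [map_mul, map_pow, map_ofNat, aeval_X, Matrix.cons_val]
  · simp only [map_add, map_sub, map_mul, map_pow, map_ofNat, aeval_X, Matrix.cons_val]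
  · simp only [map_sub, map_mul, map_pow, map_one, aeval_X, Matrix.cons_val]
  simp only [List.map_cons, List.map_nil, List.sum_cons, List.sum_nil, Finset.sum_range_succ,
    Finset.sum_range_zero, List.prod_cons, List.prod_nil, Finset.prod_range_succ,
    Finset.prod_range_zero] at hS hU
  rw [hS, hU]
  simp only [map_add, map_sub, map_mul, map_pow, map_one, map_ofNat, aeval_X, Matrix.cons_val]
  ring

theorem bigradedHilbertSeries_two (h₁ : t₁ = MvPowerSeries.X 0)
    (h₂ : t₂ = MvPowerSeries.X 1) (hz : z = MvPowerSeries.X 2)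
    {δ : LieDerivation K (Alg K d) (Alg K d)} {e : CellIndex [2] → Alg K d}
    (he : IsJordanBasis δ [2] e) :
    bigradedHilbertSeries δ [2] e =
      t₁ ^ 2 * z + t₁ ^ 3 * t₂ * z ^ 2 * ((1 - t₁ ^ 2 * z) * (1 - t₁ * t₂ * z))⁻¹ := by
  subst h₁ h₂ hz
  refine he.bigradedHilbertSeries_eq (X 0 ^ 2 * X 2)
    (X 0 ^ 2 * X 1 * X 2 ^ 2)
    ((1 - X 0 ^ 2 * X 2) * (1 - X 1 * X 2))
    (by simp) ?_ ?_ ?_ fun t₁ t₂ z S U hS hU => ?_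
  · simp only [map_mul, map_pow, map_ofNat, aeval_X, Matrix.cons_val]
  · simp only [map_add, map_sub, map_mul, map_pow, map_ofNat, aeval_X, Matrix.cons_val]
    ring
  · simp only [map_sub, map_mul, map_pow, map_one, aeval_X, Matrix.cons_val]
  simp only [List.map_cons, List.map_nil, List.sum_cons, List.sum_nil, Finset.sum_range_succ,
    Finset.sum_range_zero, List.prod_cons, List.prod_nil, Finset.prod_range_succ,
    Finset.prod_range_zero] at hS hU
  rw [hS, hU]
  simp only [map_add, map_sub, map_mul, map_pow, map_one, map_ofNat, aeval_X, Matrix.cons_val]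
  ring

set_option maxHeartbeats 1000000 in
theorem bigradedHilbertSeries_three (h₁ : t₁ = MvPowerSeries.X 0)
    (h₂ : t₂ = MvPowerSeries.X 1) (hz : z = MvPowerSeries.X 2)
    {δ : LieDerivation K (Alg K d) (Alg K d)} {e : CellIndex [3] → Alg K d}
    (he : IsJordanBasis δ [3] e) :
    bigradedHilbertSeries δ [3] e =
      t₁ ^ 3 * z +
        t₁ ^ 3 * t₂ * z ^ 2 *
          (t₁ ^ 2 + t₂ ^ 2 + t₁ ^ 4 * t₂ ^ 4 * z ^ 2 + t₁ ^ 5 * t₂ ^ 6 * z ^ 3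
            - t₁ ^ 8 * t₂ ^ 6 * z ^ 4) *
          ((1 - t₁ ^ 3 * z) * (1 - t₁ ^ 2 * t₂ * z) * (1 - t₁ ^ 6 * t₂ ^ 6 * z ^ 4))⁻¹ := by
  subst h₁ h₂ hz
  refine he.bigradedHilbertSeries_eq (X 0 ^ 3 * X 2)
    (X 1 * X 2 ^ 2 * (X 0 ^ 4 + X 1 ^ 2 + X 0 ^ 2 * X 1 ^ 4 * X 2 ^ 2
      + X 0 * X 1 ^ 6 * X 2 ^ 3 - X 0 ^ 4 * X 1 ^ 6 * X 2 ^ 4))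
    ((1 - X 0 ^ 3 * X 2) * (1 - X 0 * X 1 * X 2) * (1 - X 1 ^ 6 * X 2 ^ 4))
    (by simp) ?_ ?_ ?_ fun t₁ t₂ z S U hS hU => ?_
  · simp only [map_mul, map_pow, map_ofNat, aeval_X, Matrix.cons_val]
  · simp only [map_add, map_sub, map_mul, map_pow, map_ofNat, aeval_X, Matrix.cons_val]
    ring
  · simp only [map_sub, map_mul, map_pow, map_one, aeval_X, Matrix.cons_val]
    ring
  simp only [List.map_cons, List.map_nil, List.sum_cons, List.sum_nil, Finset.sum_range_succ,
    Finset.sum_range_zero, List.prod_cons, List.prod_nil, Finset.prod_range_succ,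
    Finset.prod_range_zero] at hS hU
  rw [hS, hU]
  simp only [map_add, map_sub, map_mul, map_pow, map_one, map_ofNat, aeval_X, Matrix.cons_val]
  ring

theorem bigradedHilbertSeries_one_one (h₁ : t₁ = MvPowerSeries.X 0)
    (h₂ : t₂ = MvPowerSeries.X 1) (hz : z = MvPowerSeries.X 2)
    {δ : LieDerivation K (Alg K d) (Alg K d)} {e : CellIndex [1, 1] → Alg K d}
    (he : IsJordanBasis δ [1, 1] e) :
    bigradedHilbertSeries δ [1, 1] e =
      2 * t₁ * z +
        t₁ * z ^ 2 * (t₁ + 3 * t₂ - t₁ ^ 2 * t₂ * z ^ 2) *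
          ((1 - t₁ * z) ^ 2 * (1 - t₁ * t₂ * z ^ 2))⁻¹ := by
  subst h₁ h₂ hz
  refine he.bigradedHilbertSeries_eq (2 * X 0 * X 2)
    (X 2 ^ 2 * (X 0 ^ 2 + 3 * X 1 - X 0 ^ 2 * X 1 * X 2 ^ 2))
    ((1 - X 0 * X 2) ^ 2 * (1 - X 1 * X 2 ^ 2))
    (by simp) ?_ ?_ ?_ fun t₁ t₂ z S U hS hU => ?_
  · simp only [map_mul, map_pow, map_ofNat, aeval_X, Matrix.cons_val]
  · simp only [map_add, map_sub, map_mul, map_pow, map_ofNat, aeval_X, Matrix.cons_val]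
    ring
  · simp only [map_sub, map_mul, map_pow, map_one, aeval_X, Matrix.cons_val]
  simp only [List.map_cons, List.map_nil, List.sum_cons, List.sum_nil, Finset.sum_range_succ,
    Finset.sum_range_zero, List.prod_cons, List.prod_nil, Finset.prod_range_succ,
    Finset.prod_range_zero] at hS hU
  rw [hS, hU]
  simp only [map_add, map_sub, map_mul, map_pow, map_one, map_ofNat, aeval_X, Matrix.cons_val]
  ring

set_option maxHeartbeats 1000000 in
theorem bigradedHilbertSeries_one_one_one (h₁ : t₁ = MvPowerSeries.X 0)
    (h₂ : t₂ = MvPowerSeries.X 1) (hz : z = MvPowerSeries.X 2)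
    {δ : LieDerivation K (Alg K d) (Alg K d)} {e : CellIndex [1, 1, 1] → Alg K d}
    (he : IsJordanBasis δ [1, 1, 1] e) :
    bigradedHilbertSeries δ [1, 1, 1] e =
      3 * t₁ * z +
        t₁ * z ^ 2 *
          (3 * (t₁ + 2 * t₂) + t₁ * (-t₁ + t₂) * z - 9 * t₁ ^ 2 * t₂ * z ^ 2
            + 3 * t₁ ^ 2 * t₂ * (-3 * t₂ + t₁) * z ^ 3
            + t₁ ^ 2 * t₂ ^ 2 * (9 * t₁ - t₂) * z ^ 4
            + 3 * t₁ ^ 3 * t₂ ^ 2 * (t₂ - t₁) * z ^ 5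
            - 3 * t₁ ^ 4 * t₂ ^ 3 * z ^ 6 + t₁ ^ 5 * t₂ ^ 3 * z ^ 7) *
          ((1 - t₁ * z) ^ 3 * (1 - t₁ * t₂ * z ^ 2) ^ 3)⁻¹ := by
  subst h₁ h₂ hz
  refine he.bigradedHilbertSeries_eq (3 * X 0 * X 2)
    (X 2 ^ 2 * (3 * (X 0 ^ 2 + 2 * X 1) + X 0 * (X 1 - X 0 ^ 2) * X 2
      - 9 * X 0 ^ 2 * X 1 * X 2 ^ 2 + 3 * X 0 * X 1 * (X 0 ^ 2 - 3 * X 1) * X 2 ^ 3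
      + X 1 ^ 2 * (9 * X 0 ^ 2 - X 1) * X 2 ^ 4 + 3 * X 0 * X 1 ^ 2 * (X 1 - X 0 ^ 2) * X 2 ^ 5
      - 3 * X 0 ^ 2 * X 1 ^ 3 * X 2 ^ 6 + X 0 ^ 3 * X 1 ^ 3 * X 2 ^ 7))
    ((1 - X 0 * X 2) ^ 3 * (1 - X 1 * X 2 ^ 2) ^ 3)
    (by simp) ?_ ?_ ?_ fun t₁ t₂ z S U hS hU => ?_
  · simp only [map_mul, map_pow, map_ofNat, aeval_X, Matrix.cons_val]
  · simp only [map_add, map_sub, map_mul, map_pow, map_ofNat, aeval_X, Matrix.cons_val]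
    ring
  · simp only [map_sub, map_mul, map_pow, map_one, aeval_X, Matrix.cons_val]
  simp only [List.map_cons, List.map_nil, List.sum_cons, List.sum_nil, Finset.sum_range_succ,
    Finset.sum_range_zero, List.prod_cons, List.prod_nil, Finset.prod_range_succ,
    Finset.prod_range_zero] at hS hU
  rw [hS, hU]
  simp only [map_add, map_sub, map_mul, map_pow, map_one, map_ofNat, aeval_X, Matrix.cons_val]
  ring

end BigradedTable

/-! ### Jordan types in small dimensions -/

/-- The Jordan types without cells of size one, for `2 ≤ d ≤ 6`: the partitions of `d` into parts
`p_i + 1 ≥ 2`. -/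
theorem HasJordanCells.eq_of_le_six {K : Type*} [Field K] [CharZero K] {d : ℕ}
    {δ : LieDerivation K (Alg K d) (Alg K d)} {p : List ℕ} (hδ : HasJordanCells δ p)
    (hd : 2 ≤ d) (hd' : d ≤ 6) (hp : 0 ∉ p) :
    (d = 2 ∧ p = [1]) ∨ (d = 3 ∧ p = [2]) ∨ (d = 4 ∧ (p = [3] ∨ p = [1, 1])) ∨
      (d = 5 ∧ (p = [4] ∨ p = [2, 1])) ∨
      (d = 6 ∧ (p = [5] ∨ p = [3, 1] ∨ p = [2, 2] ∨ p = [1, 1, 1])) := by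
  obtain ⟨hs, e, he⟩ := hδ
  have hsum := he.sum_eq
  -- every cell has size at least 2, so there are at most three cells
  rcases p with _ | ⟨a, _ | ⟨b, _ | ⟨c, _ | ⟨q, p⟩⟩⟩⟩ <;>
    simp at hs hp hsum ⊢ <;> omega

end FreeMetabelian

theorem mainTheorem8 (K : Type*) [Field K] [CharZero K] :
    -- the Jordan types of Weitzenböck derivations without 1 × 1 cells, for 2 ≤ d ≤ 6
    (∀ (d : ℕ) (δ : LieDerivation K (Alg K d) (Alg K d)) (p : List ℕ),
      2 ≤ d → d ≤ 6 → IsWeitzenbock δ → HasJordanCells δ p → 0 ∉ p →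
        (d = 2 ∧ p = [1]) ∨ (d = 3 ∧ p = [2]) ∨ (d = 4 ∧ (p = [3] ∨ p = [1, 1])) ∨
        (d = 5 ∧ (p = [4] ∨ p = [2, 1])) ∨
        (d = 6 ∧ (p = [5] ∨ p = [3, 1] ∨ p = [2, 2] ∨ p = [1, 1, 1]))) ∧
    -- bigraded Hilbert series
    (∀ t₁ t₂ z : MvPowerSeries (Fin 3) ℚ,
     t₁ = MvPowerSeries.X 0 → t₂ = MvPowerSeries.X 1 → z = MvPowerSeries.X 2 →
     (∀ (δ : LieDerivation K (Alg K 2) (Alg K 2)) (e : CellIndex [1] → Alg K 2),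
        IsJordanBasis δ [1] e →
        bigradedHilbertSeries δ [1] e = t₁ * z + t₁ * t₂ * z ^ 2 * (1 - t₁ * z)⁻¹) ∧
     (∀ (δ : LieDerivation K (Alg K 3) (Alg K 3)) (e : CellIndex [2] → Alg K 3),
        IsJordanBasis δ [2] e →
        bigradedHilbertSeries δ [2] e =
          t₁ ^ 2 * z + t₁ ^ 3 * t₂ * z ^ 2 * ((1 - t₁ ^ 2 * z) * (1 - t₁ * t₂ * z))⁻¹) ∧
     (∀ (δ : LieDerivation K (Alg K 4) (Alg K 4)) (e : CellIndex [3] → Alg K 4),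
        IsJordanBasis δ [3] e →
        bigradedHilbertSeries δ [3] e =
          t₁ ^ 3 * z +
            t₁ ^ 3 * t₂ * z ^ 2 *
              (t₁ ^ 2 + t₂ ^ 2 + t₁ ^ 4 * t₂ ^ 4 * z ^ 2 + t₁ ^ 5 * t₂ ^ 6 * z ^ 3
                - t₁ ^ 8 * t₂ ^ 6 * z ^ 4) *
              ((1 - t₁ ^ 3 * z) * (1 - t₁ ^ 2 * t₂ * z) * (1 - t₁ ^ 6 * t₂ ^ 6 * z ^ 4))⁻¹) ∧
     (∀ (δ : LieDerivation K (Alg K 4) (Alg K 4)) (e : CellIndex [1, 1] → Alg K 4),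
        IsJordanBasis δ [1, 1] e →
        bigradedHilbertSeries δ [1, 1] e =
          2 * t₁ * z +
            t₁ * z ^ 2 * (t₁ + 3 * t₂ - t₁ ^ 2 * t₂ * z ^ 2) *
              ((1 - t₁ * z) ^ 2 * (1 - t₁ * t₂ * z ^ 2))⁻¹) ∧
     (∀ (δ : LieDerivation K (Alg K 6) (Alg K 6)) (e : CellIndex [1, 1, 1] → Alg K 6),
        IsJordanBasis δ [1, 1, 1] e →
        bigradedHilbertSeries δ [1, 1, 1] e =
          3 * t₁ * z +
            t₁ * z ^ 2 *
              (3 * (t₁ + 2 * t₂) + t₁ * (-t₁ + t₂) * z - 9 * t₁ ^ 2 * t₂ * z ^ 2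
                + 3 * t₁ ^ 2 * t₂ * (-3 * t₂ + t₁) * z ^ 3
                + t₁ ^ 2 * t₂ ^ 2 * (9 * t₁ - t₂) * z ^ 4
                + 3 * t₁ ^ 3 * t₂ ^ 2 * (t₂ - t₁) * z ^ 5
                - 3 * t₁ ^ 4 * t₂ ^ 3 * z ^ 6 + t₁ ^ 5 * t₂ ^ 3 * z ^ 7) *
              ((1 - t₁ * z) ^ 3 * (1 - t₁ * t₂ * z ^ 2) ^ 3)⁻¹)) ∧
    -- graded Hilbert series
    (∀ z : PowerSeries ℚ, z = PowerSeries.X →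
     (∀ δ : LieDerivation K (Alg K 2) (Alg K 2), HasJordanCells δ [1] →
        hilbertSeries δ = z + z ^ 2 * (1 - z)⁻¹) ∧
     (∀ δ : LieDerivation K (Alg K 3) (Alg K 3), HasJordanCells δ [2] →
        hilbertSeries δ = z + z ^ 2 * ((1 - z) ^ 2)⁻¹) ∧
     (∀ δ : LieDerivation K (Alg K 4) (Alg K 4), HasJordanCells δ [3] →
        hilbertSeries δ =
          z + z ^ 2 * (2 + z ^ 2 + z ^ 3 - z ^ 4) * ((1 - z) ^ 2 * (1 - z ^ 4))⁻¹) ∧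
     (∀ δ : LieDerivation K (Alg K 4) (Alg K 4), HasJordanCells δ [1, 1] →
        hilbertSeries δ = 2 * z + z ^ 2 * (4 - z ^ 2) * ((1 - z) ^ 2 * (1 - z ^ 2))⁻¹) ∧
     (∀ δ : LieDerivation K (Alg K 5) (Alg K 5), HasJordanCells δ [4] →
        hilbertSeries δ =
          z + z ^ 2 * (2 + 2 * z + z ^ 2 - 2 * z ^ 4 + z ^ 5) *
            ((1 - z) ^ 2 * (1 - z ^ 2) * (1 - z ^ 3))⁻¹) ∧
     (∀ δ : LieDerivation K (Alg K 5) (Alg K 5), HasJordanCells δ [2, 1] →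
        hilbertSeries δ =
          2 * z + z ^ 2 * (4 + 2 * z ^ 2 - 3 * z ^ 3 + z ^ 4) *
            ((1 - z) ^ 3 * (1 - z ^ 3))⁻¹) ∧
     (∀ δ : LieDerivation K (Alg K 6) (Alg K 6), HasJordanCells δ [5] →
        hilbertSeries δ =
          z + z ^ 2 *
            (3 + 3 * z + 7 * z ^ 2 + 10 * z ^ 3 + 11 * z ^ 4 + 14 * z ^ 5 + 13 * z ^ 6
              + 16 * z ^ 7 + 12 * z ^ 8 + 8 * z ^ 9 + 10 * z ^ 10 + 3 * z ^ 11 + 5 * z ^ 12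
              - z ^ 13 + z ^ 14 - z ^ 16 + 2 * z ^ 17 - z ^ 18) *
            ((1 - z) ^ 2 * (1 - z ^ 4) * (1 - z ^ 6) * (1 - z ^ 8))⁻¹) ∧
     (∀ δ : LieDerivation K (Alg K 6) (Alg K 6), HasJordanCells δ [3, 1] →
        hilbertSeries δ =
          2 * z + z ^ 2 *
            (5 + 6 * z + 8 * z ^ 2 + 11 * z ^ 3 + 5 * z ^ 4 - 2 * z ^ 5 + 3 * z ^ 6
              - 2 * z ^ 7 + 2 * z ^ 9 - z ^ 10) *
            ((1 - z) ^ 2 * (1 - z ^ 2) * (1 - z ^ 4) ^ 2)⁻¹) ∧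
     (∀ δ : LieDerivation K (Alg K 6) (Alg K 6), HasJordanCells δ [2, 2] →
        hilbertSeries δ =
          2 * z + z ^ 2 * (5 + 8 * z - 6 * z ^ 3 + 2 * z ^ 4 + 2 * z ^ 5 - z ^ 6) *
            ((1 - z) ^ 2 * (1 - z ^ 2) ^ 3)⁻¹) ∧
     (∀ δ : LieDerivation K (Alg K 6) (Alg K 6), HasJordanCells δ [1, 1, 1] →
        hilbertSeries δ =
          3 * z + z ^ 2 * (9 + 9 * z - 6 * z ^ 3 + 2 * z ^ 4 + 2 * z ^ 5 - z ^ 6) *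
            ((1 - z) ^ 2 * (1 - z ^ 2) ^ 3)⁻¹)) := by
  refine ⟨fun d δ p hd hd' _ hδ hp => hδ.eq_of_le_six hd hd' hp, fun t₁ t₂ z h₁ h₂ hz => ?_,
    fun z hz => ?_⟩
  · exact ⟨fun δ e he => bigradedHilbertSeries_one h₁ h₂ hz he,
      fun δ e he => bigradedHilbertSeries_two h₁ h₂ hz he,
      fun δ e he => bigradedHilbertSeries_three h₁ h₂ hz he,
      fun δ e he => bigradedHilbertSeries_one_one h₁ h₂ hz he,
      fun δ e he => bigradedHilbertSeries_one_one_one h₁ h₂ hz he⟩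
  · subst hz
    exact ⟨fun δ hδ => hilbertSeries_one hδ, fun δ hδ => hilbertSeries_two hδ,
      fun δ hδ => hilbertSeries_three hδ, fun δ hδ => hilbertSeries_one_one hδ,
      fun δ hδ => hilbertSeries_four hδ, fun δ hδ => hilbertSeries_two_one hδ,
      fun δ hδ => hilbertSeries_five hδ, fun δ hδ => hilbertSeries_three_one hδ,
      fun δ hδ => hilbertSeries_two_two hδ, fun δ hδ => hilbertSeries_one_one_one hδ⟩
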